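/- **Setting.** Let $0<\nu^*\le\infty$ and consider a family of periodically forced planar Hamiltonians $H(x,y,\omega(\nu)t+\theta;\nu)=H_0(x,y;\nu)+H_1(x,y,\omega(\nu)t+\theta;\nu)$, $\nu\in[0,\nu^*)$, with $\dot x=\partial_yH$, $\dot y=-\partial_xH$, all of whose solutions exist for all times. Assume, for some $k>2$: 1. $H_0,H_1$ are $C^k$ in all arguments; $H_1$ is $2\pi$-periodic with zero mean in its phase argument. 2. For every $\nu\in[0,\nu^*)$ there is a hyperbolic periodic orbit $\gamma(\omega(\nu)t+\theta;\nu)$ (for $\omega=0$: a hyperbolic equilibrium of each system frozen at phase $\theta$), $C^1$ in the phase and $\nu$, with stable and unstable directions that can be chosen continuously in the phase and $\nu$ and $2\pi$-periodically in the phase; the directions chosen, and the branches of the manifolds to which they point, are called *left*. The left branches are invariant under the Poincaré map. 3. $\omega$ is $C^k$, maps $[0,\nu^*)$ onto $[0,\infty)$, and does not vanish on $(0,\nu^*)$. 4. For $\omega=0$ (that is, $\nu=0$) and every phase $\theta$, the left branches coincide and form a homoclinic loop depending smoothly ($C^1$) on $\theta$; the derivative in $\theta$ of the enclosed area is nonzero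 except at finitely many $\theta\in[0,2\pi]$. For $\nu\in(0,\nu^*)$ let $F$ be the time-$2\pi/\omega(\nu)$ map with initial phase $0$, and $\gamma(\nu)$ its hyperbolic fixed point. For a homoclinic point $p$ on the left branches let $U[\gamma,p]$, $U(\gamma,p)$ (resp. $S[\gamma,p]$, $S(\gamma,p)$) be the closed and open segments of the left unstable (resp. stable) branch from $\gamma(\nu)$ to $p$. The point $p$, and its orbit, is *primary* if $U(\gamma,p)\cap S(\gamma,p)=\emptyset$. It is *tangent* if the two manifolds are tangent at $p$, and *topologically transverse* if the unstable manifold crosses the stable one at $p$ from one side to the other. A *primary homoclinic bifurcation value* is a $\nu\in(0,\nu^*)$ for which some primary homoclinic orbit is tangent; a homoclinic orbit *undergoes a homoclinic bifurcation* at $\nu$ if it is tangent at $\nu$. Assume further: 5. For every $\nu\in(0,\nu^*)$ there are finitely many primary homoclinic orbits, at least two of them topologically transverse. 6. Every bounded open interval contains only finitely many primary homoclinic bifurcation values. **Lemma.** There are finite sets of labels $Lbl(\nu)\subset\mathbb R$ and points $p_0^r(\nu)$, $r\in Lbl(\nu)$, $\nu\in(0,\nu^*)$, such that for each $\nu$ the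 $p_0^r(\nu)$ are topologically transverse primary homoclinic points, every topologically transverse primary homoclinic orbit is $p^r(\nu)=\{F^ip_0^r(\nu)\}_{i\in\mathbb Z}$ for exactly one $r\in Lbl(\nu)$, and: * (Labels are piecewise constant and change only at homoclinic bifurcations of the labelled orbit.) $Lbl(\nu)$ is constant on every open interval in $(0,\nu^*)$ without primary homoclinic bifurcation values. Moreover, for every $\nu_0\in(0,\nu^*)$ and $r\in Lbl(\nu_0)$ such that $p^r(\nu_0)$ does not undergo a homoclinic bifurcation at $\nu_0$, one has $r\in Lbl(\nu)$ for all $\nu$ near $\nu_0$, and $\nu\mapsto p_0^r(\nu)$ is continuous near $\nu_0$. * (The labels respect the unstable ordering.) For $r,r'\in Lbl(\nu)$: $r<r'$ if and only if $U[\gamma(\nu),p_0^{r}(\nu)]\subsetneq U[\gamma(\nu),p_0^{r'}(\nu)]$. The points $p_0^r(\nu)$ lie in one fundamental segment: $U[\gamma(\nu),p_0^{r}(\nu)]\subsetneq U[\gamma(\nu),F p_0^{r'}(\nu)]$ for all $r,r'\in Lbl(\nu)$. -/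

import Mathlib

open Set Filter Topology MeasureTheory

noncomputable section

namespace FreqSpan

/-- The phase plane, with coordinates `(x, y)`. -/
abbrev Plane : Type := ℝ × ℝ

/-- The data of a one-parameter family of periodically forced Hamiltonians
`H(x, y, ω(ν) t + θ; ν) = H₀(x, y; ν) + H₁(x, y, ω(ν) t + θ; ν)`, `ν ∈ [0, ν*)`,
where `ν*` may be finite or infinite. -/
structure Family where
  nuStar : EReal
  H0 : ℝ → ℝ → ℝ → ℝ
  H1 : ℝ → ℝ → ℝ → ℝ → ℝ
  freq : ℝ → ℝ

namespace Family

variable (𝓗 : Family)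

/-- The parameter interval `[0, ν*)`. -/
def params : Set ℝ := {ν | 0 ≤ ν ∧ (ν : EReal) < 𝓗.nuStar}

/-- The parameters `ν ≠ 0`, i.e. `(0, ν*)`. -/
def posParams : Set ℝ := {ν | 0 < ν ∧ (ν : EReal) < 𝓗.nuStar}

/-- The total Hamiltonian, as a function of `x, y`, the phase `φ` and `ν`. -/
def H (x y φ ν : ℝ) : ℝ := 𝓗.H0 x y ν + 𝓗.H1 x y φ ν

/-- The Hamiltonian vector field `(∂H/∂y, -∂H/∂x)` at phase `φ`. -/
def field (φ ν : ℝ) (z : Plane) : Plane :=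
  (deriv (fun y => 𝓗.H z.1 y φ ν) z.2, -deriv (fun x => 𝓗.H x z.2 φ ν) z.1)

/-- `z` is a solution, defined for all times, of the forced system with initial phase `θ`.
When `ω(ν) = 0` this is the system frozen at the phase `θ`. -/
def IsSolution (ν θ : ℝ) (z : ℝ → Plane) : Prop :=
  ∀ t, HasDerivAt z (𝓗.field (𝓗.freq ν * t + θ) ν (z t)) t

/-- All solutions exist for all times (so the Poincaré map is globally defined). -/
def Complete : Prop :=
  ∀ ν ∈ 𝓗.params, ∀ θ : ℝ, ∀ z₀ : Plane, ∃ z : ℝ → Plane, z 0 = z₀ ∧ 𝓗.IsSolution ν θ z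

/-- The position at time `t` of the solution that starts at `z₀` at time `0` with phase `θ`. -/
def flow (ν θ t : ℝ) (z₀ : Plane) : Plane :=
  Classical.epsilon (fun z : ℝ → Plane => z 0 = z₀ ∧ 𝓗.IsSolution ν θ z) t

/-- The forcing period `2π / ω(ν)`. -/
def period (ν : ℝ) : ℝ := 2 * Real.pi / 𝓗.freq ν

/-- The Poincaré map `F_θ`, the time-`2π/ω` map with initial phase `θ`. -/
def poincare (ν θ : ℝ) (z : Plane) : Plane := 𝓗.flow ν θ (𝓗.period ν) z

/-- The iterate `F^n`, `n ∈ ℤ`, of the Poincaré map `F = F_0`: the flow over `n` periods. -/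
def iter (ν : ℝ) (n : ℤ) (z : Plane) : Plane := 𝓗.flow ν 0 (n * 𝓗.period ν) z

/-- `z` and `w` lie on the same orbit of the Poincaré map. -/
def SameOrbit (ν : ℝ) (z w : Plane) : Prop := ∃ n : ℤ, w = 𝓗.iter ν n z

end Family

/-- The periodic orbit `t ↦ γ(ω(ν) t + θ; ν)`, together with vectors tangent at its points to the
left branch of its unstable manifold (`eu`) and of its stable manifold (`es`), pointing into these
branches. All are functions of the phase and of `ν`. -/
structure Saddle where
  γ : ℝ → ℝ → Plane
  eu : ℝ → ℝ → Plane
  es : ℝ → ℝ → Plane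

section manifolds

variable (𝓗 : Family) (S : Saddle) (ν : ℝ)

/-- The fixed point `γ(ν)` of the Poincaré map `F_0`. -/
def fixedPt : Plane := S.γ 0 ν

/-- The unstable manifold of `γ(ν)` as a set. -/
def unstableManifold : Set Plane :=
  {z | Tendsto (fun n : ℕ => 𝓗.iter ν (-(n : ℤ)) z) atTop (𝓝 (fixedPt S ν))}

/-- The stable manifold of `γ(ν)` as a set. -/
def stableManifold : Set Plane :=
  {z | Tendsto (fun n : ℕ => 𝓗.iter ν (n : ℤ) z) atTop (𝓝 (fixedPt S ν))}

/-- `c : ℝ → ℝ²` parametrizes the unstable manifold of `γ(ν)` as an injectively immersed line;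
`c 0 = γ(ν)`, positive parameters give the left branch, and the parameter is
chosen such that the Poincaré map acts on the manifold as `t ↦ μ t`. These properties determine `c`
up to a positive factor in the parameter. -/
structure IsUnstableParam (c : ℝ → Plane) : Prop where
  smooth : ContDiff ℝ 1 c
  inj : Function.Injective c
  immersed : ∀ t, deriv c t ≠ 0
  range_eq : range c = unstableManifold 𝓗 S ν
  base : c 0 = fixedPt S ν
  left : ∃ a > (0 : ℝ), deriv c 0 = a • S.eu 0 ν
  expand : ∃ μ > (1 : ℝ), ∀ t, 𝓗.poincare ν 0 (c t) = c (μ * t)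

/-- The same for the stable manifold, on which the Poincaré map contracts the parameter. -/
structure IsStableParam (c : ℝ → Plane) : Prop where
  smooth : ContDiff ℝ 1 c
  inj : Function.Injective c
  immersed : ∀ t, deriv c t ≠ 0
  range_eq : range c = stableManifold 𝓗 S ν
  base : c 0 = fixedPt S ν
  left : ∃ a > (0 : ℝ), deriv c 0 = a • S.es 0 ν
  contract : ∃ μ : ℝ, 0 < μ ∧ μ < 1 ∧ ∀ t, 𝓗.poincare ν 0 (c t) = c (μ * t)

/-- `p = c a = s b`, where `c`, `s` parametrize the unstable and the stable manifold and `a, b > 0`: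
`p` is a homoclinic point on the left branches. -/
structure IsHomoclinicAt (c s : ℝ → Plane) (a b : ℝ) (p : Plane) : Prop where
  unstable : IsUnstableParam 𝓗 S ν c
  stable : IsStableParam 𝓗 S ν s
  a_pos : 0 < a
  b_pos : 0 < b
  eq_unstable : c a = p
  eq_stable : s b = p

/-- `p` is a homoclinic point of `γ(ν)` on the left branches of its manifolds. -/
def IsHomoclinic (p : Plane) : Prop := ∃ c s a b, IsHomoclinicAt 𝓗 S ν c s a b p

/-- The closed segment `U[γ(ν), p]` of the left branch of the unstable manifold. -/
def closedU (p : Plane) : Set Plane :=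
  {z | ∃ c, IsUnstableParam 𝓗 S ν c ∧ ∃ a > (0 : ℝ), c a = p ∧ z ∈ c '' Icc 0 a}

/-- The open segment `U(γ(ν), p)` of the left branch of the unstable manifold. -/
def openU (p : Plane) : Set Plane :=
  {z | ∃ c, IsUnstableParam 𝓗 S ν c ∧ ∃ a > (0 : ℝ), c a = p ∧ z ∈ c '' Ioo 0 a}

/-- The open segment `S(γ(ν), p)` of the left branch of the stable manifold. -/
def openS (p : Plane) : Set Plane :=
  {z | ∃ s, IsStableParam 𝓗 S ν s ∧ ∃ b > (0 : ℝ), s b = p ∧ z ∈ s '' Ioo 0 b}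

/-- `p` is a primary homoclinic point: `U(γ, p) ∩ S(γ, p) = ∅`. -/
def IsPrimary (p : Plane) : Prop :=
  IsHomoclinic 𝓗 S ν p ∧ openU 𝓗 S ν p ∩ openS 𝓗 S ν p = ∅

/-- The unstable and the stable manifold are tangent at the homoclinic point `p`. -/
def IsTangent (p : Plane) : Prop :=
  ∃ c s a b, IsHomoclinicAt 𝓗 S ν c s a b p ∧
    ¬ LinearIndependent ℝ ![deriv c a, deriv s b]

/-- At `c a = s b` the curve `c` crosses the curve `s` from one side to the other: in a local
homeomorphic chart of the plane in which `s` runs along the horizontal axis, `c` passes from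
below the axis to above it (a reflection of the chart covers the other direction). -/
def CrossesAt (c s : ℝ → Plane) (a b : ℝ) : Prop :=
  ∃ e : OpenPartialHomeomorph Plane Plane, c a ∈ e.source ∧ s b = c a ∧
    (∀ᶠ t in 𝓝 b, (e (s t)).2 = 0) ∧
    (∀ᶠ t in 𝓝[<] a, (e (c t)).2 < 0) ∧
    (∀ᶠ t in 𝓝[>] a, 0 < (e (c t)).2)

/-- The manifolds intersect topologically transversely at the homoclinic point `p`. -/
def IsTopTransverse (p : Plane) : Prop :=
  ∃ c s a b, IsHomoclinicAt 𝓗 S ν c s a b p ∧ CrossesAt c s a b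

/-- The points of the topologically transverse primary homoclinic orbits (left branch). -/
def P : Set Plane := {p | IsPrimary 𝓗 S ν p ∧ IsTopTransverse 𝓗 S ν p}

end manifolds

/-- The primary homoclinic bifurcation values: the `ν ∈ (0, ν*)` at which some primary
homoclinic orbit is tangent. -/
def bifValues (𝓗 : Family) (S : Saddle) : Set ℝ :=
  {ν | ν ∈ 𝓗.posParams ∧ ∃ p, IsPrimary 𝓗 S ν p ∧ IsTangent 𝓗 S ν p}

/-- The area enclosed by a closed curve `C`: that of the bounded components of its complement. -/
def enclosedArea (C : Set Plane) : ℝ :=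
  (volume {z | z ∈ Cᶜ ∧ Bornology.IsBounded (connectedComponentIn Cᶜ z)}).toReal

/-- The Hamiltonians are `C^r`, and the forcing is `2π`-periodic in the phase with zero mean. -/
structure SmoothForcing (𝓗 : Family) (r : WithTop ℕ∞) : Prop where
  smooth_H0 : ContDiffOn ℝ r (fun q : ℝ × ℝ × ℝ => 𝓗.H0 q.1 q.2.1 q.2.2)
    {q | q.2.2 ∈ 𝓗.params}
  smooth_H1 : ContDiffOn ℝ r (fun q : ℝ × ℝ × ℝ × ℝ => 𝓗.H1 q.1 q.2.1 q.2.2.1 q.2.2.2)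
    {q | q.2.2.2 ∈ 𝓗.params}
  periodic : ∀ x y φ, ∀ ν ∈ 𝓗.params, 𝓗.H1 x y (φ + 2 * Real.pi) ν = 𝓗.H1 x y φ ν
  zero_mean : ∀ x y, ∀ ν ∈ 𝓗.params, ∫ φ in (0 : ℝ)..(2 * Real.pi), 𝓗.H1 x y φ ν = 0

/-- For all `ν ∈ [0, ν*)` there is a hyperbolic periodic orbit (for `ω = 0`: a hyperbolic
equilibrium of each frozen system) depending smoothly on `ν`; `eu`, `es` are continuous choices of
its unstable and stable eigenvectors. -/
structure HyperbolicOrbit (𝓗 : Family) (S : Saddle) : Prop where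
  smooth : ContDiffOn ℝ 1 (fun q : ℝ × ℝ => S.γ q.1 q.2) {q | q.2 ∈ 𝓗.params}
  periodic : ∀ φ, ∀ ν ∈ 𝓗.params, S.γ (φ + 2 * Real.pi) ν = S.γ φ ν
  isSolution : ∀ ν ∈ 𝓗.params, ∀ θ, 𝓗.IsSolution ν θ (fun t => S.γ (𝓗.freq ν * t + θ) ν)
  cont_eu : ContinuousOn (fun q : ℝ × ℝ => S.eu q.1 q.2) {q | q.2 ∈ 𝓗.params}
  cont_es : ContinuousOn (fun q : ℝ × ℝ => S.es q.1 q.2) {q | q.2 ∈ 𝓗.params}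
  periodic_eu : ∀ φ, ∀ ν ∈ 𝓗.params, S.eu (φ + 2 * Real.pi) ν = S.eu φ ν
  periodic_es : ∀ φ, ∀ ν ∈ 𝓗.params, S.es (φ + 2 * Real.pi) ν = S.es φ ν
  eu_ne : ∀ φ, ∀ ν ∈ 𝓗.params, S.eu φ ν ≠ 0
  es_ne : ∀ φ, ∀ ν ∈ 𝓗.params, S.es φ ν ≠ 0
  unstable : ∀ ν ∈ 𝓗.posParams, ∀ θ, ∃ μ > (1 : ℝ),
    fderiv ℝ (𝓗.poincare ν θ) (S.γ θ ν) (S.eu θ ν) = μ • S.eu θ ν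
  stable : ∀ ν ∈ 𝓗.posParams, ∀ θ, ∃ μ : ℝ, 0 < μ ∧ μ < 1 ∧
    fderiv ℝ (𝓗.poincare ν θ) (S.γ θ ν) (S.es θ ν) = μ • S.es θ ν
  frozen_unstable : ∀ θ, ∃ μ > (0 : ℝ),
    fderiv ℝ (𝓗.field θ 0) (S.γ θ 0) (S.eu θ 0) = μ • S.eu θ 0
  frozen_stable : ∀ θ, ∃ μ < (0 : ℝ),
    fderiv ℝ (𝓗.field θ 0) (S.γ θ 0) (S.es θ 0) = μ • S.es θ 0

/-- The frequency is `C^r`, maps `[0, ν*)` onto `[0, ∞)` and vanishes at no interior point. -/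
structure SpansFrequency (𝓗 : Family) (r : WithTop ℕ∞) : Prop where
  smooth : ContDiffOn ℝ r 𝓗.freq 𝓗.params
  onto : 𝓗.freq '' 𝓗.params = Ici 0
  ne_zero : ∀ ν ∈ 𝓗.posParams, 𝓗.freq ν ≠ 0

/-- At `ω = 0` the left branches coincide, for each phase `θ`, along a homoclinic loop, swept by the
solution `h θ`, which depends smoothly on `θ`; the enclosed area is a function of `θ` with nonzero
derivative except at finitely many phases of `[0, 2π]`. -/
def AdiabaticLoops (𝓗 : Family) (S : Saddle) : Prop :=
  ∃ h : ℝ → ℝ → Plane, ContDiff ℝ 1 (fun q : ℝ × ℝ => h q.1 q.2) ∧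
    (∀ θ, 𝓗.IsSolution 0 θ (h θ) ∧
      Tendsto (h θ) atBot (𝓝 (S.γ θ 0)) ∧ Tendsto (h θ) atTop (𝓝 (S.γ θ 0)) ∧
      Tendsto (fun t => ‖h θ t - S.γ θ 0‖⁻¹ • (h θ t - S.γ θ 0)) atBot
        (𝓝 (‖S.eu θ 0‖⁻¹ • S.eu θ 0)) ∧
      Tendsto (fun t => ‖h θ t - S.γ θ 0‖⁻¹ • (h θ t - S.γ θ 0)) atTop
        (𝓝 (‖S.es θ 0‖⁻¹ • S.es θ 0))) ∧
    {θ | θ ∈ Icc 0 (2 * Real.pi) ∧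
      deriv (fun θ' => enclosedArea (insert (S.γ θ' 0) (range (h θ')))) θ = 0}.Finite

/-- For `ν ≠ 0` there are finitely many primary homoclinic orbits, at least two of which are
topologically transverse. -/
structure FinitelyManyPrimary (𝓗 : Family) (S : Saddle) : Prop where
  finite : ∀ ν ∈ 𝓗.posParams, ∃ A : Set Plane, A.Finite ∧
    ∀ p, IsPrimary 𝓗 S ν p → ∃ q ∈ A, 𝓗.SameOrbit ν q p
  two : ∀ ν ∈ 𝓗.posParams, ∃ p ∈ P 𝓗 S ν, ∃ q ∈ P 𝓗 S ν, ¬ 𝓗.SameOrbit ν p q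

/-- The assumptions on a frequency-spanning homoclinic family, written in its scaled variables.
(That the scaled loop has size and speed of order one is not required here.) -/
structure IsFrequencySpanning (𝓗 : Family) (S : Saddle) (r : WithTop ℕ∞) : Prop where
  nuStar_pos : 0 < 𝓗.nuStar
  two_lt : 2 < r
  forcing : SmoothForcing 𝓗 r
  complete : 𝓗.Complete
  orbit : HyperbolicOrbit 𝓗 S
  frequency : SpansFrequency 𝓗 r
  loops : AdiabaticLoops 𝓗 S
  primary : FinitelyManyPrimary 𝓗 S
  bifurcations : ∀ a b : ℝ, (bifValues 𝓗 S ∩ Ioo a b).Finite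

/-- `Lbl ν` is a finite set of labels and `p ν r`, for `r ∈ Lbl ν`, is the point `p₀^r(ν)` on the
orbit labelled `r`: every topologically transverse primary homoclinic orbit has exactly one
label. -/
structure IsLabelling (𝓗 : Family) (S : Saddle) (Lbl : ℝ → Finset ℝ) (p : ℝ → ℝ → Plane) :
    Prop where
  mem : ∀ ν ∈ 𝓗.posParams, ∀ r ∈ Lbl ν, p ν r ∈ P 𝓗 S ν
  unique_label : ∀ ν ∈ 𝓗.posParams, ∀ z ∈ P 𝓗 S ν,
    ∃! r, r ∈ Lbl ν ∧ 𝓗.SameOrbit ν (p ν r) z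

/-- The labels are piecewise constant and change only at bifurcations of the labelled orbit. -/
structure IsPiecewiseConstant (𝓗 : Family) (S : Saddle) (Lbl : ℝ → Finset ℝ)
    (p : ℝ → ℝ → Plane) : Prop where
  /-- On an interval free of primary homoclinic bifurcations, the set of labels is constant. -/
  constant : ∀ a b : ℝ, Ioo a b ⊆ 𝓗.posParams → Ioo a b ∩ bifValues 𝓗 S = ∅ →
    ∀ ν ∈ Ioo a b, ∀ ν' ∈ Ioo a b, Lbl ν = Lbl ν'
  /-- At any parameter value (a bifurcation value of other orbits or not), an orbit that is not
  itself tangent keeps its label on both sides, the labelled point moving continuously. -/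
  persists : ∀ ν₀ ∈ 𝓗.posParams, ∀ r ∈ Lbl ν₀, ¬ IsTangent 𝓗 S ν₀ (p ν₀ r) →
    ∀ᶠ ν in 𝓝 ν₀, r ∈ Lbl ν ∧ ContinuousAt (fun ν' => p ν' r) ν

/-- The labels respect the unstable ordering. The second clause says that the points `p₀^r(ν)` are
taken from a single fundamental segment: each precedes the image of each under the Poincaré map. -/
structure RespectsUnstableOrder (𝓗 : Family) (S : Saddle) (Lbl : ℝ → Finset ℝ)
    (p : ℝ → ℝ → Plane) : Prop where
  order : ∀ ν ∈ 𝓗.posParams, ∀ r ∈ Lbl ν, ∀ r' ∈ Lbl ν,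
    (r < r' ↔ closedU 𝓗 S ν (p ν r) ⊂ closedU 𝓗 S ν (p ν r'))
  fundamental : ∀ ν ∈ 𝓗.posParams, ∀ r ∈ Lbl ν, ∀ r' ∈ Lbl ν,
    closedU 𝓗 S ν (p ν r) ⊂ closedU 𝓗 S ν (𝓗.poincare ν 0 (p ν r'))

end FreqSpan

end

/-!
The labels are obtained by following transverse homoclinic points along `ν`, and by choosing new
real numbers for the orbits which cannot be followed.

*Invariant curves.* The flow of a `C²` field is `C^{1,1}` (`flow_C11`); hence so are the iterates of
the Poincaré map, jointly in the point and in `ν` (`iter_C11`). For maps of this class the unstable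
and the stable manifold have parametrizations `c ν`, `s ν` on which the map acts as multiplication
by the eigenvalues `μ ν`, `l ν`. Once the velocity at the fixed point is normalized, such a curve is
the limit of the iterates of short segments in the eigendirection, at a rate that is locally uniform
in `ν`. So it is unique, and the curves and their velocities are jointly continuous in `ν` and the
curve parameter (`continuousOn_expandedCurve`, `continuousAt_normalCurve`,
`exists_manifoldParams`).

*Continuation of homoclinic points.* Homoclinic points correspond to the zeros `(a, b)` of
`c ν a - s ν b`, and near a zero that is not tangent there is exactly one zero for each nearby `ν`
(`exists_unique_zero`). Primary points continue to primary points (`PrimaryAt.eventually`): the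
rectangle of parameters below `(a, b)` is compact, and close to the saddle the two curves are
transverse. Conversely, a point near a followed one must be the followed one. Here only the unstable
parameter is known to be close; but the orderings of the primary points along the two branches are
opposite to each other (`PrimaryAt.lt_of_lt`), which bounds the stable parameter too
(`ManifoldParams.exists_bounds`), so that a limit exists and local uniqueness applies
(`ManifoldParams.exists_continuation`). The same bounds show that away from bifurcation values no
primary orbit appears (`ManifoldParams.eventually_notMem`).

*Labelling.* The unstable parameters `a` of the topologically transverse primary points form a
`BranchSystem`: a set of positive numbers over each `ν`, invariant under multiplication by `μ ν`,
finite modulo it, and with unique continuation outside a locally finite set of bifurcation values.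
Over an interval without bifurcation values the set is a union of disjoint continuous sections
(`BranchSystem.exists_section`), whose order does not change, so that a labelling of one fibre
spreads over the interval (`BranchSystem.exists_spread`). At a bifurcation value finitely many
orbits can be followed from either side and keep their labels. Their points remain ordered and in
one fundamental segment; the remaining points of that segment receive labels from the gaps of the
finite set of labels in use, which exist because `ℝ` is dense (`exists_strictMonoOn_extension`,
`BranchSystem.exists_extension_across`). As bifurcation values are isolated, Zorn's lemma yields
a labelling over the whole of `(0, ν*)` (`exists_extension_of_local`,
`BranchSystem.exists_labelling`).
-/

noncomputable section

namespace FreqSpan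

set_option linter.unusedSectionVars false

/-! ### Flows of `C²` vector fields -/

section smoothness

variable {E F G : Type*} [NormedAddCommGroup E] [NormedSpace ℝ E] [NormedAddCommGroup F]
  [NormedSpace ℝ F] [NormedAddCommGroup G] [NormedSpace ℝ G]

/-- `f` is Lipschitz on some neighbourhood of `x`. -/
def LipAt (f : E → F) (x : E) : Prop := ∃ K : NNReal, ∃ U ∈ 𝓝 x, LipschitzOnWith K f U

lemma LipAt.continuousAt {f : E → F} {x : E} (h : LipAt f x) : ContinuousAt f x := by
  obtain ⟨K, U, hU, h⟩ := h
  exact h.continuousOn.continuousAt hU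

lemma LipAt.prodMk {f : E → F} {g : E → G} {x : E} (hf : LipAt f x) (hg : LipAt g x) :
    LipAt (fun y => (f y, g y)) x := by
  obtain ⟨K, U, hU, h⟩ := hf
  obtain ⟨K', U', hU', h'⟩ := hg
  exact ⟨max K K', U ∩ U', inter_mem hU hU',
    (h.mono inter_subset_left).prodMk (h'.mono inter_subset_right)⟩

lemma LipAt.comp {g : F → G} {f : E → F} {x : E} (hg : LipAt g (f x)) (hf : LipAt f x) :
    LipAt (fun y => g (f y)) x := by
  have hc := hf.continuousAt
  obtain ⟨K, U, hU, h⟩ := hf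
  obtain ⟨K', U', hU', h'⟩ := hg
  exact ⟨K' * K, U ∩ f ⁻¹' U', inter_mem hU (hc hU'),
    h'.comp (h.mono inter_subset_left) (fun y hy => hy.2)⟩

lemma LipAt.congr {f g : E → F} {x : E} (hf : LipAt f x) (h : f =ᶠ[𝓝 x] g) : LipAt g x := by
  obtain ⟨K, U, hU, hK⟩ := hf
  refine ⟨K, U ∩ {y | f y = g y}, inter_mem hU h, fun y hy z hz => ?_⟩
  rw [← hy.2, ← hz.2]
  exact hK hy.1 hz.1

lemma LipAt.of_contDiffAt {f : E → F} {x : E} (h : ContDiffAt ℝ 1 f x) : LipAt f x :=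
  h.exists_lipschitzOnWith

/-- `f` is continuously differentiable near `x` and its derivative is Lipschitz near `x`. -/
def C11At (f : E → F) (x : E) : Prop := ContDiffAt ℝ 1 f x ∧ LipAt (fderiv ℝ f) x

lemma C11At.of_contDiffAt {f : E → F} {x : E} (h : ContDiffAt ℝ 2 f x) : C11At f x :=
  ⟨h.of_le (by norm_num), LipAt.of_contDiffAt (h.fderiv_right (by norm_num))⟩

lemma C11At.eventually_differentiableAt {f : E → F} {x : E} (h : C11At f x) :
    ∀ᶠ y in 𝓝 x, DifferentiableAt ℝ f y :=
  (h.1.eventually (by simp)).mono fun _ hy => hy.differentiableAt one_ne_zero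

lemma C11At.congr {f g : E → F} {x : E} (h : C11At f x) (hfg : f =ᶠ[𝓝 x] g) : C11At g x :=
  ⟨h.1.congr_of_eventuallyEq hfg.symm, h.2.congr hfg.fderiv⟩

lemma C11At.comp {g : F → G} {f : E → F} {x : E} (hg : C11At g (f x)) (hf : C11At f x) :
    C11At (fun y => g (f y)) x := by
  refine ⟨hg.1.comp x hf.1, ?_⟩
  have h1 : LipAt (fun y => (fderiv ℝ g (f y), fderiv ℝ f y)) x :=
    (LipAt.comp hg.2 (LipAt.of_contDiffAt hf.1)).prodMk hf.2
  have h2 : ContDiffAt ℝ 1 (fun p : (F →L[ℝ] G) × (E →L[ℝ] F) => p.1.comp p.2)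
      (fderiv ℝ g (f x), fderiv ℝ f x) :=
    (contDiff_fst.clm_comp contDiff_snd).contDiffAt
  refine (LipAt.comp (f := fun y => (fderiv ℝ g (f y), fderiv ℝ f y))
    (LipAt.of_contDiffAt h2) h1).congr ?_
  filter_upwards [hf.eventually_differentiableAt,
    hf.1.continuousAt.eventually hg.eventually_differentiableAt] with y hy hy'
  exact (fderiv_comp y hy' hy).symm

end smoothness

section flow

variable {E : Type*} [NormedAddCommGroup E] [NormedSpace ℝ E]

/-- Uniqueness for solutions of an autonomous equation with a locally Lipschitz right-hand side. -/
lemma solution_unique {v : E → E} {f g : ℝ → E} {a b t₀ : ℝ} (ht₀ : t₀ ∈ Ioo a b)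
    (hf : ∀ t ∈ Ioo a b, HasDerivAt f (v (f t)) t) (hg : ∀ t ∈ Ioo a b, HasDerivAt g (v (g t)) t)
    (hv : ∀ t ∈ Ioo a b, LipAt v (f t)) (h0 : f t₀ = g t₀) : EqOn f g (Ioo a b) := by
  have key : ∀ t ∈ Ioo a b, f t = g t → f =ᶠ[𝓝 t] g := by
    intro t ht h
    obtain ⟨K, U, hU, hK⟩ := hv t ht
    refine ODE_solution_unique_of_eventually (v := fun _ => v) (s := fun _ => U) (K := K)
      (Eventually.of_forall fun _ => hK) ?_ ?_ h
    · filter_upwards [isOpen_Ioo.mem_nhds ht, (hf t ht).continuousAt hU] with s hs hs'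
      exact ⟨hf s hs, hs'⟩
    · filter_upwards [isOpen_Ioo.mem_nhds ht, (hg t ht).continuousAt (h ▸ hU)] with s hs hs'
      exact ⟨hg s hs, hs'⟩
  have hsub : Ioo a b ⊆ {t | f =ᶠ[𝓝 t] g} := by
    refine isPreconnected_Ioo.subset_of_closure_inter_subset ?_ ⟨t₀, ht₀, key t₀ ht₀ h0⟩ ?_
    · exact isOpen_setOfPred_eventually_nhds
    · rintro t ⟨htc, ht⟩
      refine key t ht ?_
      have hfr : ∃ᶠ s in 𝓝 t, f s = g s :=
        (mem_closure_iff_frequently.1 htc).mono fun s hs => hs.self_of_nhds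
      by_contra hne
      have h1 : ∀ᶠ s in 𝓝 t, f s ≠ g s :=
        ((hf t ht).continuousAt.prodMk (hg t ht).continuousAt).eventually
          (isOpen_ne_fun continuous_fst continuous_snd |>.mem_nhds hne)
      exact hfr h1
  exact fun t ht => (hsub ht).self_of_nhds

variable [CompleteSpace E]

/-- For short times the flow of a `C²` field is `C^{1,1}`. The derivative in the initial point is
the solution of the variational equation, which is Lipschitz in the initial point as part of the
solution of a larger `C¹` system. -/
lemma short_time_C11 {v : E → E} {Ω : Set E} (hΩ : IsOpen Ω) (hv : ∀ x ∈ Ω, ContDiffAt ℝ 2 v x)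
    {φ : ℝ → E → E} (h0 : ∀ x, φ 0 x = x) (hφ : ∀ x ∈ Ω, ∀ t, φ t x ∈ Ω)
    (hd : ∀ x ∈ Ω, ∀ t, HasDerivAt (fun t => φ t x) (v (φ t x)) t) {x₀ : E} (hx₀ : x₀ ∈ Ω) :
    ∃ τ > 0, ∀ᶠ x in 𝓝 x₀, ∀ t ∈ Icc 0 τ, C11At (φ t) x := by
  set V : E × (E →L[ℝ] E) → E × (E →L[ℝ] E) := fun p => (v p.1, (fderiv ℝ v p.1).comp p.2) with hV
  set id' : E →L[ℝ] E := ContinuousLinearMap.id ℝ E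
  have hVC : ContDiffAt ℝ 1 V (x₀, id') := by
    have h1 : ContDiffAt ℝ 1 (fun p : E × (E →L[ℝ] E) => v p.1) (x₀, id') :=
      ((hv x₀ hx₀).of_le (by norm_num)).comp (x₀, id') contDiffAt_fst
    have h2 : ContDiffAt ℝ 1 (fun p : E × (E →L[ℝ] E) => fderiv ℝ v p.1) (x₀, id') :=
      ((hv x₀ hx₀).fderiv_right (m := 1) (by norm_num)).comp (x₀, id') contDiffAt_fst
    exact h1.prodMk (h2.clm_comp contDiffAt_snd)
  obtain ⟨ε, hε, a, r, L, K, hr, hPL⟩ := IsPicardLindelof.of_contDiffAt_one hVC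
  obtain ⟨α, hα, L', hL'⟩ :=
    (hPL 0).exists_forall_mem_closedBall_eq_hasDerivWithinAt_lipschitzOnWith
  simp only [zero_sub, zero_add] at hα hL'
  have hrpos : (0 : ℝ) < r := by exact_mod_cast hr
  have hαd : ∀ p ∈ Metric.closedBall (x₀, id') (r : ℝ), ∀ t ∈ Ioo (-ε) ε,
      HasDerivAt (α p) (V (α p t)) t := fun p hp t ht =>
    ((hα p hp).2 t (Ioo_subset_Icc_self ht)).hasDerivAt (Icc_mem_nhds ht.1 ht.2)
  have hmem : ∀ x, dist x x₀ ≤ r → (x, id') ∈ Metric.closedBall (x₀, id') (r : ℝ) := by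
    intro x hx
    simpa [Prod.dist_eq] using hx
  -- the first component of the extended solution is the flow
  have hfst : ∀ x, x ∈ Ω → dist x x₀ ≤ r → ∀ t ∈ Ioo (-ε) ε, φ t x = (α (x, id') t).1 := by
    intro x hx hxr
    refine solution_unique (v := v) (t₀ := 0) ⟨by linarith, hε⟩ (fun t _ => hd x hx t) ?_
      (fun t _ => LipAt.of_contDiffAt ((hv _ (hφ x hx t)).of_le (by norm_num))) ?_
    · intro t ht
      exact (hαd _ (hmem x hxr) t ht).fst
    · rw [h0, (hα _ (hmem x hxr)).1]
  -- a ball on which the field and its derivative are controlled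
  obtain ⟨K₂, U₂, hU₂, hK₂⟩ := LipAt.of_contDiffAt ((hv x₀ hx₀).fderiv_right (m := 1) (by norm_num))
  obtain ⟨ρ, hρ, hball⟩ := Metric.mem_nhds_iff.1 (inter_mem hU₂ (hΩ.mem_nhds hx₀))
  set M : ℝ := K₂ * ρ + ‖fderiv ℝ v x₀‖ + 1 with hM
  have hMpos : 0 < M := by positivity
  have hMb : ∀ y ∈ Metric.ball x₀ ρ, ‖fderiv ℝ v y‖ ≤ M := by
    intro y hy
    have h1 : ‖fderiv ℝ v y - fderiv ℝ v x₀‖ ≤ K₂ * ‖y - x₀‖ :=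
      hK₂.norm_sub_le (hball hy).1 (mem_of_mem_nhds hU₂)
    have h2 : ‖y - x₀‖ ≤ ρ := (mem_ball_iff_norm.1 hy).le
    calc ‖fderiv ℝ v y‖ ≤ ‖fderiv ℝ v y - fderiv ℝ v x₀‖ + ‖fderiv ℝ v x₀‖ :=
          norm_le_norm_sub_add _ _
      _ ≤ K₂ * ρ + ‖fderiv ℝ v x₀‖ := by gcongr; exact h1.trans (by gcongr)
      _ ≤ M := by linarith
  -- solutions starting near `x₀` stay in this ball for a short time
  have hstay : ∃ τ > 0, τ < ε ∧ ∃ δ > 0, δ ≤ (r : ℝ) ∧ Metric.ball x₀ δ ⊆ Ω ∧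
      ∀ x ∈ Metric.ball x₀ δ, ∀ t ∈ Icc 0 τ, φ t x ∈ Metric.ball x₀ ρ := by
    have hc : ContinuousAt (fun t => φ t x₀) 0 := (hd x₀ hx₀ 0).continuousAt
    have h1 : ∀ᶠ t in 𝓝 (0 : ℝ), dist (φ t x₀) x₀ < ρ / 2 := by
      have := hc.eventually (Metric.ball_mem_nhds (φ 0 x₀) (half_pos hρ))
      simpa [h0] using this
    obtain ⟨τ, hτ, hτ'⟩ := Metric.eventually_nhds_iff.1 h1
    obtain ⟨δ₁, hδ₁, hδΩ⟩ := Metric.isOpen_iff.1 hΩ x₀ hx₀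
    refine ⟨min (τ / 2) (ε / 2), by positivity, ?_, min (min δ₁ r) (ρ / 2 / (L' + 1)),
      by positivity, ?_, ?_, ?_⟩
    · exact (min_le_right _ _).trans_lt (by linarith)
    · exact (min_le_left _ _).trans (min_le_right _ _)
    · exact (Metric.ball_subset_ball ((min_le_left _ _).trans (min_le_left _ _))).trans hδΩ
    · intro x hx t ht
      have hxr : dist x x₀ < min (min δ₁ r) (ρ / 2 / (L' + 1)) := hx
      have hxr1 : dist x x₀ < δ₁ := hxr.trans_le ((min_le_left _ _).trans (min_le_left _ _))
      have hxr2 : dist x x₀ ≤ r := hxr.le.trans ((min_le_left _ _).trans (min_le_right _ _))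
      have hxr3 : dist x x₀ < ρ / 2 / (L' + 1) := hxr.trans_le (min_le_right _ _)
      have ht2 : t ≤ τ / 2 := ht.2.trans (min_le_left _ _)
      have ht3 : t ≤ ε / 2 := ht.2.trans (min_le_right _ _)
      have htε : t ∈ Ioo (-ε) ε := ⟨by linarith [ht.1], by linarith⟩
      have e1 : dist (φ t x) (φ t x₀) ≤ L' * dist x x₀ := by
        rw [hfst x (hδΩ hxr1) hxr2 t htε, hfst x₀ hx₀ (by simp) t htε]
        have := (hL' t (Ioo_subset_Icc_self htε)).dist_le_mul _ (hmem x hxr2) _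
          (hmem x₀ (by simp))
        refine le_trans (le_trans (le_max_left _ _) this) ?_
        simp [Prod.dist_eq]
      have e2 : dist (φ t x₀) x₀ < ρ / 2 := hτ' (by
        rw [Real.dist_eq, sub_zero, abs_of_nonneg ht.1]; linarith)
      have e3 : L' * dist x x₀ ≤ ρ / 2 := by
        rw [lt_div_iff₀ (by positivity)] at hxr3
        nlinarith [dist_nonneg (x := x) (y := x₀)]
      calc dist (φ t x) x₀ ≤ dist (φ t x) (φ t x₀) + dist (φ t x₀) x₀ := dist_triangle _ _ _
        _ < ρ := by linarith
  obtain ⟨τ, hτ, hτε, δ, hδ, hδr, hδΩ, hst⟩ := hstay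
  refine ⟨τ, hτ, ?_⟩
  have hdr : ∀ x ∈ Metric.ball x₀ δ, dist x x₀ ≤ r := fun x hx => (Metric.mem_ball.1 hx).le.trans hδr
  have hIoo : ∀ t ∈ Icc 0 τ, t ∈ Ioo (-ε) ε := fun t ht => ⟨by linarith [ht.1], by linarith [ht.2]⟩
  have hLip : ∀ t ∈ Icc 0 τ, ∀ z ∈ Metric.ball x₀ δ, ∀ w ∈ Metric.ball x₀ δ,
      ‖α (z, id') t - α (w, id') t‖ ≤ L' * ‖z - w‖ := by
    intro t ht z hz w hw
    have := (hL' t (Ioo_subset_Icc_self (hIoo t ht))).norm_sub_le (hmem z (hdr z hz))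
      (hmem w (hdr w hw))
    simpa [Prod.norm_def] using this
  set C : ℝ := K₂ * L' ^ 2 * (Real.exp (M * τ) / M) with hC
  have hCpos : 0 ≤ C := by positivity
  have hest : ∀ t ∈ Icc 0 τ, ∀ z ∈ Metric.ball x₀ δ, ∀ w ∈ Metric.ball x₀ δ,
      ‖φ t z - φ t w - (α (w, id') t).2 (z - w)‖ ≤ C * ‖z - w‖ ^ 2 := by
    intro t ht z hz w hw
    set e : ℝ → E := fun s => φ s z - φ s w - (α (w, id') s).2 (z - w) with he
    have hαw : ∀ s ∈ Icc 0 τ, (α (w, id') s).1 = φ s w := fun s hs =>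
      (hfst w (hδΩ hw) (hdr w hw) s (hIoo s hs)).symm
    have hed : ∀ s ∈ Icc 0 τ, HasDerivAt e (v (φ s z) - v (φ s w)
        - (fderiv ℝ v (φ s w)) ((α (w, id') s).2 (z - w))) s := by
      intro s hs
      have h1 : HasDerivAt (fun s => (α (w, id') s).2)
          ((fderiv ℝ v (φ s w)).comp (α (w, id') s).2) s := by
        have := hasFDerivAt_snd.comp_hasDerivAt s (hαd _ (hmem w (hdr w hw)) s (hIoo s hs))
        simpa [hV, hαw s hs, Function.comp_def] using this
      have h2 := h1.clm_apply (hasDerivAt_const s (z - w))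
      simp only [ContinuousLinearMap.comp_apply, map_zero, add_zero] at h2
      exact ((hd z (hδΩ hz) s).sub (hd w (hδΩ hw) s)).sub h2
    have hgr := norm_le_gronwallBound_of_norm_deriv_right_le (f := e) (a := 0) (b := τ) (δ := 0)
      (K := M) (ε := K₂ * (L' * ‖z - w‖) ^ 2)
      (fun s hs => (hed s hs).continuousAt.continuousWithinAt)
      (fun s hs => (hed s (Ico_subset_Icc_self hs)).hasDerivWithinAt) ?_ ?_ t ht
    · refine hgr.trans ?_
      rw [sub_zero, gronwallBound_of_K_ne_0 hMpos.ne']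
      simp only [zero_mul, zero_add]
      have h1 : Real.exp (M * t) - 1 ≤ Real.exp (M * τ) := by
        have : Real.exp (M * t) ≤ Real.exp (M * τ) := by
          apply Real.exp_le_exp.2; gcongr; exact ht.2
        linarith
      calc K₂ * (L' * ‖z - w‖) ^ 2 / M * (Real.exp (M * t) - 1)
          ≤ K₂ * (L' * ‖z - w‖) ^ 2 / M * Real.exp (M * τ) := by gcongr
        _ = C * ‖z - w‖ ^ 2 := by rw [hC]; ring
    · have : e 0 = 0 := by
        simp only [he, h0, (hα _ (hmem w (hdr w hw))).1]
        simp [id']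
      simp [this]
    · intro s hs
      have hs' := Ico_subset_Icc_self hs
      have hzb := hst z hz s hs'
      have hwb := hst w hw s hs'
      have hsub : segment ℝ (φ s w) (φ s z) ⊆ Metric.ball x₀ ρ :=
        (convex_ball x₀ ρ).segment_subset hwb hzb
      have hdist : ‖φ s z - φ s w‖ ≤ L' * ‖z - w‖ := by
        rw [hfst z (hδΩ hz) (hdr z hz) s (hIoo s hs'), hfst w (hδΩ hw) (hdr w hw) s (hIoo s hs')]
        exact (norm_fst_le _).trans (hLip s hs' z hz w hw)
      have hT : ‖v (φ s z) - v (φ s w) - fderiv ℝ v (φ s w) (φ s z - φ s w)‖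
          ≤ (K₂ * ‖φ s z - φ s w‖) * ‖φ s z - φ s w‖ := by
        refine Convex.norm_image_sub_le_of_norm_hasFDerivWithin_le' (f := v)
          (f' := fun y => fderiv ℝ v y) (s := segment ℝ (φ s w) (φ s z)) ?_ ?_
          (convex_segment _ _) (left_mem_segment _ _ _) (right_mem_segment _ _ _)
        · intro y hy
          exact ((hv y (hball (hsub hy)).2).differentiableAt
            (by norm_num)).hasFDerivAt.hasFDerivWithinAt
        · intro y hy
          refine (hK₂.norm_sub_le (hball (hsub hy)).1 (hball hwb).1).trans ?_
          gcongr
          obtain ⟨a, b, ha, hb, hab, rfl⟩ := hy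
          have : a • φ s w + b • φ s z - φ s w = b • (φ s z - φ s w) := by
            have : a = 1 - b := by linarith
            subst this; module
          rw [this, norm_smul, Real.norm_of_nonneg hb]
          have : b ≤ 1 := by linarith
          nlinarith [norm_nonneg (φ s z - φ s w)]
      have hsplit : v (φ s z) - v (φ s w) - (fderiv ℝ v (φ s w)) ((α (w, id') s).2 (z - w))
          = (v (φ s z) - v (φ s w) - fderiv ℝ v (φ s w) (φ s z - φ s w))
            + fderiv ℝ v (φ s w) (e s) := by
        simp only [he, map_sub]; abel
      rw [hsplit]
      calc _ ≤ ‖v (φ s z) - v (φ s w) - fderiv ℝ v (φ s w) (φ s z - φ s w)‖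
            + ‖fderiv ℝ v (φ s w) (e s)‖ := norm_add_le _ _
        _ ≤ (K₂ * (L' * ‖z - w‖)) * (L' * ‖z - w‖) + M * ‖e s‖ := by
            gcongr
            · refine hT.trans ?_
              gcongr
            · exact (ContinuousLinearMap.le_opNorm _ _).trans (by gcongr; exact hMb _ hwb)
        _ = M * ‖e s‖ + K₂ * (L' * ‖z - w‖) ^ 2 := by ring
  have hder : ∀ t ∈ Icc 0 τ, ∀ w ∈ Metric.ball x₀ δ, HasFDerivAt (φ t) (α (w, id') t).2 w := by
    intro t ht w hw
    rw [hasFDerivAt_iff_isLittleO]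
    have hO : (fun z => φ t z - φ t w - (α (w, id') t).2 (z - w)) =O[𝓝 w]
        fun z => ‖z - w‖ ^ 2 := by
      refine Asymptotics.IsBigO.of_bound C ?_
      filter_upwards [Metric.isOpen_ball.mem_nhds hw] with z hz
      simpa using hest t ht z hz w hw
    refine hO.trans_isLittleO ?_
    have h1 : (fun z => ‖z - w‖) =o[𝓝 w] fun _ => (1 : ℝ) := by
      rw [Asymptotics.isLittleO_one_iff]
      have : ContinuousAt (fun z => ‖z - w‖) w := by fun_prop
      simpa [ContinuousAt] using this
    have h2 := h1.mul_isBigO (Asymptotics.isBigO_refl (fun z => ‖z - w‖) (𝓝 w))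
    simp only [one_mul] at h2
    exact (h2.congr_left fun z => by ring).trans_isBigO (Asymptotics.isBigO_refl _ _).norm_left
  have hLipD : ∀ t ∈ Icc 0 τ, LipschitzOnWith L' (fun w => (α (w, id') t).2) (Metric.ball x₀ δ) := by
    intro t ht
    refine LipschitzOnWith.of_dist_le_mul fun z hz w hw => ?_
    rw [dist_eq_norm, dist_eq_norm]
    exact (norm_snd_le (α (z, id') t - α (w, id') t)).trans (hLip t ht z hz w hw)
  filter_upwards [Metric.ball_mem_nhds x₀ hδ] with x hx t ht
  have hxn := Metric.isOpen_ball.mem_nhds hx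
  refine ⟨contDiffAt_one_iff.2 ⟨fun w => (α (w, id') t).2, Metric.ball x₀ δ, hxn,
    (hLipD t ht).continuousOn, hder t ht⟩, ?_⟩
  refine LipAt.congr ⟨L', Metric.ball x₀ δ, hxn, hLipD t ht⟩ ?_
  filter_upwards [hxn] with w hw
  exact (hder t ht w hw).fderiv.symm

/-- The maps of a complete flow of a `C²` field are `C^{1,1}` (for nonnegative times). -/
lemma flow_C11_of_nonneg {v : E → E} {Ω : Set E} (hΩ : IsOpen Ω)
    (hv : ∀ x ∈ Ω, ContDiffAt ℝ 2 v x)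
    {φ : ℝ → E → E} (h0 : ∀ x, φ 0 x = x) (hφ : ∀ x ∈ Ω, ∀ t, φ t x ∈ Ω)
    (hd : ∀ x ∈ Ω, ∀ t, HasDerivAt (fun t => φ t x) (v (φ t x)) t) {x₀ : E} (hx₀ : x₀ ∈ Ω)
    {T : ℝ} (hT : 0 ≤ T) : C11At (φ T) x₀ := by
  have hadd : ∀ x ∈ Ω, ∀ s t, φ (s + t) x = φ s (φ t x) := by
    intro x hx s t
    have := solution_unique (v := v) (f := fun u => φ (u + t) x) (g := fun u => φ u (φ t x))
      (a := -|s| - 1) (b := |s| + 1) (t₀ := 0) ⟨by linarith [abs_nonneg s], by positivity⟩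
      (fun u _ => (hd x hx (u + t)).comp_add_const u t) (fun u _ => hd _ (hφ x hx t) u)
      (fun u _ => LipAt.of_contDiffAt ((hv _ (hφ x hx _)).of_le (by norm_num)))
      (by simp [h0])
    exact this ⟨by linarith [neg_abs_le s], by linarith [le_abs_self s]⟩
  -- a uniform time step along the compact piece of the orbit
  have hK : IsCompact ((fun t => φ t x₀) '' Icc 0 T) :=
    isCompact_Icc.image (continuous_iff_continuousAt.2 fun t => (hd x₀ hx₀ t).continuousAt)
  obtain ⟨τ, hτ, hstep⟩ : ∃ τ > 0, ∀ x ∈ (fun t => φ t x₀) '' Icc 0 T, ∀ t ∈ Icc 0 τ,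
      C11At (φ t) x := by
    refine hK.induction_on (p := fun s => ∃ τ > 0, ∀ x ∈ s, ∀ t ∈ Icc 0 τ, C11At (φ t) x)
      ⟨1, one_pos, by simp⟩ ?_ ?_ ?_
    · rintro s s' hss ⟨τ, hτ, h⟩
      exact ⟨τ, hτ, fun x hx => h x (hss hx)⟩
    · rintro s s' ⟨τ, hτ, h⟩ ⟨τ', hτ', h'⟩
      refine ⟨min τ τ', lt_min hτ hτ', ?_⟩
      rintro x (hx | hx) t ht
      · exact h x hx t ⟨ht.1, ht.2.trans (min_le_left _ _)⟩
      · exact h' x hx t ⟨ht.1, ht.2.trans (min_le_right _ _)⟩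
    · rintro _ ⟨t, _, rfl⟩
      obtain ⟨τ, hτ, h⟩ := short_time_C11 hΩ hv h0 hφ hd (hφ x₀ hx₀ t)
      exact ⟨_, mem_nhdsWithin_of_mem_nhds h, τ, hτ, fun x hx => hx⟩
  obtain ⟨n, hn⟩ := exists_nat_gt (T / τ)
  have hnpos : (0 : ℝ) < n := lt_of_le_of_lt (by positivity) hn
  have hsmall : T / n ≤ τ := by
    rw [div_le_iff₀ hnpos]; rw [div_lt_iff₀ hτ] at hn; linarith
  have hind : ∀ k : ℕ, k ≤ n → C11At (φ (k * (T / n))) x₀ := by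
    intro k
    induction k with
    | zero =>
      intro _
      simp only [Nat.cast_zero, zero_mul]
      have : φ 0 = id := funext h0
      rw [this]
      exact C11At.of_contDiffAt contDiffAt_id
    | succ k ih =>
      intro hk
      have hk' : (k : ℝ) ≤ n := by exact_mod_cast (Nat.le_succ k).trans hk
      have h1 := ih ((Nat.le_succ k).trans hk)
      have h2 : C11At (φ (T / n)) (φ (k * (T / n)) x₀) := by
        refine hstep _ ⟨k * (T / n), ⟨by positivity, ?_⟩, rfl⟩ _ ⟨by positivity, hsmall⟩
        calc k * (T / n) ≤ n * (T / n) := by gcongr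
          _ = T := by field_simp
      refine (h2.comp h1).congr ?_
      filter_upwards [hΩ.mem_nhds hx₀] with x hx
      rw [← hadd x hx]
      congr 1
      push_cast; ring
  have := hind n le_rfl
  rwa [mul_div_cancel₀ _ hnpos.ne'] at this

/-- The maps of a complete flow of a `C²` field are `C^{1,1}`. -/
theorem flow_C11 {v : E → E} {Ω : Set E} (hΩ : IsOpen Ω) (hv : ∀ x ∈ Ω, ContDiffAt ℝ 2 v x)
    {φ : ℝ → E → E} (h0 : ∀ x, φ 0 x = x) (hφ : ∀ x ∈ Ω, ∀ t, φ t x ∈ Ω)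
    (hd : ∀ x ∈ Ω, ∀ t, HasDerivAt (fun t => φ t x) (v (φ t x)) t) {x₀ : E} (hx₀ : x₀ ∈ Ω)
    (T : ℝ) : C11At (φ T) x₀ := by
  rcases le_total 0 T with hT | hT
  · exact flow_C11_of_nonneg hΩ hv h0 hφ hd hx₀ hT
  · have := flow_C11_of_nonneg (v := fun x => -v x) (φ := fun t => φ (-t)) hΩ
      (fun x hx => (hv x hx).neg) (by simpa using h0) (fun x hx t => hφ x hx (-t))
      (fun x hx t => by
        have := (hd x hx (-t)).scomp t (hasDerivAt_neg t)
        simpa [Function.comp_def] using this) hx₀ (neg_nonneg.2 hT)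
    simpa using this

end flow

/-! ### The Poincaré map of the family -/

section poincare

variable {𝓗 : Family} {S : Saddle} {k : WithTop ℕ∞}

lemma isOpen_posParams (𝓗 : Family) : IsOpen 𝓗.posParams := by
  have h2 : IsOpen {ν : ℝ | (ν : EReal) < 𝓗.nuStar} :=
    isOpen_Iio.preimage continuous_coe_real_ereal
  exact isOpen_Ioi.inter h2

lemma posParams_subset_params (𝓗 : Family) : 𝓗.posParams ⊆ 𝓗.params :=
  fun _ h => ⟨h.1.le, h.2⟩

lemma params_mem_nhds {ν : ℝ} (hν : ν ∈ 𝓗.posParams) : 𝓗.params ∈ 𝓝 ν :=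
  mem_of_superset ((isOpen_posParams 𝓗).mem_nhds hν) (posParams_subset_params 𝓗)

lemma three_le_of_two_lt {r : WithTop ℕ∞} (h : 2 < r) : 3 ≤ r := by
  have h3 : (3 : WithTop ℕ∞) = ((3 : ℕ∞) : WithTop ℕ∞) := rfl
  have h2 : (2 : WithTop ℕ∞) = ((2 : ℕ∞) : WithTop ℕ∞) := rfl
  rw [h2] at h
  rw [h3]
  induction r with
  | top => exact le_top
  | coe n =>
    have h' := WithTop.coe_lt_coe.1 h
    refine WithTop.coe_le_coe.2 ?_
    have := Order.add_one_le_of_lt h'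
    convert this using 1
    norm_num

/-- The Hamiltonian as a function on the extended phase space. -/
def hamExt (𝓗 : Family) (q : Plane × ℝ × ℝ) : ℝ := 𝓗.H q.1.1 q.1.2 q.2.1 q.2.2

lemma contDiffAt_hamExt (h : IsFrequencySpanning 𝓗 S k) {q : Plane × ℝ × ℝ}
    (hq : q.2.2 ∈ 𝓗.posParams) : ContDiffAt ℝ 3 (hamExt 𝓗) q := by
  have hk := three_le_of_two_lt h.two_lt
  have h0 : ContDiffAt ℝ 3 (fun q : ℝ × ℝ × ℝ => 𝓗.H0 q.1 q.2.1 q.2.2) (q.1.1, q.1.2, q.2.2) :=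
    (h.forcing.smooth_H0.contDiffAt (((continuous_snd.comp continuous_snd).continuousAt
      (x := (q.1.1, q.1.2, q.2.2))).preimage_mem_nhds (params_mem_nhds hq))).of_le hk
  have h1 : ContDiffAt ℝ 3 (fun q : ℝ × ℝ × ℝ × ℝ => 𝓗.H1 q.1 q.2.1 q.2.2.1 q.2.2.2)
      (q.1.1, q.1.2, q.2.1, q.2.2) :=
    (h.forcing.smooth_H1.contDiffAt
      (((continuous_snd.comp (continuous_snd.comp continuous_snd)).continuousAt
        (x := (q.1.1, q.1.2, q.2.1, q.2.2))).preimage_mem_nhds (params_mem_nhds hq))).of_le hk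
  have l0 : ContDiff ℝ 3 (fun q : Plane × ℝ × ℝ => (q.1.1, q.1.2, q.2.2)) := by fun_prop
  have l1 : ContDiff ℝ 3 (fun q : Plane × ℝ × ℝ => (q.1.1, q.1.2, q.2.1, q.2.2)) := by fun_prop
  exact (h0.comp q l0.contDiffAt).add (h1.comp q l1.contDiffAt)

lemma field_eq (h : IsFrequencySpanning 𝓗 S k) {q : Plane × ℝ × ℝ} (hq : q.2.2 ∈ 𝓗.posParams) :
    𝓗.field q.2.1 q.2.2 q.1 = (fderiv ℝ (hamExt 𝓗) q ((0, 1), 0, 0),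
      -fderiv ℝ (hamExt 𝓗) q ((1, 0), 0, 0)) := by
  have hd := ((contDiffAt_hamExt h hq).differentiableAt (by norm_num)).hasFDerivAt
  obtain ⟨⟨x, y⟩, φ, ν⟩ := q
  have hy : HasDerivAt (fun y => 𝓗.H x y φ ν) (fderiv ℝ (hamExt 𝓗) ((x, y), φ, ν) ((0, 1), 0, 0))
      y := by
    have hl : HasDerivAt (fun y : ℝ => (((x, y), φ, ν) : Plane × ℝ × ℝ)) ((0, 1), 0, 0) y :=
      ((hasDerivAt_const y x).prodMk (hasDerivAt_id y)).prodMk (hasDerivAt_const y (φ, ν))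
    exact hd.comp_hasDerivAt y hl
  have hx : HasDerivAt (fun x => 𝓗.H x y φ ν) (fderiv ℝ (hamExt 𝓗) ((x, y), φ, ν) ((1, 0), 0, 0))
      x := by
    have hl : HasDerivAt (fun x : ℝ => (((x, y), φ, ν) : Plane × ℝ × ℝ)) ((1, 0), 0, 0) x :=
      ((hasDerivAt_id x).prodMk (hasDerivAt_const x y)).prodMk (hasDerivAt_const x (φ, ν))
    exact hd.comp_hasDerivAt x hl
  simp only [Family.field, hy.deriv, hx.deriv]

lemma contDiffAt_period (h : IsFrequencySpanning 𝓗 S k) {ν : ℝ} (hν : ν ∈ 𝓗.posParams) :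
    ContDiffAt ℝ 2 𝓗.period ν := by
  have h1 : ContDiffAt ℝ 2 𝓗.freq ν :=
    (h.frequency.smooth.contDiffAt (params_mem_nhds hν)).of_le h.two_lt.le
  exact contDiffAt_const.div h1 (h.frequency.ne_zero ν hν)

lemma freq_mul_period (h : IsFrequencySpanning 𝓗 S k) {ν : ℝ} (hν : ν ∈ 𝓗.posParams) :
    𝓗.freq ν * 𝓗.period ν = 2 * Real.pi := by
  have := h.frequency.ne_zero ν hν
  rw [Family.period]; field_simp

/-- The autonomous field on the extended phase space, with time scaled such that the forcing has
period one. -/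
def extField (𝓗 : Family) (q : Plane × ℝ × ℝ) : Plane × ℝ × ℝ :=
  (𝓗.period q.2.2 • 𝓗.field q.2.1 q.2.2 q.1, 2 * Real.pi, 0)

/-- The part of the extended phase space over the positive parameters. -/
def extDomain (𝓗 : Family) : Set (Plane × ℝ × ℝ) := {q | q.2.2 ∈ 𝓗.posParams}

lemma isOpen_extDomain (𝓗 : Family) : IsOpen (extDomain 𝓗) :=
  (isOpen_posParams 𝓗).preimage (continuous_snd.comp continuous_snd)

lemma contDiffAt_extField (h : IsFrequencySpanning 𝓗 S k) {q : Plane × ℝ × ℝ}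
    (hq : q ∈ extDomain 𝓗) : ContDiffAt ℝ 2 (extField 𝓗) q := by
  have hq' : q.2.2 ∈ 𝓗.posParams := hq
  have h1 : ContDiffAt ℝ 2 (fun q : Plane × ℝ × ℝ => 𝓗.period q.2.2) q :=
    ContDiffAt.comp (g := 𝓗.period) (f := fun q : Plane × ℝ × ℝ => q.2.2) q
      (contDiffAt_period h hq') (contDiff_snd.comp contDiff_snd).contDiffAt
  have h2 : ContDiffAt ℝ 2 (fderiv ℝ (hamExt 𝓗)) q :=
    (contDiffAt_hamExt h hq').fderiv_right (by norm_num)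
  have h3 : ContDiffAt ℝ 2 (fun q : Plane × ℝ × ℝ => 𝓗.field q.2.1 q.2.2 q.1) q := by
    refine ContDiffAt.congr_of_eventuallyEq (f := fun q => (fderiv ℝ (hamExt 𝓗) q ((0, 1), 0, 0),
      -fderiv ℝ (hamExt 𝓗) q ((1, 0), 0, 0))) ?_ ?_
    · exact (h2.clm_apply contDiffAt_const).prodMk (h2.clm_apply contDiffAt_const).neg
    · filter_upwards [(isOpen_extDomain 𝓗).mem_nhds hq] with p hp
      exact field_eq h hp
  exact (h1.smul h3).prodMk contDiffAt_const

lemma flow_spec (h : IsFrequencySpanning 𝓗 S k) {ν : ℝ} (hν : ν ∈ 𝓗.posParams) (θ : ℝ)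
    (z : Plane) : 𝓗.flow ν θ 0 z = z ∧ 𝓗.IsSolution ν θ (fun t => 𝓗.flow ν θ t z) :=
  Classical.epsilon_spec (h.complete ν (posParams_subset_params 𝓗 hν) θ z)

/-- In the time unit of one period, solutions are integral curves of the extended field. -/
lemma IsSolution.hasDerivAt_ext (h : IsFrequencySpanning 𝓗 S k) {ν : ℝ} (hν : ν ∈ 𝓗.posParams)
    {θ : ℝ} {z : ℝ → Plane} (hz : 𝓗.IsSolution ν θ z) (t : ℝ) :
    HasDerivAt (fun t => ((z (t * 𝓗.period ν), θ + t * (2 * Real.pi), ν) : Plane × ℝ × ℝ))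
      (extField 𝓗 (z (t * 𝓗.period ν), θ + t * (2 * Real.pi), ν)) t := by
  have h1 : HasDerivAt (fun t => z (t * 𝓗.period ν))
      (𝓗.period ν • 𝓗.field (θ + t * (2 * Real.pi)) ν (z (t * 𝓗.period ν))) t := by
    have := (hz (t * 𝓗.period ν)).scomp t (hasDerivAt_mul_const (𝓗.period ν))
    have e : 𝓗.freq ν * (t * 𝓗.period ν) + θ = θ + t * (2 * Real.pi) := by
      rw [← freq_mul_period h hν]; ring
    rw [e] at this
    exact this
  have h2 : HasDerivAt (fun t => θ + t * (2 * Real.pi)) (2 * Real.pi) t :=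
    (hasDerivAt_mul_const _).const_add _
  exact h1.prodMk (h2.prodMk (hasDerivAt_const t ν))

lemma IsSolution.unique (h : IsFrequencySpanning 𝓗 S k) {ν : ℝ} (hν : ν ∈ 𝓗.posParams)
    {θ : ℝ} {z w : ℝ → Plane} (hz : 𝓗.IsSolution ν θ z) (hw : 𝓗.IsSolution ν θ w)
    (h0 : z 0 = w 0) : z = w := by
  have hT : 𝓗.period ν ≠ 0 := by
    intro h0
    have := freq_mul_period h hν
    rw [h0, mul_zero] at this
    exact (by positivity : (2 * Real.pi) ≠ 0) this.symm
  funext s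
  set t := s / 𝓗.period ν with ht
  have key := solution_unique (v := extField 𝓗) (a := -|t| - 1) (b := |t| + 1) (t₀ := 0)
    ⟨by linarith [abs_nonneg t], by positivity⟩
    (fun t _ => IsSolution.hasDerivAt_ext h hν hz t)
    (fun t _ => IsSolution.hasDerivAt_ext h hν hw t)
    (fun t _ => LipAt.of_contDiffAt ((contDiffAt_extField h hν).of_le (by norm_num)))
    (by simp [h0])
  have := key (x := t) ⟨by linarith [neg_abs_le t], by linarith [le_abs_self t]⟩
  have hs : t * 𝓗.period ν = s := by rw [ht]; field_simp
  simpa [hs] using this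

/-- The flow on the extended phase space, continued by the identity. -/
def extFlow (𝓗 : Family) (t : ℝ) (q : Plane × ℝ × ℝ) : Plane × ℝ × ℝ := by
  classical exact if q ∈ extDomain 𝓗 then
    (𝓗.flow q.2.2 q.2.1 (t * 𝓗.period q.2.2) q.1, q.2.1 + t * (2 * Real.pi), q.2.2) else q

lemma extFlow_C11 (h : IsFrequencySpanning 𝓗 S k) {q : Plane × ℝ × ℝ} (hq : q ∈ extDomain 𝓗)
    (t : ℝ) : C11At (extFlow 𝓗 t) q := by
  have hval : ∀ q ∈ extDomain 𝓗, ∀ t, extFlow 𝓗 t q =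
      (𝓗.flow q.2.2 q.2.1 (t * 𝓗.period q.2.2) q.1, q.2.1 + t * (2 * Real.pi), q.2.2) :=
    fun q hq t => if_pos hq
  refine flow_C11 (isOpen_extDomain 𝓗) (fun q hq => contDiffAt_extField h hq) ?_ ?_ ?_ hq t
  · intro q
    by_cases hq : q ∈ extDomain 𝓗
    · rw [hval q hq]
      have := (flow_spec h hq q.2.1 q.1).1
      simp [this]
    · exact if_neg hq
  · intro q hq t
    rw [hval q hq]
    exact hq
  · intro q hq t
    have := IsSolution.hasDerivAt_ext h hq (flow_spec h hq q.2.1 q.1).2 t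
    simpa only [hval q hq] using this

/-- The iterates of the Poincaré map are `C^{1,1}` in the point and the parameter jointly. -/
lemma iter_C11 (h : IsFrequencySpanning 𝓗 S k) {ν : ℝ} (hν : ν ∈ 𝓗.posParams) (n : ℤ) (z : Plane) :
    C11At (fun q : Plane × ℝ => 𝓗.iter q.2 n q.1) (z, ν) := by
  have h1 : C11At (fun q : Plane × ℝ => ((q.1, 0, q.2) : Plane × ℝ × ℝ)) (z, ν) := by
    apply C11At.of_contDiffAt; fun_prop
  have h2 : C11At (extFlow 𝓗 n) ((z, 0, ν) : Plane × ℝ × ℝ) := extFlow_C11 h hν n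
  have h3 : C11At (Prod.fst : Plane × ℝ × ℝ → Plane) (extFlow 𝓗 n (z, 0, ν)) :=
    C11At.of_contDiffAt contDiffAt_fst
  have h4 : C11At (fun q : Plane × ℝ => extFlow 𝓗 n (q.1, 0, q.2)) (z, ν) :=
    C11At.comp (f := fun q : Plane × ℝ => ((q.1, 0, q.2) : Plane × ℝ × ℝ)) h2 h1
  refine (C11At.comp (f := fun q : Plane × ℝ => extFlow 𝓗 n (q.1, 0, q.2)) h3 h4).congr ?_
  have : ∀ᶠ q : Plane × ℝ in 𝓝 (z, ν), q.2 ∈ 𝓗.posParams :=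
    continuousAt_snd ((isOpen_posParams 𝓗).mem_nhds hν)
  filter_upwards [this] with q hq
  have : (q.1, 0, q.2) ∈ extDomain 𝓗 := hq
  simp [extFlow, this, Family.iter]

lemma field_periodic (h : IsFrequencySpanning 𝓗 S k) {ν : ℝ} (hν : ν ∈ 𝓗.posParams) (n : ℤ) (φ : ℝ)
    (z : Plane) : 𝓗.field (φ + n * (2 * Real.pi)) ν z = 𝓗.field φ ν z := by
  have hH : ∀ x y, 𝓗.H x y (φ + n * (2 * Real.pi)) ν = 𝓗.H x y φ ν := by
    intro x y
    have hp : Function.Periodic (fun φ => 𝓗.H1 x y φ ν) (2 * Real.pi) := fun φ =>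
      h.forcing.periodic x y φ ν (posParams_subset_params 𝓗 hν)
    have := hp.int_mul n φ
    simp only [Family.H]
    exact congrArg _ this
  simp only [Family.field, hH]

lemma iter_zero (h : IsFrequencySpanning 𝓗 S k) {ν : ℝ} (hν : ν ∈ 𝓗.posParams) (z : Plane) :
    𝓗.iter ν 0 z = z := by
  simpa [Family.iter] using (flow_spec h hν 0 z).1

lemma iter_one (𝓗 : Family) (ν : ℝ) (z : Plane) : 𝓗.iter ν 1 z = 𝓗.poincare ν 0 z := by
  simp [Family.iter, Family.poincare]

lemma iter_add (h : IsFrequencySpanning 𝓗 S k) {ν : ℝ} (hν : ν ∈ 𝓗.posParams) (m n : ℤ)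
    (z : Plane) : 𝓗.iter ν (m + n) z = 𝓗.iter ν m (𝓗.iter ν n z) := by
  have h1 : 𝓗.IsSolution ν 0 (fun t => 𝓗.flow ν 0 (t + n * 𝓗.period ν) z) := by
    intro t
    have := ((flow_spec h hν 0 z).2 (t + n * 𝓗.period ν)).comp_add_const t (n * 𝓗.period ν)
    have e : 𝓗.freq ν * (t + n * 𝓗.period ν) + 0 = (𝓗.freq ν * t + 0) + n * (2 * Real.pi) := by
      rw [← freq_mul_period h hν]; ring
    rw [e, field_periodic h hν] at this
    exact this
  have h2 := IsSolution.unique h hν h1 (flow_spec h hν 0 (𝓗.iter ν n z)).2 (by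
    rw [(flow_spec h hν 0 _).1]; simp [Family.iter])
  have h3 := congrFun h2 (m * 𝓗.period ν)
  simp only [Family.iter] at h3 ⊢
  rw [← h3]
  congr 1
  push_cast; ring

lemma iter_neg_iter (h : IsFrequencySpanning 𝓗 S k) {ν : ℝ} (hν : ν ∈ 𝓗.posParams) (n : ℤ)
    (z : Plane) : 𝓗.iter ν (-n) (𝓗.iter ν n z) = z := by
  rw [← iter_add h hν, neg_add_cancel, iter_zero h hν]

lemma iter_iter_neg (h : IsFrequencySpanning 𝓗 S k) {ν : ℝ} (hν : ν ∈ 𝓗.posParams) (n : ℤ)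
    (z : Plane) : 𝓗.iter ν n (𝓗.iter ν (-n) z) = z := by
  rw [← iter_add h hν, add_neg_cancel, iter_zero h hν]

/-- The iterates for a fixed parameter are `C¹` maps of the plane. -/
lemma contDiff_iter (h : IsFrequencySpanning 𝓗 S k) {ν : ℝ} (hν : ν ∈ 𝓗.posParams) (n : ℤ) :
    ContDiff ℝ 1 (𝓗.iter ν n) := by
  refine contDiff_iff_contDiffAt.2 fun z => ?_
  have hl : ContDiff ℝ 1 (fun z : Plane => ((z, ν) : Plane × ℝ)) := by fun_prop
  exact ContDiffAt.comp (g := fun q : Plane × ℝ => 𝓗.iter q.2 n q.1) z (iter_C11 h hν n z).1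
    hl.contDiffAt

/-- The iterates of the Poincaré map as homeomorphisms. -/
def iterHomeo (h : IsFrequencySpanning 𝓗 S k) {ν : ℝ} (hν : ν ∈ 𝓗.posParams) (n : ℤ) :
    Plane ≃ₜ Plane where
  toFun := 𝓗.iter ν n
  invFun := 𝓗.iter ν (-n)
  left_inv := iter_neg_iter h hν n
  right_inv := iter_iter_neg h hν n
  continuous_toFun := (contDiff_iter h hν n).continuous
  continuous_invFun := (contDiff_iter h hν (-n)).continuous

lemma iter_fixedPt (h : IsFrequencySpanning 𝓗 S k) {ν : ℝ} (hν : ν ∈ 𝓗.posParams) (n : ℤ) :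
    𝓗.iter ν n (S.γ 0 ν) = S.γ 0 ν := by
  have h1 := IsSolution.unique h hν
    (h.orbit.isSolution ν (posParams_subset_params 𝓗 hν) 0) (flow_spec h hν 0 (S.γ 0 ν)).2 (by
      rw [(flow_spec h hν 0 _).1]; simp)
  have h3 := congrFun h1 (n * 𝓗.period ν)
  have e : 𝓗.freq ν * (n * 𝓗.period ν) + 0 = 0 + n * (2 * Real.pi) := by
    rw [← freq_mul_period h hν]; ring
  have hp : Function.Periodic (fun φ => S.γ φ ν) (2 * Real.pi) := fun φ =>
    h.orbit.periodic φ ν (posParams_subset_params 𝓗 hν)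
  have h4 : S.γ (0 + n * (2 * Real.pi)) ν = S.γ 0 ν := hp.int_mul n 0
  beta_reduce at h3
  rw [e, h4] at h3
  exact h3.symm

end poincare

/-! ### Expanding invariant curves through a fixed point -/

section curves

variable {E : Type*} [NormedAddCommGroup E] [NormedSpace ℝ E]

/-- A map `h` with derivative `h'` near the fixed point `0`; the linear part at `0` has norm at most
`μ > 1` and attains it at the unit eigenvector `e`, and `h'` varies at most at rate `K` on the ball
of radius `r`. The constant `C` dominates the nonlinearity relative to the expansion. -/
structure LocalModel (h : E → E) (h' : E → E →L[ℝ] E) (e : E) (μ K r C : ℝ) : Prop where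
  one_lt : 1 < μ
  K_nonneg : 0 ≤ K
  dominates : 4 * K ≤ C * (μ - 1)
  norm_e : ‖e‖ = 1
  map_zero : h 0 = 0
  deriv : ∀ u, ‖u‖ ≤ r → HasFDerivAt h (h' u) u
  lip : ∀ u, ‖u‖ ≤ r → ‖h' u - h' 0‖ ≤ K * ‖u‖
  norm_le : ‖h' 0‖ ≤ μ
  eigen : h' 0 e = μ • e

/-- A `C¹` curve `q` with derivative `q'`, tangent to `e` at `q 0 = 0`, on which `h` acts as
multiplication of the parameter by `μ`. -/
structure ExpandedCurve (h : E → E) (e : E) (μ : ℝ) (q q' : ℝ → E) : Prop where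
  deriv : ∀ t, HasDerivAt q (q' t) t
  cont : Continuous q'
  zero : q 0 = 0
  deriv_zero : q' 0 = e
  conj : ∀ t, h (q t) = q (μ * t)

variable {h : E → E} {h' : E → E →L[ℝ] E} {e : E} {μ K r C : ℝ} {q q' : ℝ → E}

lemma LocalModel.C_nonneg (H : LocalModel h h' e μ K r C) : 0 ≤ C := by
  have h1 := H.dominates
  have h2 := H.K_nonneg
  have h3 := H.one_lt
  by_contra hC
  push Not at hC
  nlinarith

lemma LocalModel.norm_deriv_le (H : LocalModel h h' e μ K r C) {u : E} {ρ : ℝ} (hu : ‖u‖ ≤ ρ)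
    (hρ : ρ ≤ r) : ‖h' u‖ ≤ μ + K * ρ := by
  have h1 := H.lip u (hu.trans hρ)
  have h2 := H.norm_le
  have h3 : K * ‖u‖ ≤ K * ρ := mul_le_mul_of_nonneg_left hu H.K_nonneg
  have : ‖h' u‖ ≤ ‖h' u - h' 0‖ + ‖h' 0‖ := norm_le_norm_sub_add _ _
  linarith

lemma LocalModel.norm_sub_le (H : LocalModel h h' e μ K r C) {u w : E} {ρ : ℝ} (hu : ‖u‖ ≤ ρ)
    (hw : ‖w‖ ≤ ρ) (hρ : ρ ≤ r) : ‖h u - h w‖ ≤ (μ + K * ρ) * ‖u - w‖ := by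
  refine Convex.norm_image_sub_le_of_norm_hasFDerivWithin_le (f' := h')
    (s := Metric.closedBall 0 ρ) ?_ ?_ (convex_closedBall 0 ρ) (by simpa using hw) (by simpa using hu)
  · intro x hx
    exact (H.deriv x ((mem_closedBall_zero_iff.1 hx).trans hρ)).hasFDerivWithinAt
  · intro x hx
    exact H.norm_deriv_le (mem_closedBall_zero_iff.1 hx) hρ

/-- A sequence growing at most by the factors `μ + 2 K s μ ^ j` grows like `μ ^ k`, as
long as `s μ ^ k` stays small. -/
lemma growth_le {M A s : ℝ} (hμ : 1 < μ) (hK : 0 ≤ K) (hM : 4 * K ≤ M * (μ - 1)) (hA : 0 ≤ A)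
    (hs : 0 ≤ s) {u : ℕ → ℝ} {k : ℕ} (hk : M * (s * μ ^ k) ≤ 1) (h0 : u 0 ≤ A)
    (hstep : ∀ j < k, u j ≤ 2 * A * μ ^ j → u (j + 1) ≤ (μ + 2 * K * (s * μ ^ j)) * u j) :
    u k ≤ 2 * A * μ ^ k := by
  have hM0 : 0 ≤ M := by
    by_contra h; push Not at h; nlinarith
  have hsmall : ∀ j ≤ k, M * (s * μ ^ j) ≤ 1 := fun j hj => by
    have : μ ^ j ≤ μ ^ k := pow_le_pow_right₀ hμ.le hj
    exact le_trans (by gcongr) hk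
  have claim : ∀ j ≤ k, u j ≤ A * μ ^ j * (1 + M * (s * μ ^ j)) := by
    intro j
    induction j with
    | zero =>
      intro _
      have : 0 ≤ M * (s * μ ^ 0) := by positivity
      simp only [pow_zero, mul_one] at *
      nlinarith
    | succ j ih =>
      intro hj
      have hj' : j ≤ k := (Nat.le_succ j).trans hj
      have h1 := ih hj'
      have h2 := hsmall j hj'
      have hp : 0 < μ ^ j := by positivity
      set σ := s * μ ^ j with hσ
      have hσ0 : 0 ≤ σ := by positivity
      have h3 : u j ≤ 2 * A * μ ^ j := by
        have : A * μ ^ j * (1 + M * σ) ≤ A * μ ^ j * 2 := by gcongr; linarith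
        linarith
      have h4 := hstep j hj h3
      have h5 : (μ + 2 * K * σ) * (1 + M * σ) ≤ μ * (1 + M * (μ * σ)) := by
        nlinarith [mul_nonneg hK hσ0, mul_nonneg (mul_nonneg hK hσ0) (sub_nonneg.2 h2),
          mul_le_mul_of_nonneg_left hM (mul_nonneg (by linarith : (0 : ℝ) ≤ μ) hσ0)]
      calc u (j + 1) ≤ (μ + 2 * K * σ) * u j := h4
        _ ≤ (μ + 2 * K * σ) * (A * μ ^ j * (1 + M * σ)) := by gcongr
        _ = A * μ ^ j * ((μ + 2 * K * σ) * (1 + M * σ)) := by ring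
        _ ≤ A * μ ^ j * (μ * (1 + M * (μ * σ))) := by gcongr
        _ = A * μ ^ (j + 1) * (1 + M * (s * μ ^ (j + 1))) := by rw [hσ]; ring
  have h1 := claim k le_rfl
  have hp : 0 < μ ^ k := by positivity
  have : A * μ ^ k * (1 + M * (s * μ ^ k)) ≤ A * μ ^ k * 2 := by gcongr; linarith
  linarith

/-- The tangent of an expanded curve converges to `e` at a rate which depends only on
the constants of the local model. -/
lemma ExpandedCurve.norm_deriv_sub_le (H : LocalModel h h' e μ K r C)
    (Q : ExpandedCurve h e μ q q') {δ : ℝ} (hδ : C * δ ≤ 1 / 2) (hδr : 2 * δ ≤ r) {t : ℝ}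
    (ht : |t| ≤ δ) : ‖q' t - e‖ ≤ C * |t| := by
  have hμ0 : 0 < μ := by linarith [H.one_lt]
  have hC := H.C_nonneg
  refine le_of_forall_pos_le_add fun ε' hε' => ?_
  set ε := min ε' (1 / 2) with hε
  have hεpos : 0 < ε := by positivity
  obtain ⟨η, hη, hηq⟩ : ∃ η > 0, ∀ s, |s| < η → ‖q' s - e‖ ≤ ε := by
    have := Q.cont.continuousAt.eventually (Metric.closedBall_mem_nhds (q' 0) hεpos)
    obtain ⟨η, hη, h⟩ := Metric.eventually_nhds_iff.1 this
    refine ⟨η, hη, fun s hs => ?_⟩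
    have := h (y := s) (by simpa using hs)
    rwa [Q.deriv_zero, dist_eq_norm] at this
  have claim : ∀ n : ℕ, ∀ s, |s| < η * μ ^ n → |s| ≤ δ → ‖q' s - e‖ ≤ ε + C * |s| := by
    intro n
    induction n with
    | zero =>
      intro s hs _
      have := hηq s (by simpa using hs)
      have : 0 ≤ C * |s| := by positivity
      linarith
    | succ n ih =>
      intro s hs hsδ
      set σ := s / μ with hσ
      have hsσ : s = μ * σ := by rw [hσ]; field_simp
      have habs : |s| = μ * |σ| := by rw [hsσ, abs_mul, abs_of_pos hμ0]
      have hσs : |σ| ≤ |s| := by rw [habs]; nlinarith [abs_nonneg σ, H.one_lt]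
      have hσδ : |σ| ≤ δ := hσs.trans hsδ
      have hση : |σ| < η * μ ^ n := by
        rw [habs, pow_succ] at hs
        have : μ * |σ| < μ * (η * μ ^ n) := by linarith
        exact lt_of_mul_lt_mul_left this hμ0.le
      have hd : ∀ τ, |τ| ≤ |σ| → ‖q' τ - e‖ ≤ 1 := by
        intro τ hτ
        have h1 := ih τ (hτ.trans_lt hση) (hτ.trans hσδ)
        have h2 : C * |τ| ≤ C * δ := by gcongr; exact hτ.trans hσδ
        have h3 : ε ≤ 1 / 2 := min_le_right _ _
        linarith
      have hd2 : ∀ τ, |τ| ≤ |σ| → ‖q' τ‖ ≤ 2 := by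
        intro τ hτ
        have := hd τ hτ
        have h2 : ‖q' τ‖ ≤ ‖q' τ - e‖ + ‖e‖ := norm_le_norm_sub_add _ _
        rw [H.norm_e] at h2
        linarith
      have hqσ : ‖q σ‖ ≤ 2 * |σ| := by
        have := Convex.norm_image_sub_le_of_norm_hasDerivWithin_le (f := q) (f' := q')
          (s := Icc (-|σ|) |σ|) (C := 2) (x := 0) (y := σ)
          (fun x _ => (Q.deriv x).hasDerivWithinAt) (fun x hx => hd2 x (abs_le.2 hx))
          (convex_Icc _ _) (by simp) (abs_le.1 le_rfl)
        simpa [Q.zero] using this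
      have hqr : ‖q σ‖ ≤ r := hqσ.trans (by linarith)
      have hder : h' (q σ) (q' σ) = μ • q' (μ * σ) := by
        have h1 : HasDerivAt (fun t => h (q t)) (h' (q σ) (q' σ)) σ :=
          (H.deriv _ hqr).comp_hasDerivAt σ (Q.deriv σ)
        have h2 : HasDerivAt (fun t => q (μ * t)) (μ • q' (μ * σ)) σ := by
          have := (Q.deriv (μ * σ)).scomp σ ((hasDerivAt_id σ).const_mul μ)
          simpa [Function.comp_def] using this
        have h3 : (fun t => h (q t)) = fun t => q (μ * t) := funext Q.conj
        rw [h3] at h1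
        exact h1.unique h2
      have hsplit : μ • (q' s - e) = (h' (q σ) - h' 0) (q' σ) + h' 0 (q' σ - e) := by
        rw [smul_sub, hsσ, ← hder, ← H.eigen, map_sub, _root_.sub_apply]
        abel
      have hbound : μ * ‖q' s - e‖ ≤ K * (2 * |σ|) * 2 + μ * (ε + C * |σ|) := by
        calc μ * ‖q' s - e‖ = ‖μ • (q' s - e)‖ := by rw [norm_smul, Real.norm_of_nonneg hμ0.le]
          _ ≤ ‖(h' (q σ) - h' 0) (q' σ)‖ + ‖h' 0 (q' σ - e)‖ := by rw [hsplit]; exact norm_add_le _ _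
          _ ≤ ‖h' (q σ) - h' 0‖ * ‖q' σ‖ + ‖h' 0‖ * ‖q' σ - e‖ :=
            add_le_add (ContinuousLinearMap.le_opNorm _ _) (ContinuousLinearMap.le_opNorm _ _)
          _ ≤ K * (2 * |σ|) * 2 + μ * (ε + C * |σ|) := by
            have hK := H.K_nonneg
            gcongr
            · exact (H.lip _ hqr).trans (by gcongr)
            · exact hd2 σ le_rfl
            · exact H.norm_le
            · exact ih σ hση hσδ
      rw [habs]
      have hdom := H.dominates
      have h6 : 4 * K * |σ| ≤ C * (μ - 1) * |σ| := by gcongr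
      have h7 : C * (μ - 1) * |σ| ≤ μ * (C * (μ - 1) * |σ|) := by
        have : 0 ≤ C * (μ - 1) * |σ| := by
          have := H.one_lt
          have h8 : 0 ≤ μ - 1 := by linarith
          positivity
        nlinarith [H.one_lt]
      have h9 : μ * ‖q' s - e‖ ≤ μ * (ε + C * (μ * |σ|)) := by nlinarith
      exact le_of_mul_le_mul_left h9 hμ0
  obtain ⟨n, hn⟩ := pow_unbounded_of_one_lt (|t| / η) H.one_lt
  rw [div_lt_iff₀ hη] at hn
  have := claim n t (by linarith) ht
  have h2 : ε ≤ ε' := min_le_left _ _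
  linarith

lemma ExpandedCurve.norm_sub_smul_le (H : LocalModel h h' e μ K r C)
    (Q : ExpandedCurve h e μ q q') {δ : ℝ} (hδ : C * δ ≤ 1 / 2) (hδr : 2 * δ ≤ r) {t : ℝ}
    (ht : |t| ≤ δ) : ‖q t - t • e‖ ≤ C * |t| * |t| := by
  have hC := H.C_nonneg
  have := Convex.norm_image_sub_le_of_norm_hasDerivWithin_le (f := fun t => q t - t • e)
    (f' := fun t => q' t - e)
    (s := Icc (-|t|) |t|) (C := C * |t|) (x := 0) (y := t)
    (fun x _ => ((Q.deriv x).sub (by simpa using (hasDerivAt_id x).smul_const e)).hasDerivWithinAt)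
    (fun x hx => by
      have hx' := abs_le.2 hx
      refine (Q.norm_deriv_sub_le H hδ hδr (hx'.trans ht)).trans (by gcongr))
    (convex_Icc _ _) (by simp) (abs_le.1 le_rfl)
  simpa [Q.zero] using this

lemma ExpandedCurve.norm_le (H : LocalModel h h' e μ K r C)
    (Q : ExpandedCurve h e μ q q') {δ : ℝ} (hδ : C * δ ≤ 1 / 2) (hδr : 2 * δ ≤ r) {t : ℝ}
    (ht : |t| ≤ δ) : ‖q t‖ ≤ 2 * |t| := by
  have h1 := Q.norm_sub_smul_le H hδ hδr ht
  have h2 : ‖q t‖ ≤ ‖q t - t • e‖ + ‖t • e‖ := norm_le_norm_sub_add _ _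
  have h3 : ‖t • e‖ = |t| := by rw [norm_smul, H.norm_e, mul_one, Real.norm_eq_abs]
  have h4 : C * |t| ≤ 1 / 2 := le_trans (mul_le_mul_of_nonneg_left ht H.C_nonneg) hδ
  nlinarith [abs_nonneg t]

lemma LocalModel.norm_iterate_le (H : LocalModel h h' e μ K r C) {δ : ℝ} (hδ : C * δ ≤ 1 / 2)
    (hδr : 2 * δ ≤ r) {s : ℝ} {j : ℕ} (hs : |s| * μ ^ j ≤ δ) :
    ‖h^[j] (s • e)‖ ≤ 2 * |s| * μ ^ j := by
  have hμ0 : 0 < μ := by linarith [H.one_lt]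
  have hC := H.C_nonneg
  refine growth_le (u := fun j => ‖h^[j] (s • e)‖) (s := |s|) (M := C) H.one_lt H.K_nonneg
    H.dominates (abs_nonneg s)
    (abs_nonneg s) ?_ ?_ ?_
  · have : C * (|s| * μ ^ j) ≤ C * δ := by gcongr
    linarith
  · simp [norm_smul, H.norm_e]
  · intro i hi hb
    have hp : μ ^ i ≤ μ ^ j := pow_le_pow_right₀ H.one_lt.le hi.le
    have h1 : 2 * |s| * μ ^ i ≤ r := by
      have : |s| * μ ^ i ≤ |s| * μ ^ j := by gcongr
      linarith
    rw [Function.iterate_succ_apply']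
    have h2 := H.norm_sub_le (u := h^[i] (s • e)) (w := 0) hb (by rw [norm_zero]; positivity) h1
    rw [H.map_zero, sub_zero, sub_zero] at h2
    refine h2.trans (le_of_eq ?_)
    ring

lemma ExpandedCurve.iterate (Q : ExpandedCurve h e μ q q') (j : ℕ) (t : ℝ) :
    h^[j] (q t) = q (t * μ ^ j) := by
  induction j with
  | zero => simp
  | succ j ih =>
    rw [Function.iterate_succ_apply', ih, Q.conj]
    congr 1; ring

/-- The curve is the limit of the iterates of short linear segments, at a uniform rate. -/
lemma ExpandedCurve.norm_sub_iterate_le (H : LocalModel h h' e μ K r C)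
    (Q : ExpandedCurve h e μ q q') {δ : ℝ} (hδ : C * δ ≤ 1 / 2) (hδr : 2 * δ ≤ r) {t : ℝ}
    (ht : |t| ≤ δ) (k : ℕ) : ‖q t - h^[k] ((t / μ ^ k) • e)‖ ≤ 2 * C * δ ^ 2 / μ ^ k := by
  have hμ0 : 0 < μ := by linarith [H.one_lt]
  have hC := H.C_nonneg
  have hpk : 0 < μ ^ k := by positivity
  set s := t / μ ^ k with hs
  have hst : |s| * μ ^ k = |t| := by
    rw [hs, abs_div, abs_of_pos hpk]; field_simp
  have hsj : ∀ j ≤ k, |s| * μ ^ j ≤ δ := fun j hj => by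
    have : μ ^ j ≤ μ ^ k := pow_le_pow_right₀ H.one_lt.le hj
    calc |s| * μ ^ j ≤ |s| * μ ^ k := by gcongr
      _ ≤ δ := by rw [hst]; exact ht
  have hsδ : |s| ≤ δ := by simpa using hsj 0 (Nat.zero_le k)
  have key := growth_le (u := fun j => ‖h^[j] (q s) - h^[j] (s • e)‖) (A := C * |s| * |s|)
    (s := |s|) (M := C) (k := k) H.one_lt H.K_nonneg H.dominates (by positivity) (abs_nonneg s) ?_
    (Q.norm_sub_smul_le H hδ hδr hsδ) ?_
  · have e1 : h^[k] (q s) = q t := by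
      rw [Q.iterate]; congr 1; rw [hs]; field_simp
    simp only [e1] at key
    refine key.trans ?_
    rw [le_div_iff₀ hpk]
    calc 2 * (C * |s| * |s|) * μ ^ k * μ ^ k = 2 * C * (|s| * μ ^ k) ^ 2 := by ring
      _ ≤ 2 * C * δ ^ 2 := by rw [hst]; gcongr
  · have : C * (|s| * μ ^ k) ≤ C * δ := by gcongr; exact hsj k le_rfl
    linarith
  · intro j hj _
    have hjk := hsj j hj.le
    rw [Function.iterate_succ_apply', Function.iterate_succ_apply']
    have e1 : ‖h^[j] (q s)‖ ≤ 2 * (|s| * μ ^ j) := by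
      rw [Q.iterate]
      have := Q.norm_le H hδ hδr (t := s * μ ^ j) (by
        rw [abs_mul, abs_of_pos (by positivity : 0 < μ ^ j)]; exact hjk)
      rwa [abs_mul, abs_of_pos (by positivity : 0 < μ ^ j)] at this
    have e2 := H.norm_iterate_le hδ hδr hjk
    have := H.norm_sub_le e1 (w := h^[j] (s • e)) (by linarith) (by linarith)
    refine this.trans (le_of_eq ?_)
    ring

/-- Products of the derivatives of `h` along the curve, applied to `e`: with `s = t / μ ^ k` these
are the approximations of `μ ^ k q'(t)`. -/
def tangentIter (h' : E → E →L[ℝ] E) (q : ℝ → E) (e : E) (μ s : ℝ) : ℕ → E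
  | 0 => e
  | j + 1 => h' (q (s * μ ^ j)) (tangentIter h' q e μ s j)

lemma ExpandedCurve.norm_deriv_sub_tangentIter_le (H : LocalModel h h' e μ K r C)
    (Q : ExpandedCurve h e μ q q') {δ : ℝ} (hδ : C * δ ≤ 1 / 2) (hδr : 2 * δ ≤ r) {t : ℝ}
    (ht : |t| ≤ δ) (k : ℕ) :
    ‖q' t - (μ ^ k)⁻¹ • tangentIter h' q e μ (t / μ ^ k) k‖ ≤ 2 * C * δ / μ ^ k := by
  have hμ0 : 0 < μ := by linarith [H.one_lt]
  have hC := H.C_nonneg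
  have hpk : 0 < μ ^ k := by positivity
  set s := t / μ ^ k with hs
  have hst : |s| * μ ^ k = |t| := by
    rw [hs, abs_div, abs_of_pos hpk]; field_simp
  have hsj : ∀ j ≤ k, |s| * μ ^ j ≤ δ := fun j hj => by
    have : μ ^ j ≤ μ ^ k := pow_le_pow_right₀ H.one_lt.le hj
    calc |s| * μ ^ j ≤ |s| * μ ^ k := by gcongr
      _ ≤ δ := by rw [hst]; exact ht
  have hsδ : |s| ≤ δ := by simpa using hsj 0 (Nat.zero_le k)
  have key := growth_le (u := fun j => ‖μ ^ j • q' (s * μ ^ j) - tangentIter h' q e μ s j‖)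
    (A := C * |s|) (s := |s|) (M := C) (k := k) H.one_lt H.K_nonneg H.dominates (by positivity)
    (abs_nonneg s) ?_ ?_ ?_
  · have e1 : s * μ ^ k = t := by rw [hs]; field_simp
    simp only [e1] at key
    have e2 : q' t - (μ ^ k)⁻¹ • tangentIter h' q e μ s k
        = (μ ^ k)⁻¹ • (μ ^ k • q' t - tangentIter h' q e μ s k) := by
      rw [smul_sub, smul_smul, inv_mul_cancel₀ hpk.ne', one_smul]
    rw [e2, norm_smul, norm_inv, Real.norm_of_nonneg hpk.le]
    calc (μ ^ k)⁻¹ * ‖μ ^ k • q' t - tangentIter h' q e μ s k‖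
        ≤ (μ ^ k)⁻¹ * (2 * (C * |s|) * μ ^ k) := by gcongr
      _ = 2 * C * (|s| * μ ^ k) / μ ^ k := by field_simp
      _ ≤ 2 * C * δ / μ ^ k := by rw [hst]; gcongr
  · have : C * (|s| * μ ^ k) ≤ C * δ := by gcongr; exact hsj k le_rfl
    linarith
  · simpa [tangentIter] using Q.norm_deriv_sub_le H hδ hδr hsδ
  · intro j hj _
    have hjk := hsj j hj.le
    have hpj : 0 < μ ^ j := by positivity
    have e1 : ‖q (s * μ ^ j)‖ ≤ 2 * (|s| * μ ^ j) := by
      have := Q.norm_le H hδ hδr (t := s * μ ^ j) (by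
        rw [abs_mul, abs_of_pos hpj]; exact hjk)
      rwa [abs_mul, abs_of_pos hpj] at this
    have hqr : ‖q (s * μ ^ j)‖ ≤ r := e1.trans (by linarith)
    have hder : h' (q (s * μ ^ j)) (q' (s * μ ^ j)) = μ • q' (μ * (s * μ ^ j)) := by
      have h1 : HasDerivAt (fun t => h (q t)) (h' (q (s * μ ^ j)) (q' (s * μ ^ j))) (s * μ ^ j) :=
        (H.deriv _ hqr).comp_hasDerivAt _ (Q.deriv _)
      have h2 : HasDerivAt (fun t => q (μ * t)) (μ • q' (μ * (s * μ ^ j))) (s * μ ^ j) := by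
        have := (Q.deriv (μ * (s * μ ^ j))).scomp (s * μ ^ j) ((hasDerivAt_id _).const_mul μ)
        simpa [Function.comp_def] using this
      have h3 : (fun t => h (q t)) = fun t => q (μ * t) := funext Q.conj
      rw [h3] at h1
      exact h1.unique h2
    have e2 : μ ^ (j + 1) • q' (s * μ ^ (j + 1)) - tangentIter h' q e μ s (j + 1)
        = h' (q (s * μ ^ j)) (μ ^ j • q' (s * μ ^ j) - tangentIter h' q e μ s j) := by
      rw [map_sub, map_smul, hder, smul_smul, tangentIter]
      congr 2
      congr 1; ring
    rw [e2]
    refine (ContinuousLinearMap.le_opNorm _ _).trans ?_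
    gcongr
    have := H.norm_deriv_le e1 (by linarith)
    linarith

/-- An expanded curve is determined by its tangent vector at the fixed point. -/
lemma ExpandedCurve.unique {q₁ q₁' q₂ q₂' : ℝ → E} (H : LocalModel h h' e μ K r C) (hr : 0 < r)
    (Q₁ : ExpandedCurve h e μ q₁ q₁') (Q₂ : ExpandedCurve h e μ q₂ q₂') : q₁ = q₂ := by
  have hμ0 : 0 < μ := by linarith [H.one_lt]
  have hC := H.C_nonneg
  set δ := min (r / 2) (1 / (2 * (C + 1))) with hδ
  have hδ0 : 0 < δ := by positivity
  have hδr : 2 * δ ≤ r := by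
    have := min_le_left (r / 2) (1 / (2 * (C + 1)))
    rw [← hδ] at this; linarith
  have hδC : C * δ ≤ 1 / 2 := by
    have h1 := min_le_right (r / 2) (1 / (2 * (C + 1)))
    rw [← hδ, le_div_iff₀ (by positivity)] at h1
    nlinarith
  have hloc : ∀ t, |t| ≤ δ → q₁ t = q₂ t := by
    intro t ht
    have hlim : Tendsto (fun k : ℕ => 2 * (2 * C * δ ^ 2) * (1 / μ) ^ k) atTop (𝓝 0) := by
      have := tendsto_pow_atTop_nhds_zero_of_lt_one (r := 1 / μ) (by positivity)
        (by rw [div_lt_one hμ0]; exact H.one_lt)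
      simpa using this.const_mul (2 * (2 * C * δ ^ 2))
    have hle : ∀ k : ℕ, ‖q₁ t - q₂ t‖ ≤ 2 * (2 * C * δ ^ 2) * (1 / μ) ^ k := by
      intro k
      have h1 := Q₁.norm_sub_iterate_le H hδC hδr ht k
      have h2 := Q₂.norm_sub_iterate_le H hδC hδr ht k
      have h3 : ‖q₁ t - q₂ t‖ ≤ ‖q₁ t - h^[k] ((t / μ ^ k) • e)‖
          + ‖q₂ t - h^[k] ((t / μ ^ k) • e)‖ := by
        have := norm_sub_le (q₁ t - h^[k] ((t / μ ^ k) • e)) (q₂ t - h^[k] ((t / μ ^ k) • e))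
        simpa using this
      calc ‖q₁ t - q₂ t‖ ≤ 2 * C * δ ^ 2 / μ ^ k + 2 * C * δ ^ 2 / μ ^ k := by linarith
        _ = 2 * (2 * C * δ ^ 2) * (1 / μ) ^ k := by rw [one_div, inv_pow]; ring
    have := ge_of_tendsto' hlim hle
    exact sub_eq_zero.1 (norm_le_zero_iff.1 this)
  funext t
  obtain ⟨n, hn⟩ := pow_unbounded_of_one_lt (|t| / δ) H.one_lt
  rw [div_lt_iff₀ hδ0] at hn
  have hpn : 0 < μ ^ n := by positivity
  have h1 := hloc (t / μ ^ n) (by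
    rw [abs_div, abs_of_pos hpn, div_le_iff₀ hpn]; linarith)
  have e1 := Q₁.iterate n (t / μ ^ n)
  have e2 := Q₂.iterate n (t / μ ^ n)
  rw [div_mul_cancel₀ _ hpn.ne'] at e1 e2
  rw [← e1, ← e2, h1]

/-- Expanded curves of a continuous family of maps form a continuous family near the
fixed point, and so do their tangents. -/
lemma continuousOn_expandedCurve {X : Type*} [TopologicalSpace X] {V : Set X} {h : X → E → E}
    {h' : X → E → E →L[ℝ] E} {μ : X → ℝ} {m : ℝ} {q q' : X → ℝ → E} (hm : 1 < m)
    (hmμ : ∀ ν ∈ V, m ≤ μ ν) (H : ∀ ν ∈ V, LocalModel (h ν) (h' ν) e (μ ν) K r C)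
    (Q : ∀ ν ∈ V, ExpandedCurve (h ν) e (μ ν) (q ν) (q' ν)) (hμ : ContinuousOn μ V)
    (hh : ContinuousOn (fun p : X × E => h p.1 p.2) (V ×ˢ Metric.closedBall 0 r))
    (hh' : ContinuousOn (fun p : X × E => h' p.1 p.2) (V ×ˢ Metric.closedBall 0 r))
    {δ : ℝ} (hC : 0 ≤ C) (hδ0 : 0 ≤ δ) (hδ : C * δ ≤ 1 / 2) (hδr : 2 * δ ≤ r) :
    ContinuousOn (fun p : X × ℝ => q p.1 p.2) (V ×ˢ Icc (-δ) δ) ∧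
      ContinuousOn (fun p : X × ℝ => q' p.1 p.2) (V ×ˢ Icc (-δ) δ) := by
  set s := V ×ˢ Icc (-δ) δ with hs
  have hμ1 : ContinuousOn (fun p : X × ℝ => μ p.1) s := hμ.comp continuousOn_fst fun p hp => hp.1
  have hμpos : ∀ ν ∈ V, 0 < μ ν := fun ν hν => by linarith [hmμ ν hν]
  have hdiv : ∀ k : ℕ, ContinuousOn (fun p : X × ℝ => p.2 / μ p.1 ^ k) s := fun k =>
    continuousOn_snd.div (hμ1.pow k) fun p hp => (pow_pos (hμpos p.1 hp.1) k).ne'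
  have hsmall : ∀ p ∈ s, ∀ k : ℕ, ∀ j ≤ k, |p.2 / μ p.1 ^ k| * μ p.1 ^ j ≤ δ := by
    intro p hp k j hj
    have h1 := hμpos p.1 hp.1
    have h2 : μ p.1 ^ j ≤ μ p.1 ^ k :=
      pow_le_pow_right₀ (hm.le.trans (hmμ p.1 hp.1)) hj
    have hpk : 0 < μ p.1 ^ k := by positivity
    rw [abs_div, abs_of_pos hpk, div_mul_eq_mul_div, div_le_iff₀ hpk]
    have h3 : |p.2| ≤ δ := abs_le.2 hp.2
    gcongr
  -- a geometric majorant independent of the parameter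
  have hgeom : ∀ A : ℝ, 0 ≤ A → ∀ ε > 0, ∀ᶠ k : ℕ in atTop, ∀ p ∈ s, A / μ p.1 ^ k < ε := by
    intro A hA ε hε
    have h1 : Tendsto (fun k : ℕ => A * (1 / m) ^ k) atTop (𝓝 0) := by
      have := tendsto_pow_atTop_nhds_zero_of_lt_one (r := 1 / m) (by positivity)
        (by rw [div_lt_one (by positivity)]; exact hm)
      simpa using this.const_mul A
    filter_upwards [h1.eventually (gt_mem_nhds hε)] with k hk p hp
    refine lt_of_le_of_lt ?_ hk
    rw [one_div, inv_pow, ← div_eq_mul_inv]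
    have := hmμ p.1 hp.1
    gcongr
  have hiter : ∀ k j : ℕ, j ≤ k →
      ContinuousOn (fun p : X × ℝ => (h p.1)^[j] ((p.2 / μ p.1 ^ k) • e)) s := by
    intro k j
    induction j with
    | zero => intro _; exact (hdiv k).smul continuousOn_const
    | succ j ih =>
      intro hj
      have h1 := ih (Nat.le_of_succ_le hj)
      simp only [Function.iterate_succ_apply']
      refine hh.comp (continuousOn_fst.prodMk h1) fun p hp => ⟨hp.1, ?_⟩
      rw [mem_closedBall_zero_iff]
      have h2 := hsmall p hp k j (Nat.le_of_succ_le hj)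
      refine ((H p.1 hp.1).norm_iterate_le hδ hδr h2).trans ?_
      linarith
  have hq : ContinuousOn (fun p : X × ℝ => q p.1 p.2) s := by
    refine TendstoUniformlyOn.continuousOn (p := atTop)
      (F := fun (k : ℕ) (p : X × ℝ) => (h p.1)^[k] ((p.2 / μ p.1 ^ k) • e)) ?_
      (Eventually.of_forall fun k => hiter k k le_rfl).frequently
    rw [Metric.tendstoUniformlyOn_iff]
    intro ε hε
    filter_upwards [hgeom (2 * C * δ ^ 2) (by positivity) ε hε] with k hk p hp
    rw [dist_eq_norm]
    exact ((Q p.1 hp.1).norm_sub_iterate_le (H p.1 hp.1) hδ hδr (abs_le.2 hp.2) k).trans_lt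
      (hk p hp)
  refine ⟨hq, ?_⟩
  have htan : ∀ k j : ℕ, j ≤ k → ContinuousOn (fun p : X × ℝ =>
      tangentIter (h' p.1) (q p.1) e (μ p.1) (p.2 / μ p.1 ^ k) j) s := by
    intro k j
    induction j with
    | zero => intro _; exact continuousOn_const
    | succ j ih =>
      intro hj
      have hj' := Nat.le_of_succ_le hj
      have hmem : ∀ p ∈ s, |p.2 / μ p.1 ^ k * μ p.1 ^ j| ≤ δ := fun p hp => by
        rw [abs_mul, abs_of_pos (pow_pos (hμpos p.1 hp.1) j)]
        exact hsmall p hp k j hj'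
      have h1 : ContinuousOn (fun p : X × ℝ => q p.1 (p.2 / μ p.1 ^ k * μ p.1 ^ j)) s :=
        hq.comp (f := fun p : X × ℝ => (p.1, p.2 / μ p.1 ^ k * μ p.1 ^ j))
          (continuousOn_fst.prodMk ((hdiv k).mul (hμ1.pow j)))
          fun p hp => ⟨hp.1, abs_le.1 (hmem p hp)⟩
      have h2 : ContinuousOn (fun p : X × ℝ => h' p.1 (q p.1 (p.2 / μ p.1 ^ k * μ p.1 ^ j))) s := by
        refine hh'.comp (f := fun p : X × ℝ => (p.1, q p.1 (p.2 / μ p.1 ^ k * μ p.1 ^ j)))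
          (continuousOn_fst.prodMk h1) fun p hp => ⟨hp.1, ?_⟩
        rw [mem_closedBall_zero_iff]
        have h3 := hmem p hp
        exact ((Q p.1 hp.1).norm_le (H p.1 hp.1) hδ hδr h3).trans (by linarith)
      exact h2.clm_apply (ih hj')
  refine TendstoUniformlyOn.continuousOn (p := atTop)
    (F := fun (k : ℕ) (p : X × ℝ) => (μ p.1 ^ k)⁻¹ •
      tangentIter (h' p.1) (q p.1) e (μ p.1) (p.2 / μ p.1 ^ k) k) ?_
    (Eventually.of_forall fun k => ?_).frequently
  · rw [Metric.tendstoUniformlyOn_iff]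
    intro ε hε
    filter_upwards [hgeom (2 * C * δ) (by positivity) ε hε] with k hk p hp
    rw [dist_eq_norm]
    exact ((Q p.1 hp.1).norm_deriv_sub_tangentIter_le (H p.1 hp.1) hδ hδr (abs_le.2 hp.2)
      k).trans_lt (hk p hp)
  · exact ((hμ1.pow k).inv₀ fun p hp => (pow_pos (hμpos p.1 hp.1) k).ne').smul (htan k k le_rfl)

end curves

/-! ### Families of planar saddles and their invariant curves -/

section wedge

/-- The oriented area spanned by two vectors of the plane. -/
def wedge (u w : Plane) : ℝ := u.1 * w.2 - u.2 * w.1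

lemma exists_smul_of_wedge_eq_zero {u w : Plane} (hu : u ≠ 0) (h : wedge u w = 0) :
    ∃ c : ℝ, w = c • u := by
  obtain ⟨a, b⟩ := u
  obtain ⟨x, y⟩ := w
  simp only [wedge] at h
  by_cases ha : a = 0
  · have hb : b ≠ 0 := fun hb => hu (by simp [ha, hb])
    refine ⟨y / b, ?_⟩
    subst ha
    have : x = 0 := by
      have : b * x = 0 := by linarith
      exact (mul_eq_zero.1 this).resolve_left hb
    ext <;> simp [this, hb]
  · refine ⟨x / a, ?_⟩
    ext
    · simp [ha]
    · simp only [Prod.smul_mk, smul_eq_mul]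
      field_simp; linarith

lemma linearIndependent_iff_wedge_ne_zero {u w : Plane} :
    LinearIndependent ℝ ![u, w] ↔ wedge u w ≠ 0 := by
  rw [LinearIndependent.pair_iff]
  constructor
  · intro h h0
    have h1 := h w.2 (-u.2) (by
      ext
      · simp only [wedge] at h0; simp; linarith
      · simp; ring)
    have h2 := h w.1 (-u.1) (by
      ext
      · simp; ring
      · simp only [wedge] at h0; simp; linarith)
    have hu : u = 0 := by ext <;> simp <;> linarith [h1.2, h2.2]
    have := h 1 0 (by simp [hu])
    exact one_ne_zero this.1
  · intro h s t hst
    have h1 : s * u.1 + t * w.1 = 0 := by simpa using congrArg Prod.fst hst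
    have h2 : s * u.2 + t * w.2 = 0 := by simpa using congrArg Prod.snd hst
    have hs : s * wedge u w = 0 := by
      rw [wedge]; linear_combination w.2 * h1 - w.1 * h2
    have ht : t * wedge u w = 0 := by
      rw [wedge]; linear_combination u.1 * h2 - u.2 * h1
    exact ⟨(mul_eq_zero.1 hs).resolve_right h, (mul_eq_zero.1 ht).resolve_right h⟩

/-- The linear map with columns `u`, `w`. -/
def colMap (u w : Plane) : Plane →L[ℝ] Plane :=
  (ContinuousLinearMap.fst ℝ ℝ ℝ).smulRight u + (ContinuousLinearMap.snd ℝ ℝ ℝ).smulRight w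

@[simp] lemma colMap_apply (u w p : Plane) : colMap u w p = p.1 • u + p.2 • w := by simp [colMap]

/-- The inverse of `colMap u w`, by Cramer's rule. -/
def colInv (u w : Plane) : Plane →L[ℝ] Plane :=
  (wedge u w)⁻¹ • (
    w.2 • (ContinuousLinearMap.fst ℝ ℝ ℝ).smulRight ((1, 0) : Plane)
    - w.1 • (ContinuousLinearMap.snd ℝ ℝ ℝ).smulRight ((1, 0) : Plane)
    + u.1 • (ContinuousLinearMap.snd ℝ ℝ ℝ).smulRight ((0, 1) : Plane)
    - u.2 • (ContinuousLinearMap.fst ℝ ℝ ℝ).smulRight ((0, 1) : Plane))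

lemma colInv_apply (u w p : Plane) : colInv u w p =
    ((wedge u w)⁻¹ * (w.2 * p.1 - w.1 * p.2), (wedge u w)⁻¹ * (u.1 * p.2 - u.2 * p.1)) := by
  ext <;> simp [colInv]

lemma colInv_colMap {u w : Plane} (h : wedge u w ≠ 0) (p : Plane) :
    colInv u w (colMap u w p) = p := by
  rw [colInv_apply]
  ext
  · simp only [colMap_apply, Prod.fst_add, Prod.snd_add, Prod.smul_fst, Prod.smul_snd, smul_eq_mul]
    rw [inv_mul_eq_iff_eq_mul₀ h, wedge]; ring
  · simp only [colMap_apply, Prod.fst_add, Prod.snd_add, Prod.smul_fst, Prod.smul_snd, smul_eq_mul]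
    rw [inv_mul_eq_iff_eq_mul₀ h, wedge]; ring

lemma colMap_colInv {u w : Plane} (h : wedge u w ≠ 0) (p : Plane) :
    colMap u w (colInv u w p) = p := by
  rw [colInv_apply]
  ext
  · simp only [colMap_apply, Prod.fst_add, Prod.smul_fst, smul_eq_mul]
    rw [mul_assoc, mul_assoc, ← mul_add, inv_mul_eq_iff_eq_mul₀ h, wedge]; ring
  · simp only [colMap_apply, Prod.snd_add, Prod.smul_snd, smul_eq_mul]
    rw [mul_assoc, mul_assoc, ← mul_add, inv_mul_eq_iff_eq_mul₀ h, wedge]; ring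

lemma continuous_wedge : Continuous fun p : Plane × Plane => wedge p.1 p.2 := by
  unfold wedge; fun_prop

lemma continuous_colMap : Continuous fun p : Plane × Plane => colMap p.1 p.2 := by
  have h : Continuous fun u : Plane => (ContinuousLinearMap.fst ℝ ℝ ℝ).smulRight u :=
    ((ContinuousLinearMap.smulRightL ℝ Plane Plane) (ContinuousLinearMap.fst ℝ ℝ ℝ)).continuous
  have h' : Continuous fun u : Plane => (ContinuousLinearMap.snd ℝ ℝ ℝ).smulRight u :=
    ((ContinuousLinearMap.smulRightL ℝ Plane Plane) (ContinuousLinearMap.snd ℝ ℝ ℝ)).continuous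
  exact (h.comp continuous_fst).add (h'.comp continuous_snd)

lemma continuousAt_colInv {p : Plane × Plane} (h : wedge p.1 p.2 ≠ 0) :
    ContinuousAt (fun p : Plane × Plane => colInv p.1 p.2) p := by
  unfold colInv
  exact (continuous_wedge.continuousAt.inv₀ h).smul (by fun_prop)

end wedge

section saddles

/-- A family of planar maps, over an open set `D` of parameters, with saddle fixed points `γ ν`:
the eigenvector `eu ν` is expanded by the factor `μ ν`, the eigenvector `es ν` contracted by `l ν`. -/
structure SaddleFamily (D : Set ℝ) (G : Plane × ℝ → Plane) (γ eu es : ℝ → Plane) (μ l : ℝ → ℝ) :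
    Prop where
  isOpen : IsOpen D
  c11 : ∀ ν ∈ D, ∀ z, C11At G (z, ν)
  cont_γ : ContinuousOn γ D
  cont_eu : ContinuousOn eu D
  cont_es : ContinuousOn es D
  fixed : ∀ ν ∈ D, G (γ ν, ν) = γ ν
  eu_ne : ∀ ν ∈ D, eu ν ≠ 0
  es_ne : ∀ ν ∈ D, es ν ≠ 0
  one_lt : ∀ ν ∈ D, 1 < μ ν
  pos : ∀ ν ∈ D, 0 < l ν
  lt_one : ∀ ν ∈ D, l ν < 1
  eigen_u : ∀ ν ∈ D, fderiv ℝ (fun z => G (z, ν)) (γ ν) (eu ν) = μ ν • eu ν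
  eigen_s : ∀ ν ∈ D, fderiv ℝ (fun z => G (z, ν)) (γ ν) (es ν) = l ν • es ν

/-- A curve through `γ ν` with tangent vector `eu ν` on which the map acts as multiplication of the
parameter by `μ ν`. -/
structure IsNormalCurve (G : Plane × ℝ → Plane) (γ eu : ℝ → Plane) (μ : ℝ → ℝ) (ν : ℝ)
    (c : ℝ → Plane) : Prop where
  smooth : ContDiff ℝ 1 c
  zero : c 0 = γ ν
  deriv_zero : deriv c 0 = eu ν
  conj : ∀ t, G (c t, ν) = c (μ ν * t)

variable {D : Set ℝ} {G : Plane × ℝ → Plane} {γ eu es : ℝ → Plane} {μ l : ℝ → ℝ}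

/-- The derivative of `G` in the point of the plane. -/
def planeDeriv (G : Plane × ℝ → Plane) (q : Plane × ℝ) : Plane →L[ℝ] Plane :=
  (fderiv ℝ G q).comp (ContinuousLinearMap.inl ℝ Plane ℝ)

lemma hasFDerivAt_slice {q : Plane × ℝ} (h : DifferentiableAt ℝ G q) :
    HasFDerivAt (fun z => G (z, q.2)) (planeDeriv G q) q.1 :=
  HasFDerivAt.comp (g := G) (f := fun z : Plane => (z, q.2)) q.1 h.hasFDerivAt
    (hasFDerivAt_prodMk_left q.1 q.2)

lemma SaddleFamily.differentiableAt (H : SaddleFamily D G γ eu es μ l) {ν : ℝ} (hν : ν ∈ D)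
    (z : Plane) : DifferentiableAt ℝ G (z, ν) :=
  (H.c11 ν hν z).1.differentiableAt one_ne_zero

lemma SaddleFamily.continuousAt_planeDeriv (H : SaddleFamily D G γ eu es μ l) {ν : ℝ} (hν : ν ∈ D)
    (z : Plane) : ContinuousAt (planeDeriv G) (z, ν) :=
  (H.c11 ν hν z).2.continuousAt.clm_comp continuousAt_const

lemma SaddleFamily.planeDeriv_eu (H : SaddleFamily D G γ eu es μ l) {ν : ℝ} (hν : ν ∈ D) :
    planeDeriv G (γ ν, ν) (eu ν) = μ ν • eu ν := by
  rw [← H.eigen_u ν hν, (hasFDerivAt_slice (H.differentiableAt hν (γ ν))).fderiv]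

lemma SaddleFamily.planeDeriv_es (H : SaddleFamily D G γ eu es μ l) {ν : ℝ} (hν : ν ∈ D) :
    planeDeriv G (γ ν, ν) (es ν) = l ν • es ν := by
  rw [← H.eigen_s ν hν, (hasFDerivAt_slice (H.differentiableAt hν (γ ν))).fderiv]

lemma SaddleFamily.wedge_ne_zero (H : SaddleFamily D G γ eu es μ l) {ν : ℝ} (hν : ν ∈ D) :
    wedge (eu ν) (es ν) ≠ 0 := by
  intro h
  obtain ⟨c, hc⟩ := exists_smul_of_wedge_eq_zero (H.eu_ne ν hν) h
  have hc0 : c ≠ 0 := by rintro rfl; exact H.es_ne ν hν (by simpa using hc)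
  have h1 := H.planeDeriv_es hν
  rw [hc, map_smul, H.planeDeriv_eu hν, smul_smul, smul_smul] at h1
  have h2 := smul_left_injective ℝ (H.eu_ne ν hν) h1
  have h3 : μ ν = l ν := by
    have : c * μ ν = c * l ν := by rw [h2]; ring
    exact mul_left_cancel₀ hc0 this
  linarith [H.one_lt ν hν, H.lt_one ν hν]

lemma SaddleFamily.continuousAt_μ (H : SaddleFamily D G γ eu es μ l) {ν : ℝ} (hν : ν ∈ D) :
    ContinuousAt μ ν := by
  have hn : D ∈ 𝓝 ν := H.isOpen.mem_nhds hν
  have hγ := H.cont_γ.continuousAt hn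
  have heu := H.cont_eu.continuousAt hn
  have hD : ContinuousAt (fun ν => planeDeriv G (γ ν, ν) (eu ν)) ν :=
    (ContinuousAt.comp (f := fun ν => (γ ν, ν)) (H.continuousAt_planeDeriv hν (γ ν))
      (hγ.prodMk continuousAt_id)).clm_apply heu
  have hne : ∀ ν ∈ D, (eu ν).1 * (eu ν).1 + (eu ν).2 * (eu ν).2 ≠ 0 := by
    intro ν hν h
    refine H.eu_ne ν hν ?_
    have h1 : (eu ν).1 = 0 := by nlinarith [mul_self_nonneg (eu ν).1, mul_self_nonneg (eu ν).2]
    have h2 : (eu ν).2 = 0 := by nlinarith [mul_self_nonneg (eu ν).1, mul_self_nonneg (eu ν).2]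
    exact Prod.ext h1 h2
  have hc : ContinuousAt (fun ν => ((eu ν).1 * (planeDeriv G (γ ν, ν) (eu ν)).1
      + (eu ν).2 * (planeDeriv G (γ ν, ν) (eu ν)).2)
      / ((eu ν).1 * (eu ν).1 + (eu ν).2 * (eu ν).2)) ν :=
    ((heu.fst.mul hD.fst).add (heu.snd.mul hD.snd)).div
      ((heu.fst.mul heu.fst).add (heu.snd.mul heu.snd)) (hne ν hν)
  refine hc.congr ?_
  filter_upwards [hn] with ν' hν'
  rw [H.planeDeriv_eu hν']
  simp only [Prod.smul_fst, Prod.smul_snd, smul_eq_mul]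
  rw [div_eq_iff (hne ν' hν')]; ring

/-- The map in the coordinates of the eigenvectors. -/
def conjMap (G : Plane × ℝ → Plane) (γ eu es : ℝ → Plane) (ν : ℝ) (u : Plane) : Plane :=
  colInv (eu ν) (es ν) (G (γ ν + colMap (eu ν) (es ν) u, ν) - γ ν)

/-- The derivative of `conjMap`. -/
def conjDeriv (G : Plane × ℝ → Plane) (γ eu es : ℝ → Plane) (ν : ℝ) (u : Plane) :
    Plane →L[ℝ] Plane :=
  (colInv (eu ν) (es ν)).comp
    ((planeDeriv G (γ ν + colMap (eu ν) (es ν) u, ν)).comp (colMap (eu ν) (es ν)))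

lemma SaddleFamily.continuousAt_colMap (H : SaddleFamily D G γ eu es μ l) {ν : ℝ} (hν : ν ∈ D) :
    ContinuousAt (fun ν => colMap (eu ν) (es ν)) ν :=
  ContinuousAt.comp (g := fun p : Plane × Plane => colMap p.1 p.2) (f := fun ν => (eu ν, es ν))
    continuous_colMap.continuousAt
    ((H.cont_eu.continuousAt (H.isOpen.mem_nhds hν)).prodMk
      (H.cont_es.continuousAt (H.isOpen.mem_nhds hν)))

lemma SaddleFamily.continuousAt_colInv (H : SaddleFamily D G γ eu es μ l) {ν : ℝ} (hν : ν ∈ D) :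
    ContinuousAt (fun ν => colInv (eu ν) (es ν)) ν :=
  ContinuousAt.comp (g := fun p : Plane × Plane => colInv p.1 p.2) (f := fun ν => (eu ν, es ν))
    (FreqSpan.continuousAt_colInv (H.wedge_ne_zero hν))
    ((H.cont_eu.continuousAt (H.isOpen.mem_nhds hν)).prodMk
      (H.cont_es.continuousAt (H.isOpen.mem_nhds hν)))

lemma SaddleFamily.continuousAt_base (H : SaddleFamily D G γ eu es μ l) {ν : ℝ} (hν : ν ∈ D)
    (u : Plane) : ContinuousAt (fun p : ℝ × Plane => (γ p.1 + colMap (eu p.1) (es p.1) p.2, p.1))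
      (ν, u) := by
  have h1 : ContinuousAt (fun p : ℝ × Plane => γ p.1) (ν, u) :=
    ContinuousAt.comp (g := γ) (f := Prod.fst) (H.cont_γ.continuousAt (H.isOpen.mem_nhds hν))
      continuousAt_fst
  have h2 : ContinuousAt (fun p : ℝ × Plane => colMap (eu p.1) (es p.1)) (ν, u) :=
    ContinuousAt.comp (g := fun ν => colMap (eu ν) (es ν)) (f := Prod.fst)
      (H.continuousAt_colMap hν) continuousAt_fst
  exact (h1.add (h2.clm_apply continuousAt_snd)).prodMk continuousAt_fst

lemma SaddleFamily.continuousAt_conjMap (H : SaddleFamily D G γ eu es μ l) {ν : ℝ} (hν : ν ∈ D)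
    (u : Plane) : ContinuousAt (fun p : ℝ × Plane => conjMap G γ eu es p.1 p.2) (ν, u) := by
  have h1 : ContinuousAt (fun p : ℝ × Plane => γ p.1) (ν, u) :=
    ContinuousAt.comp (g := γ) (f := Prod.fst) (H.cont_γ.continuousAt (H.isOpen.mem_nhds hν))
      continuousAt_fst
  have h2 : ContinuousAt (fun p : ℝ × Plane => colInv (eu p.1) (es p.1)) (ν, u) :=
    ContinuousAt.comp (g := fun ν => colInv (eu ν) (es ν)) (f := Prod.fst)
      (H.continuousAt_colInv hν) continuousAt_fst
  have h3 := ContinuousAt.comp (g := G)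
    (f := fun p : ℝ × Plane => (γ p.1 + colMap (eu p.1) (es p.1) p.2, p.1)) (x := (ν, u))
    (H.differentiableAt hν _).continuousAt (H.continuousAt_base hν u)
  exact h2.clm_apply (h3.sub h1)

lemma SaddleFamily.continuousAt_conjDeriv (H : SaddleFamily D G γ eu es μ l) {ν : ℝ} (hν : ν ∈ D)
    (u : Plane) : ContinuousAt (fun p : ℝ × Plane => conjDeriv G γ eu es p.1 p.2) (ν, u) := by
  have h1 : ContinuousAt (fun p : ℝ × Plane => colMap (eu p.1) (es p.1)) (ν, u) :=
    ContinuousAt.comp (g := fun ν => colMap (eu ν) (es ν)) (f := Prod.fst)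
      (H.continuousAt_colMap hν) continuousAt_fst
  have h2 : ContinuousAt (fun p : ℝ × Plane => colInv (eu p.1) (es p.1)) (ν, u) :=
    ContinuousAt.comp (g := fun ν => colInv (eu ν) (es ν)) (f := Prod.fst)
      (H.continuousAt_colInv hν) continuousAt_fst
  have h3 := ContinuousAt.comp (g := planeDeriv G)
    (f := fun p : ℝ × Plane => (γ p.1 + colMap (eu p.1) (es p.1) p.2, p.1)) (x := (ν, u))
    (H.continuousAt_planeDeriv hν _) (H.continuousAt_base hν u)
  exact h2.clm_comp (h3.clm_comp h1)

/-- In the coordinates of the eigenvectors a saddle family satisfies the hypotheses of the local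
theory with constants that are uniform near each parameter. -/
lemma SaddleFamily.exists_localModel (H : SaddleFamily D G γ eu es μ l) {ν₀ : ℝ} (hν₀ : ν₀ ∈ D) :
    ∃ V ∈ 𝓝 ν₀, V ⊆ D ∧ ∃ m K r C : ℝ, 1 < m ∧ 0 < r ∧ 0 ≤ C ∧ (∀ ν ∈ V, m ≤ μ ν) ∧ ∀ ν ∈ V,
      LocalModel (conjMap G γ eu es ν) (conjDeriv G γ eu es ν) (1, 0) (μ ν) K r C := by
  obtain ⟨K₁, U, hU, hK₁⟩ := (H.c11 ν₀ hν₀ (γ ν₀)).2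
  have hbase := H.continuousAt_base hν₀ 0
  have hmem : ∀ᶠ p : ℝ × Plane in 𝓝 (ν₀, 0), (γ p.1 + colMap (eu p.1) (es p.1) p.2, p.1) ∈ U := by
    refine hbase ?_
    simpa using hU
  rw [nhds_prod_eq, eventually_prod_iff] at hmem
  obtain ⟨pa, hpa, pb, hpb, hab⟩ := hmem
  obtain ⟨r, hr, hrb⟩ := Metric.eventually_nhds_iff.1 hpb
  set A₀ := ‖colMap (eu ν₀) (es ν₀)‖ + 1
  set B₀ := ‖colInv (eu ν₀) (es ν₀)‖ + 1
  have hA : ∀ᶠ ν in 𝓝 ν₀, ‖colMap (eu ν) (es ν)‖ < A₀ :=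
    (H.continuousAt_colMap hν₀).norm.eventually (gt_mem_nhds (lt_add_one _))
  have hB : ∀ᶠ ν in 𝓝 ν₀, ‖colInv (eu ν) (es ν)‖ < B₀ :=
    (H.continuousAt_colInv hν₀).norm.eventually (gt_mem_nhds (lt_add_one _))
  have hμ0 := H.one_lt ν₀ hν₀
  set m := (1 + μ ν₀) / 2
  have hm : ∀ᶠ ν in 𝓝 ν₀, m < μ ν :=
    (H.continuousAt_μ hν₀).eventually (lt_mem_nhds (by simp only [m]; linarith))
  have hm1 : 1 < m := by simp only [m]; linarith
  set K : ℝ := B₀ * (K₁ * A₀) * A₀ with hK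
  have hK0 : 0 ≤ K := by positivity
  have hm10 : 0 < m - 1 := by linarith
  refine ⟨{ν | pa ν ∧ ‖colMap (eu ν) (es ν)‖ < A₀ ∧ ‖colInv (eu ν) (es ν)‖ < B₀ ∧ m < μ ν ∧ ν ∈ D},
    ?_, fun ν hν => hν.2.2.2.2, m, K, r / 2, 4 * K / (m - 1), hm1, half_pos hr, by positivity,
    fun ν hν => hν.2.2.2.1.le, ?_⟩
  · filter_upwards [hpa, hA, hB, hm, H.isOpen.mem_nhds hν₀] with ν h1 h2 h3 h4 h5
    exact ⟨h1, h2, h3, h4, h5⟩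
  rintro ν ⟨hν1, hνA, hνB, hνm, hν⟩
  have hw := H.wedge_ne_zero hν
  have hU' : ∀ u : Plane, ‖u‖ ≤ r / 2 → (γ ν + colMap (eu ν) (es ν) u, ν) ∈ U := fun u hu =>
    hab hν1 (hrb (by rw [dist_zero_right]; linarith))
  have hz : γ ν + colMap (eu ν) (es ν) 0 = γ ν := by simp
  have hdiag : ∀ u : Plane, conjDeriv G γ eu es ν 0 u = (μ ν * u.1, l ν * u.2) := by
    intro u
    have : planeDeriv G (γ ν, ν) (colMap (eu ν) (es ν) u)
        = colMap (eu ν) (es ν) (μ ν * u.1, l ν * u.2) := by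
      simp only [colMap_apply, map_add, map_smul, H.planeDeriv_eu hν, H.planeDeriv_es hν, smul_smul]
      rw [mul_comm u.1, mul_comm u.2]
    simp only [conjDeriv, ContinuousLinearMap.comp_apply, hz]
    rw [this, colInv_colMap hw]
  refine ⟨H.one_lt ν hν, hK0, ?_, by simp [Prod.norm_def], ?_, ?_, ?_, ?_, ?_⟩
  · rw [div_mul_eq_mul_div, le_div_iff₀ hm10]
    have : m - 1 ≤ μ ν - 1 := by linarith
    gcongr
  · simp [conjMap, H.fixed ν hν]
  · intro u _
    have h1 : HasFDerivAt (fun u => γ ν + colMap (eu ν) (es ν) u) (colMap (eu ν) (es ν)) u :=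
      (colMap (eu ν) (es ν)).hasFDerivAt.const_add _
    have h2 := (hasFDerivAt_slice
      (H.differentiableAt hν (γ ν + colMap (eu ν) (es ν) u))).comp u h1
    exact ((colInv (eu ν) (es ν)).hasFDerivAt).comp u (h2.sub_const (γ ν))
  · intro u hu
    have e1 : conjDeriv G γ eu es ν u - conjDeriv G γ eu es ν 0 =
        (colInv (eu ν) (es ν)).comp (((fderiv ℝ G (γ ν + colMap (eu ν) (es ν) u, ν)
          - fderiv ℝ G (γ ν + colMap (eu ν) (es ν) 0, ν)).comp
            (ContinuousLinearMap.inl ℝ Plane ℝ)).comp (colMap (eu ν) (es ν))) := by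
      simp only [conjDeriv, planeDeriv, ContinuousLinearMap.sub_comp, ContinuousLinearMap.comp_sub]
    have e2 : ‖fderiv ℝ G (γ ν + colMap (eu ν) (es ν) u, ν)
          - fderiv ℝ G (γ ν + colMap (eu ν) (es ν) 0, ν)‖ ≤ K₁ * (A₀ * ‖u‖) := by
      refine (hK₁.norm_sub_le (hU' u hu) (hU' 0 (by simpa using (half_pos hr).le))).trans ?_
      gcongr
      have : (γ ν + colMap (eu ν) (es ν) u, ν) - (γ ν + colMap (eu ν) (es ν) 0, ν)
          = (colMap (eu ν) (es ν) u, (0 : ℝ)) := by ext <;> simp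
      rw [this, Prod.norm_def]
      refine max_le ?_ (by rw [norm_zero]; positivity)
      exact (ContinuousLinearMap.le_opNorm _ _).trans (by gcongr)
    rw [e1]
    calc _ ≤ ‖colInv (eu ν) (es ν)‖ * (‖fderiv ℝ G (γ ν + colMap (eu ν) (es ν) u, ν)
          - fderiv ℝ G (γ ν + colMap (eu ν) (es ν) 0, ν)‖ * 1 * ‖colMap (eu ν) (es ν)‖) := by
          refine (ContinuousLinearMap.opNorm_comp_le _ _).trans ?_
          gcongr
          refine (ContinuousLinearMap.opNorm_comp_le _ _).trans ?_
          gcongr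
          refine (ContinuousLinearMap.opNorm_comp_le _ _).trans ?_
          gcongr
          exact ContinuousLinearMap.norm_inl_le_one ℝ Plane ℝ
      _ ≤ B₀ * ((K₁ * (A₀ * ‖u‖)) * 1 * A₀) := by gcongr
      _ = K * ‖u‖ := by rw [hK]; ring
  · refine ContinuousLinearMap.opNorm_le_bound _ (by linarith [H.one_lt ν hν]) fun u => ?_
    rw [hdiag, Prod.norm_def, Prod.norm_def]
    have h1 := H.one_lt ν hν
    have h2 := H.pos ν hν
    have h3 := H.lt_one ν hν
    simp only [norm_mul, Real.norm_eq_abs, abs_of_pos h2, abs_of_pos (by linarith : 0 < μ ν)]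
    refine max_le ?_ ?_
    · gcongr; exact le_max_left _ _
    · calc l ν * |u.2| ≤ μ ν * |u.2| := by gcongr; linarith
        _ ≤ _ := by gcongr; exact le_max_right _ _
  · rw [hdiag]; ext <;> simp

lemma IsNormalCurve.expandedCurve (H : SaddleFamily D G γ eu es μ l) {ν : ℝ} (hν : ν ∈ D)
    {c : ℝ → Plane} (hc : IsNormalCurve G γ eu μ ν c) :
    ExpandedCurve (conjMap G γ eu es ν) (1, 0) (μ ν)
      (fun t => colInv (eu ν) (es ν) (c t - γ ν)) (fun t => colInv (eu ν) (es ν) (deriv c t)) := by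
  have hw := H.wedge_ne_zero hν
  refine ⟨?_, ?_, ?_, ?_, ?_⟩
  · intro t
    have h1 := (hc.smooth.differentiable one_ne_zero t).hasDerivAt
    exact (colInv (eu ν) (es ν)).hasFDerivAt.comp_hasDerivAt t (h1.sub_const (γ ν))
  · exact (colInv (eu ν) (es ν)).continuous.comp (hc.smooth.continuous_deriv le_rfl)
  · simp [hc.zero]
  · have := colInv_colMap hw (1, 0)
    simp only [hc.deriv_zero]
    simpa using this
  · intro t
    simp only [conjMap, colMap_colInv hw, add_sub_cancel, hc.conj]

/-- A normal curve is unique. -/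
lemma IsNormalCurve.unique (H : SaddleFamily D G γ eu es μ l) {ν : ℝ} (hν : ν ∈ D)
    {c c' : ℝ → Plane} (hc : IsNormalCurve G γ eu μ ν c) (hc' : IsNormalCurve G γ eu μ ν c') :
    c = c' := by
  obtain ⟨V, hV, -, m, K, r, C, -, hr, -, -, hmod⟩ := H.exists_localModel hν
  have h1 := ExpandedCurve.unique (hmod ν (mem_of_mem_nhds hV)) hr (hc.expandedCurve H hν)
    (hc'.expandedCurve H hν)
  funext t
  have h2 := congrArg (colMap (eu ν) (es ν)) (congrFun h1 t)
  simpa [colMap_colInv (H.wedge_ne_zero hν), -colMap_apply] using h2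

/-- Normal curves and their derivatives depend continuously on the parameter: near the fixed point
by the local theory, and then along the whole curve because the map propagates continuity from `t`
to `μ t`. -/
theorem continuousAt_normalCurve (H : SaddleFamily D G γ eu es μ l) {c : ℝ → ℝ → Plane}
    (hc : ∀ ν ∈ D, IsNormalCurve G γ eu μ ν (c ν)) {ν₀ : ℝ} (hν₀ : ν₀ ∈ D) (t₀ : ℝ) :
    ContinuousAt (fun p : ℝ × ℝ => c p.1 p.2) (ν₀, t₀) ∧
      ContinuousAt (fun p : ℝ × ℝ => deriv (c p.1) p.2) (ν₀, t₀) := by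
  have hμ1 := H.one_lt ν₀ hν₀
  have hμ0 : 0 < μ ν₀ := by linarith
  have hfst : ∀ t, ∀ᶠ p : ℝ × ℝ in 𝓝 (ν₀, t), p.1 ∈ D := fun t =>
    continuousAt_fst (H.isOpen.mem_nhds hν₀)
  obtain ⟨δ, hδ, hloc⟩ : ∃ δ > 0, ∀ t, |t| < δ →
      ContinuousAt (fun p : ℝ × ℝ => c p.1 p.2) (ν₀, t) ∧
        ContinuousAt (fun p : ℝ × ℝ => deriv (c p.1) p.2) (ν₀, t) := by
    obtain ⟨V, hV, hVD, m, K, r, C, hm, hr, hC, hmμ, hmod⟩ := H.exists_localModel hν₀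
    set δ := min (r / 2) (1 / (2 * (C + 1))) with hδ
    have hδ0 : 0 < δ := by positivity
    have hδr : 2 * δ ≤ r := by
      have := min_le_left (r / 2) (1 / (2 * (C + 1)))
      rw [← hδ] at this; linarith
    have hδC : C * δ ≤ 1 / 2 := by
      have h1 := min_le_right (r / 2) (1 / (2 * (C + 1)))
      rw [← hδ, le_div_iff₀ (by positivity)] at h1
      nlinarith
    obtain ⟨hq, hq'⟩ := continuousOn_expandedCurve hm hmμ hmod
      (fun ν hν => (hc ν (hVD hν)).expandedCurve H (hVD hν))
      (fun ν hν => (H.continuousAt_μ (hVD hν)).continuousWithinAt)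
      (fun p hp => (H.continuousAt_conjMap (hVD hp.1) p.2).continuousWithinAt)
      (fun p hp => (H.continuousAt_conjDeriv (hVD hp.1) p.2).continuousWithinAt)
      hC hδ0.le hδC hδr
    refine ⟨δ, hδ0, fun t ht => ?_⟩
    have hn : V ×ˢ Icc (-δ) δ ∈ 𝓝 (ν₀, t) :=
      prod_mem_nhds hV (Icc_mem_nhds (abs_lt.1 ht).1 (abs_lt.1 ht).2)
    have hcol : ContinuousAt (fun p : ℝ × ℝ => colMap (eu p.1) (es p.1)) (ν₀, t) :=
      ContinuousAt.comp (g := fun ν => colMap (eu ν) (es ν)) (f := Prod.fst)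
        (H.continuousAt_colMap hν₀) continuousAt_fst
    have hγ : ContinuousAt (fun p : ℝ × ℝ => γ p.1) (ν₀, t) :=
      ContinuousAt.comp (g := γ) (f := Prod.fst)
        (H.cont_γ.continuousAt (H.isOpen.mem_nhds hν₀)) continuousAt_fst
    constructor
    · refine ((hcol.clm_apply (hq.continuousAt hn)).add hγ).congr ?_
      filter_upwards [hfst t] with p hp
      rw [Pi.add_apply, colMap_colInv (H.wedge_ne_zero hp), sub_add_cancel]
    · refine (hcol.clm_apply (hq'.continuousAt hn)).congr ?_
      filter_upwards [hfst t] with p hp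
      rw [colMap_colInv (H.wedge_ne_zero hp)]
  -- propagation by the map
  have hstep : ∀ t, ContinuousAt (fun p : ℝ × ℝ => c p.1 p.2) (ν₀, t) ∧
        ContinuousAt (fun p : ℝ × ℝ => deriv (c p.1) p.2) (ν₀, t) →
      ContinuousAt (fun p : ℝ × ℝ => c p.1 p.2) (ν₀, μ ν₀ * t) ∧
        ContinuousAt (fun p : ℝ × ℝ => deriv (c p.1) p.2) (ν₀, μ ν₀ * t) := by
    rintro t ⟨h1, h2⟩
    have hμc : ContinuousAt (fun p : ℝ × ℝ => μ p.1) (ν₀, μ ν₀ * t) :=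
      ContinuousAt.comp (g := μ) (f := Prod.fst) (H.continuousAt_μ hν₀) continuousAt_fst
    have hdiv : ContinuousAt (fun p : ℝ × ℝ => (p.1, p.2 / μ p.1)) (ν₀, μ ν₀ * t) :=
      continuousAt_fst.prodMk (continuousAt_snd.div hμc hμ0.ne')
    have et : μ ν₀ * t / μ ν₀ = t := by field_simp
    have g1 : ContinuousAt (fun p : ℝ × ℝ => c p.1 (p.2 / μ p.1)) (ν₀, μ ν₀ * t) :=
      ContinuousAt.comp (g := fun p : ℝ × ℝ => c p.1 p.2) (f := fun p : ℝ × ℝ => (p.1, p.2 / μ p.1))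
        (by simpa only [et] using h1) hdiv
    have g2 : ContinuousAt (fun p : ℝ × ℝ => deriv (c p.1) (p.2 / μ p.1)) (ν₀, μ ν₀ * t) :=
      ContinuousAt.comp (g := fun p : ℝ × ℝ => deriv (c p.1) p.2)
        (f := fun p : ℝ × ℝ => (p.1, p.2 / μ p.1)) (by simpa only [et] using h2) hdiv
    have g3 : ContinuousAt (fun p : ℝ × ℝ => (c p.1 (p.2 / μ p.1), p.1)) (ν₀, μ ν₀ * t) :=
      g1.prodMk continuousAt_fst
    have hback : ∀ p : ℝ × ℝ, p.1 ∈ D → μ p.1 * (p.2 / μ p.1) = p.2 := fun p hp => by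
      have : μ p.1 ≠ 0 := by linarith [H.one_lt p.1 hp]
      field_simp
    constructor
    · refine (ContinuousAt.comp (g := G) (f := fun p : ℝ × ℝ => (c p.1 (p.2 / μ p.1), p.1))
        (H.differentiableAt hν₀ _).continuousAt g3).congr ?_
      filter_upwards [hfst (μ ν₀ * t)] with p hp
      rw [Function.comp_apply, (hc p.1 hp).conj, hback p hp]
    · have g4 : ContinuousAt (fun p : ℝ × ℝ => planeDeriv G (c p.1 (p.2 / μ p.1), p.1))
          (ν₀, μ ν₀ * t) :=
        ContinuousAt.comp (g := planeDeriv G) (H.continuousAt_planeDeriv hν₀ _) g3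
      refine ((hμc.inv₀ hμ0.ne').smul (g4.clm_apply g2)).congr ?_
      filter_upwards [hfst (μ ν₀ * t)] with p hp
      have hp0 : μ p.1 ≠ 0 := by linarith [H.one_lt p.1 hp]
      set s := p.2 / μ p.1 with hs
      have hcd := fun t => ((hc p.1 hp).smooth.differentiable one_ne_zero t).hasDerivAt
      have k1 : HasDerivAt (fun t => G (c p.1 t, p.1))
          (planeDeriv G (c p.1 s, p.1) (deriv (c p.1) s)) s :=
        (hasFDerivAt_slice (H.differentiableAt hp (c p.1 s))).comp_hasDerivAt s (hcd s)
      have k2 : HasDerivAt (fun t => c p.1 (μ p.1 * t)) (μ p.1 • deriv (c p.1) (μ p.1 * s)) s := by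
        have := (hcd (μ p.1 * s)).scomp s ((hasDerivAt_id s).const_mul (μ p.1))
        simpa [Function.comp_def] using this
      have k3 : (fun t => G (c p.1 t, p.1)) = fun t => c p.1 (μ p.1 * t) :=
        funext (hc p.1 hp).conj
      rw [k3] at k1
      change (μ p.1)⁻¹ • planeDeriv G (c p.1 s, p.1) (deriv (c p.1) s) = _
      rw [k1.unique k2, smul_smul, inv_mul_cancel₀ hp0, one_smul, hs, hback p hp]
  have hiter : ∀ n : ℕ, ∀ t, |t| < δ * μ ν₀ ^ n →
      ContinuousAt (fun p : ℝ × ℝ => c p.1 p.2) (ν₀, t) ∧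
        ContinuousAt (fun p : ℝ × ℝ => deriv (c p.1) p.2) (ν₀, t) := by
    intro n
    induction n with
    | zero => intro t ht; exact hloc t (by simpa using ht)
    | succ n ih =>
      intro t ht
      have h1 : |t / μ ν₀| < δ * μ ν₀ ^ n := by
        rw [abs_div, abs_of_pos hμ0, div_lt_iff₀ hμ0]
        rw [pow_succ] at ht; linarith
      have h2 := hstep _ (ih _ h1)
      rwa [mul_div_cancel₀ _ hμ0.ne'] at h2
  obtain ⟨n, hn⟩ := pow_unbounded_of_one_lt (|t₀| / δ) hμ1
  rw [div_lt_iff₀ hδ] at hn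
  exact hiter n t₀ (by linarith)

end saddles

/-! ### Normalized parametrizations of the stable and unstable manifolds -/

section params

variable {𝓗 : Family} {S : Saddle} {k : WithTop ℕ∞}

lemma fderiv_iter_fixedPt (h : IsFrequencySpanning 𝓗 S k) {ν : ℝ} (hν : ν ∈ 𝓗.posParams) {m : ℝ}
    (hm : m ≠ 0) {e : Plane}
    (he : fderiv ℝ (fun z => 𝓗.iter ν 1 z) (S.γ 0 ν) e = m • e) :
    fderiv ℝ (fun z => 𝓗.iter ν (-1) z) (S.γ 0 ν) e = m⁻¹ • e := by
  have h1 : HasFDerivAt (𝓗.iter ν 1) (fderiv ℝ (𝓗.iter ν 1) (S.γ 0 ν)) (S.γ 0 ν) :=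
    ((contDiff_iter h hν 1).differentiable one_ne_zero _).hasFDerivAt
  have h2 : HasFDerivAt (𝓗.iter ν (-1)) (fderiv ℝ (𝓗.iter ν (-1)) (S.γ 0 ν))
      (𝓗.iter ν 1 (S.γ 0 ν)) := by
    rw [iter_fixedPt h hν]
    exact ((contDiff_iter h hν (-1)).differentiable one_ne_zero _).hasFDerivAt
  have h3 := h2.comp _ h1
  have h4 : 𝓗.iter ν (-1) ∘ 𝓗.iter ν 1 = id := funext fun z => iter_neg_iter h hν 1 z
  rw [h4] at h3
  have h5 := congrArg (fun L : Plane →L[ℝ] Plane => L e) (h3.unique (hasFDerivAt_id _))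
  simp only [ContinuousLinearMap.comp_apply, ContinuousLinearMap.id_apply] at h5
  have he' : fderiv ℝ (𝓗.iter ν 1) (S.γ 0 ν) e = m • e := he
  rw [he', map_smul] at h5
  rw [eq_inv_smul_iff₀ hm]
  exact h5

/-- The Poincaré maps and their inverses are saddle families. -/
lemma exists_saddleFamily (h : IsFrequencySpanning 𝓗 S k) : ∃ μ l : ℝ → ℝ,
    SaddleFamily 𝓗.posParams (fun q => 𝓗.iter q.2 1 q.1) (S.γ 0) (S.eu 0) (S.es 0) μ l ∧
    SaddleFamily 𝓗.posParams (fun q => 𝓗.iter q.2 (-1) q.1) (S.γ 0) (S.es 0) (S.eu 0)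
      (fun ν => (l ν)⁻¹) (fun ν => (μ ν)⁻¹) := by
  have hu : ∀ ν, ∃ μ : ℝ, ν ∈ 𝓗.posParams → 1 < μ ∧
      fderiv ℝ (𝓗.poincare ν 0) (S.γ 0 ν) (S.eu 0 ν) = μ • S.eu 0 ν := by
    intro ν
    by_cases hν : ν ∈ 𝓗.posParams
    · obtain ⟨μ, h1, h2⟩ := h.orbit.unstable ν hν 0
      exact ⟨μ, fun _ => ⟨h1, h2⟩⟩
    · exact ⟨0, fun h' => absurd h' hν⟩
  have hs : ∀ ν, ∃ μ : ℝ, ν ∈ 𝓗.posParams → (0 < μ ∧ μ < 1) ∧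
      fderiv ℝ (𝓗.poincare ν 0) (S.γ 0 ν) (S.es 0 ν) = μ • S.es 0 ν := by
    intro ν
    by_cases hν : ν ∈ 𝓗.posParams
    · obtain ⟨μ, h1, h2, h3⟩ := h.orbit.stable ν hν 0
      exact ⟨μ, fun _ => ⟨⟨h1, h2⟩, h3⟩⟩
    · exact ⟨0, fun h' => absurd h' hν⟩
  choose μ hμ using hu
  choose l hl using hs
  have hi1 : ∀ ν, 𝓗.iter ν 1 = 𝓗.poincare ν 0 := fun ν => funext (iter_one 𝓗 ν)
  have hline : ContinuousOn (fun ν : ℝ => ((0, ν) : ℝ × ℝ)) 𝓗.posParams := by fun_prop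
  have hmaps : MapsTo (fun ν : ℝ => ((0, ν) : ℝ × ℝ)) 𝓗.posParams {q | q.2 ∈ 𝓗.params} :=
    fun ν hν => posParams_subset_params 𝓗 hν
  have cγ : ContinuousOn (S.γ 0) 𝓗.posParams := h.orbit.smooth.continuousOn.comp hline hmaps
  have ceu : ContinuousOn (S.eu 0) 𝓗.posParams := h.orbit.cont_eu.comp hline hmaps
  have ces : ContinuousOn (S.es 0) 𝓗.posParams := h.orbit.cont_es.comp hline hmaps
  have eu_ne : ∀ ν ∈ 𝓗.posParams, S.eu 0 ν ≠ 0 := fun ν hν =>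
    h.orbit.eu_ne 0 ν (posParams_subset_params 𝓗 hν)
  have es_ne : ∀ ν ∈ 𝓗.posParams, S.es 0 ν ≠ 0 := fun ν hν =>
    h.orbit.es_ne 0 ν (posParams_subset_params 𝓗 hν)
  have e1 : ∀ ν ∈ 𝓗.posParams,
      fderiv ℝ (fun z => 𝓗.iter ν 1 z) (S.γ 0 ν) (S.eu 0 ν) = μ ν • S.eu 0 ν := fun ν hν => by
    have := (hμ ν hν).2
    rwa [← hi1 ν] at this
  have e2 : ∀ ν ∈ 𝓗.posParams,
      fderiv ℝ (fun z => 𝓗.iter ν 1 z) (S.γ 0 ν) (S.es 0 ν) = l ν • S.es 0 ν := fun ν hν => by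
    have := (hl ν hν).2
    rwa [← hi1 ν] at this
  refine ⟨μ, l, ⟨isOpen_posParams 𝓗, fun ν hν z => iter_C11 h hν 1 z, cγ, ceu, ces,
    fun ν hν => iter_fixedPt h hν 1, eu_ne, es_ne, fun ν hν => (hμ ν hν).1, fun ν hν => (hl ν hν).1.1,
    fun ν hν => (hl ν hν).1.2, e1, e2⟩,
    ⟨isOpen_posParams 𝓗, fun ν hν z => iter_C11 h hν (-1) z, cγ, ces, ceu,
    fun ν hν => iter_fixedPt h hν (-1), es_ne, eu_ne,
    fun ν hν => (one_lt_inv₀ (hl ν hν).1.1).2 (hl ν hν).1.2,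
    fun ν hν => inv_pos.2 (by linarith [(hμ ν hν).1]),
    fun ν hν => inv_lt_one_of_one_lt₀ (hμ ν hν).1,
    fun ν hν => fderiv_iter_fixedPt h hν (hl ν hν).1.1.ne' (e2 ν hν),
    fun ν hν => fderiv_iter_fixedPt h hν (by linarith [(hμ ν hν).1]) (e1 ν hν)⟩⟩

lemma deriv_comp_mul_right {c : ℝ → Plane} (hc : ContDiff ℝ 1 c) (b t : ℝ) :
    deriv (fun t => c (t * b)) t = b • deriv c (t * b) := by
  have h1 := (hc.differentiable one_ne_zero (t * b)).hasDerivAt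
  have := h1.scomp t (hasDerivAt_mul_const b)
  exact this.deriv

/-- A curve on which the map of a saddle family acts as some multiplication becomes a normal curve
once the parameter is rescaled to have tangent `eu`. -/
lemma isNormalCurve_rescale {D : Set ℝ} {G : Plane × ℝ → Plane} {γ eu es : ℝ → Plane}
    {μ l : ℝ → ℝ} (H : SaddleFamily D G γ eu es μ l) {ν : ℝ} (hν : ν ∈ D) {c : ℝ → Plane} {a m : ℝ}
    (hc : ContDiff ℝ 1 c) (h0 : c 0 = γ ν) (ha : 0 < a) (hd : deriv c 0 = a • eu ν)
    (hm : ∀ t, G (c t, ν) = c (m * t)) :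
    m = μ ν ∧ IsNormalCurve G γ eu μ ν (fun t => c (t * a⁻¹)) := by
  have hmμ : m = μ ν := by
    have hcd := fun t => (hc.differentiable one_ne_zero t).hasDerivAt
    have k1 : HasDerivAt (fun t => G (c t, ν)) (planeDeriv G (c 0, ν) (deriv c 0)) 0 :=
      (hasFDerivAt_slice (H.differentiableAt hν (c 0))).comp_hasDerivAt 0 (hcd 0)
    have k2 : HasDerivAt (fun t => c (m * t)) (m • deriv c (m * 0)) 0 := by
      have := (hcd (m * 0)).scomp (0 : ℝ) ((hasDerivAt_id (0 : ℝ)).const_mul m)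
      simpa [Function.comp_def] using this
    have k3 : (fun t => G (c t, ν)) = fun t => c (m * t) := funext hm
    rw [k3] at k1
    have k4 := k1.unique k2
    rw [mul_zero, hd, h0, map_smul, H.planeDeriv_eu hν, smul_smul, smul_smul] at k4
    have k5 := smul_left_injective ℝ (H.eu_ne ν hν) k4
    have k6 : a * m = a * μ ν := by beta_reduce at k5; linarith
    exact mul_left_cancel₀ ha.ne' k6
  refine ⟨hmμ, hc.comp (contDiff_id.mul contDiff_const), by simpa using h0, ?_, ?_⟩
  · rw [deriv_comp_mul_right hc, zero_mul, hd, smul_smul, inv_mul_cancel₀ ha.ne', one_smul]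
  · intro t
    rw [hm, hmμ, mul_assoc]

lemma IsUnstableParam.rescale {ν : ℝ} {c : ℝ → Plane} (hc : IsUnstableParam 𝓗 S ν c) {b : ℝ}
    (hb : 0 < b) : IsUnstableParam 𝓗 S ν (fun t => c (t * b)) := by
  refine ⟨hc.smooth.comp (contDiff_id.mul contDiff_const), ?_, ?_, ?_, by simpa using hc.base, ?_, ?_⟩
  · intro x y hxy
    exact mul_right_cancel₀ hb.ne' (hc.inj hxy)
  · intro t
    rw [deriv_comp_mul_right hc.smooth]
    exact smul_ne_zero hb.ne' (hc.immersed _)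
  · rw [← hc.range_eq]
    exact (mul_right_surjective₀ hb.ne').range_comp c
  · obtain ⟨a, ha, hd⟩ := hc.left
    refine ⟨b * a, by positivity, ?_⟩
    rw [deriv_comp_mul_right hc.smooth, zero_mul, hd, smul_smul]
  · obtain ⟨μ, hμ, he⟩ := hc.expand
    exact ⟨μ, hμ, fun t => by rw [he, mul_assoc]⟩

lemma IsStableParam.rescale {ν : ℝ} {c : ℝ → Plane} (hc : IsStableParam 𝓗 S ν c) {b : ℝ}
    (hb : 0 < b) : IsStableParam 𝓗 S ν (fun t => c (t * b)) := by
  refine ⟨hc.smooth.comp (contDiff_id.mul contDiff_const), ?_, ?_, ?_, by simpa using hc.base, ?_, ?_⟩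
  · intro x y hxy
    exact mul_right_cancel₀ hb.ne' (hc.inj hxy)
  · intro t
    rw [deriv_comp_mul_right hc.smooth]
    exact smul_ne_zero hb.ne' (hc.immersed _)
  · rw [← hc.range_eq]
    exact (mul_right_surjective₀ hb.ne').range_comp c
  · obtain ⟨a, ha, hd⟩ := hc.left
    refine ⟨b * a, by positivity, ?_⟩
    rw [deriv_comp_mul_right hc.smooth, zero_mul, hd, smul_smul]
  · obtain ⟨μ, hμ, hμ', he⟩ := hc.contract
    exact ⟨μ, hμ, hμ', fun t => by rw [he, mul_assoc]⟩

/-- Parametrizations `c ν`, `s ν` of the unstable and the stable manifolds that are jointly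
continuous, with their derivatives, in the curve parameter and in `ν`; `F` multiplies the curve
parameters by `μ ν` and `l ν`. All other parametrizations are obtained by positive scaling of the
curve parameter. -/
structure ManifoldParams (𝓗 : Family) (S : Saddle) (μ l : ℝ → ℝ) (c s : ℝ → ℝ → Plane) : Prop where
  one_lt : ∀ ν ∈ 𝓗.posParams, 1 < μ ν
  pos : ∀ ν ∈ 𝓗.posParams, 0 < l ν
  lt_one : ∀ ν ∈ 𝓗.posParams, l ν < 1
  cont_μ : ∀ ν ∈ 𝓗.posParams, ContinuousAt μ ν
  cont_l : ∀ ν ∈ 𝓗.posParams, ContinuousAt l ν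
  param_u : ∀ ν ∈ 𝓗.posParams, IsUnstableParam 𝓗 S ν (c ν)
  param_s : ∀ ν ∈ 𝓗.posParams, IsStableParam 𝓗 S ν (s ν)
  unique_u : ∀ ν ∈ 𝓗.posParams, ∀ c', IsUnstableParam 𝓗 S ν c' →
    ∃ b > 0, c' = fun t => c ν (t * b)
  unique_s : ∀ ν ∈ 𝓗.posParams, ∀ s', IsStableParam 𝓗 S ν s' →
    ∃ b > 0, s' = fun t => s ν (t * b)
  map_u : ∀ ν ∈ 𝓗.posParams, ∀ t, 𝓗.iter ν 1 (c ν t) = c ν (μ ν * t)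
  map_s : ∀ ν ∈ 𝓗.posParams, ∀ t, 𝓗.iter ν 1 (s ν t) = s ν (l ν * t)
  cont_u : ∀ ν ∈ 𝓗.posParams, ∀ t, ContinuousAt (fun p : ℝ × ℝ => c p.1 p.2) (ν, t)
  cont_s : ∀ ν ∈ 𝓗.posParams, ∀ t, ContinuousAt (fun p : ℝ × ℝ => s p.1 p.2) (ν, t)
  cont_du : ∀ ν ∈ 𝓗.posParams, ∀ t, ContinuousAt (fun p : ℝ × ℝ => deriv (c p.1) p.2) (ν, t)
  cont_ds : ∀ ν ∈ 𝓗.posParams, ∀ t, ContinuousAt (fun p : ℝ × ℝ => deriv (s p.1) p.2) (ν, t)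
  wedge_ne : ∀ ν ∈ 𝓗.posParams, wedge (deriv (c ν) 0) (deriv (s ν) 0) ≠ 0

/-- Each manifold has a parametrization because hypothesis `FinitelyManyPrimary` provides a
homoclinic point, and with it the curves. Normalized, these are unique and depend continuously on
`ν`. -/
theorem exists_manifoldParams (h : IsFrequencySpanning 𝓗 S k) :
    ∃ μ l c s, ManifoldParams 𝓗 S μ l c s := by
  obtain ⟨μ, l, HU, HS⟩ := exists_saddleFamily h
  have hU : ∀ ν ∈ 𝓗.posParams, ∀ c', IsUnstableParam 𝓗 S ν c' → ∃ a > 0,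
      IsNormalCurve (fun q => 𝓗.iter q.2 1 q.1) (S.γ 0) (S.eu 0) μ ν (fun t => c' (t * a⁻¹)) := by
    intro ν hν c' hc'
    obtain ⟨a, ha, hd⟩ := hc'.left
    obtain ⟨m, hm, he⟩ := hc'.expand
    exact ⟨a, ha, (isNormalCurve_rescale HU hν hc'.smooth hc'.base ha hd
      (fun t => by rw [← he]; exact iter_one _ _ _)).2⟩
  have hS : ∀ ν ∈ 𝓗.posParams, ∀ c', IsStableParam 𝓗 S ν c' → ∃ a > 0,
      IsNormalCurve (fun q => 𝓗.iter q.2 (-1) q.1) (S.γ 0) (S.es 0) (fun ν => (l ν)⁻¹) ν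
        (fun t => c' (t * a⁻¹)) := by
    intro ν hν c' hc'
    obtain ⟨a, ha, hd⟩ := hc'.left
    obtain ⟨m, hm, hm', he⟩ := hc'.contract
    refine ⟨a, ha, (isNormalCurve_rescale HS hν hc'.smooth hc'.base ha hd (m := m⁻¹)
      (fun t => ?_)).2⟩
    have h1 : c' t = 𝓗.iter ν 1 (c' (m⁻¹ * t)) := by
      rw [iter_one, he, mul_inv_cancel_left₀ hm.ne']
    change 𝓗.iter ν (-1) (c' t) = _
    rw [h1, iter_neg_iter h hν]
  have ex : ∀ ν, ∃ c s : ℝ → Plane, ν ∈ 𝓗.posParams →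
      (IsUnstableParam 𝓗 S ν c ∧
        IsNormalCurve (fun q => 𝓗.iter q.2 1 q.1) (S.γ 0) (S.eu 0) μ ν c) ∧
      (IsStableParam 𝓗 S ν s ∧ IsNormalCurve (fun q => 𝓗.iter q.2 (-1) q.1) (S.γ 0) (S.es 0)
        (fun ν => (l ν)⁻¹) ν s) := by
    intro ν
    by_cases hν : ν ∈ 𝓗.posParams
    · obtain ⟨p, hp, -⟩ := h.primary.two ν hν
      obtain ⟨c, s, a, b, hab⟩ := hp.1.1
      obtain ⟨a', ha', hc'⟩ := hU ν hν c hab.unstable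
      obtain ⟨b', hb', hs'⟩ := hS ν hν s hab.stable
      exact ⟨_, _, fun _ => ⟨⟨hab.unstable.rescale (inv_pos.2 ha'), hc'⟩,
        ⟨hab.stable.rescale (inv_pos.2 hb'), hs'⟩⟩⟩
    · exact ⟨0, 0, fun h' => absurd h' hν⟩
  choose c s hcs using ex
  have hcU := fun ν₀ (hν₀ : ν₀ ∈ 𝓗.posParams) t =>
    continuousAt_normalCurve HU (c := c) (fun ν hν => (hcs ν hν).1.2) hν₀ t
  have hcS := fun ν₀ (hν₀ : ν₀ ∈ 𝓗.posParams) t =>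
    continuousAt_normalCurve HS (c := s) (fun ν hν => (hcs ν hν).2.2) hν₀ t
  refine ⟨μ, l, c, s, HU.one_lt, HU.pos, HU.lt_one, fun ν hν => HU.continuousAt_μ hν,
    fun ν hν => by
      have : ContinuousAt (fun ν => ((l ν)⁻¹)⁻¹) ν :=
        (HS.continuousAt_μ hν).inv₀ (inv_ne_zero (HU.pos ν hν).ne')
      simpa only [inv_inv] using this,
    fun ν hν => (hcs ν hν).1.1, fun ν hν => (hcs ν hν).2.1, ?_, ?_,
    fun ν hν => (hcs ν hν).1.2.conj, ?_, fun ν hν t => (hcU ν hν t).1, fun ν hν t => (hcS ν hν t).1,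
    fun ν hν t => (hcU ν hν t).2, fun ν hν t => (hcS ν hν t).2, ?_⟩
  · intro ν hν c' hc'
    obtain ⟨a, ha, hn⟩ := hU ν hν c' hc'
    have := hn.unique HU hν (hcs ν hν).1.2
    refine ⟨a, ha, funext fun t => ?_⟩
    rw [← this]
    simp only [mul_inv_cancel_right₀ ha.ne']
  · intro ν hν c' hc'
    obtain ⟨a, ha, hn⟩ := hS ν hν c' hc'
    have := hn.unique HS hν (hcs ν hν).2.2
    refine ⟨a, ha, funext fun t => ?_⟩
    rw [← this]
    simp only [mul_inv_cancel_right₀ ha.ne']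
  · intro ν hν t
    have h1 := (hcs ν hν).2.2.conj (l ν * t)
    simp only [inv_mul_cancel_left₀ (HU.pos ν hν).ne'] at h1
    rw [← h1, iter_iter_neg h hν]
  · intro ν hν
    rw [(hcs ν hν).1.2.deriv_zero, (hcs ν hν).2.2.deriv_zero]
    exact HU.wedge_ne_zero hν

end params

/-! ### Transverse intersections -/

section crossing

/-- The linear automorphism of the plane with columns `u`, `w`. -/
def colEquiv {u w : Plane} (h : wedge u w ≠ 0) : Plane ≃L[ℝ] Plane :=
  ContinuousLinearEquiv.equivOfInverse (colMap u w) (colInv u w) (colInv_colMap h) (colMap_colInv h)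

/-- Linearly transverse curves cross. The chart straightens the second curve along
the direction of the first one. -/
lemma crossesAt_of_wedge_ne_zero {c s : ℝ → Plane} {a b : ℝ} (hc : ContDiff ℝ 1 c)
    (hs : ContDiff ℝ 1 s) (hcs : c a = s b) (hw : wedge (deriv c a) (deriv s b) ≠ 0) :
    CrossesAt c s a b := by
  have hw' : wedge (deriv s b) (deriv c a) ≠ 0 := by
    intro h0; apply hw; simp only [wedge] at *; linarith
  set g : Plane → Plane := fun p => s p.1 + p.2 • deriv c a with hg
  have hgC : ContDiff ℝ 1 g := (hs.comp contDiff_fst).add (contDiff_snd.smul contDiff_const)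
  have hgd : HasFDerivAt g (colEquiv hw' : Plane →L[ℝ] Plane) (b, 0) := by
    have h1 : HasFDerivAt (fun p : Plane => s p.1)
        ((ContinuousLinearMap.fst ℝ ℝ ℝ).smulRight (deriv s b)) (b, 0) := by
      have := ((hs.differentiable one_ne_zero b).hasDerivAt.hasFDerivAt).comp
        ((b, 0) : Plane) (hasFDerivAt_fst (𝕜 := ℝ) (E := ℝ) (F := ℝ))
      have hL : (ContinuousLinearMap.toSpanSingleton ℝ (deriv s b)).comp
          (ContinuousLinearMap.fst ℝ ℝ ℝ) = (ContinuousLinearMap.fst ℝ ℝ ℝ).smulRight (deriv s b) := by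
        ext <;> simp
      rw [← hL]
      exact this
    have h2 : HasFDerivAt (fun p : Plane => p.2 • deriv c a)
        ((ContinuousLinearMap.snd ℝ ℝ ℝ).smulRight (deriv c a)) (b, 0) :=
      ((ContinuousLinearMap.snd ℝ ℝ ℝ).smulRight (deriv c a)).hasFDerivAt
    exact h1.add h2
  set e₀ := hgC.contDiffAt.toOpenPartialHomeomorph g hgd one_ne_zero with he₀
  have hcoe : ∀ p, e₀ p = g p := fun p => rfl
  have hmem : ((b, 0) : Plane) ∈ e₀.source :=
    hgC.contDiffAt.mem_toOpenPartialHomeomorph_source hgd one_ne_zero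
  have hg0 : g (b, 0) = c a := by simp [hg, hcs]
  have hsymm : e₀.symm (c a) = (b, 0) := by
    rw [← hg0, ← hcoe]; exact e₀.left_inv hmem
  have htarget : c a ∈ e₀.target := by
    rw [← hg0, ← hcoe]; exact e₀.map_source hmem
  have hd : HasDerivAt (fun t => e₀.symm (c t)) (0, 1) a := by
    have h1 : HasFDerivAt e₀.symm ((colEquiv hw').symm : Plane →L[ℝ] Plane) (c a) :=
      e₀.hasFDerivAt_symm htarget (by rw [hsymm]; exact hgd)
    have h2 := h1.comp_hasDerivAt a (hc.differentiable one_ne_zero a).hasDerivAt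
    have h3 : ((colEquiv hw').symm : Plane →L[ℝ] Plane) (deriv c a) = (0, 1) := by
      have := colInv_colMap hw' (0, 1)
      simp only [colMap_apply, zero_smul, one_smul, zero_add] at this
      exact this
    rw [h3] at h2
    exact h2
  have hd2 : HasDerivAt (fun t => (e₀.symm (c t)).2) 1 a := by
    exact (hasFDerivAt_snd (𝕜 := ℝ) (E := ℝ) (F := ℝ)).comp_hasDerivAt a hd
  have hslope : ∀ᶠ t in 𝓝[≠] a, 0 < slope (fun t => (e₀.symm (c t)).2) a t :=
    (hasDerivAt_iff_tendsto_slope.1 hd2).eventually (lt_mem_nhds one_pos)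
  have h0 : (e₀.symm (c a)).2 = 0 := by rw [hsymm]
  refine ⟨e₀.symm, htarget, hcs.symm, ?_, ?_, ?_⟩
  · have hcont : ContinuousAt (fun t : ℝ => ((t, 0) : Plane)) b := by fun_prop
    filter_upwards [hcont (e₀.open_source.mem_nhds hmem)] with t ht
    have h1 : s t = e₀ (t, 0) := by simp [hcoe, hg]
    rw [h1, e₀.left_inv ht]
  · have hle : 𝓝[<] a ≤ 𝓝[≠] a := nhdsWithin_mono _ fun t ht => ne_of_lt ht
    filter_upwards [hle hslope, self_mem_nhdsWithin] with t ht hta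
    rw [slope_def_field, h0, sub_zero] at ht
    have : t - a < 0 := sub_neg.2 hta
    by_contra hcon
    push Not at hcon
    exact absurd ht (not_lt.2 (div_nonpos_of_nonneg_of_nonpos hcon this.le))
  · have hle : 𝓝[>] a ≤ 𝓝[≠] a := nhdsWithin_mono _ fun t ht => ne_of_gt ht
    filter_upwards [hle hslope, self_mem_nhdsWithin] with t ht hta
    rw [slope_def_field, h0, sub_zero] at ht
    have : 0 < t - a := sub_pos.2 hta
    exact (div_pos_iff_of_pos_right this).1 ht

/-- A homeomorphism which acts on two curves as multiplication of their parameters transports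
their crossings. -/
lemma CrossesAt.map {c s : ℝ → Plane} {a b m m' : ℝ} (F : Plane ≃ₜ Plane) (hm : 0 < m)
    (hm' : 0 < m') (hFc : ∀ t, F (c t) = c (m * t)) (hFs : ∀ t, F (s t) = s (m' * t))
    (h : CrossesAt c s a b) : CrossesAt c s (m * a) (m' * b) := by
  obtain ⟨e, he, hab, h1, h2, h3⟩ := h
  have hcinv : ∀ t, F.symm (c t) = c (t / m) := fun t => by
    rw [Homeomorph.symm_apply_eq, hFc]; congr 1; field_simp
  have hsinv : ∀ t, F.symm (s t) = s (t / m') := fun t => by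
    rw [Homeomorph.symm_apply_eq, hFs]; congr 1; field_simp
  have ea : m * a / m = a := by field_simp
  have eb : m' * b / m' = b := by field_simp
  have hcont : ∀ x y : ℝ, 0 < y → Tendsto (fun t => t / y) (𝓝 (y * x)) (𝓝 x) := fun x y hy => by
    have : ContinuousAt (fun t => t / y) (y * x) := by fun_prop
    have e : y * x / y = x := by field_simp
    simpa [ContinuousAt, e] using this
  refine ⟨F.symm.toOpenPartialHomeomorph.trans e, ?_, by rw [← hFs, ← hFc, hab], ?_, ?_, ?_⟩
  · simp [hcinv, ea, he]
  · filter_upwards [(hcont b m' hm').eventually h1] with t ht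
    simpa [hsinv] using ht
  · have ht : Tendsto (fun t => t / m) (𝓝[<] (m * a)) (𝓝[<] a) :=
      tendsto_nhdsWithin_iff.2 ⟨(hcont a m hm).mono_left nhdsWithin_le_nhds, by
        filter_upwards [self_mem_nhdsWithin] with t ht
        rw [mem_Iio, div_lt_iff₀ hm]; rw [mem_Iio] at ht; linarith⟩
    filter_upwards [ht.eventually h2] with t ht
    simpa [hcinv] using ht
  · have ht : Tendsto (fun t => t / m) (𝓝[>] (m * a)) (𝓝[>] a) :=
      tendsto_nhdsWithin_iff.2 ⟨(hcont a m hm).mono_left nhdsWithin_le_nhds, by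
        filter_upwards [self_mem_nhdsWithin] with t ht
        rw [mem_Ioi, lt_div_iff₀ hm]; rw [mem_Ioi] at ht; linarith⟩
    filter_upwards [ht.eventually h3] with t ht
    simpa [hcinv] using ht

end crossing

/-! ### Primary homoclinic points in terms of curve parameters -/

section primary

variable {𝓗 : Family} {S : Saddle} {k : WithTop ℕ∞} {μ l : ℝ → ℝ} {c s : ℝ → ℝ → Plane}

/-- `c ν a = s ν b` is a primary homoclinic point, in terms of the curve parameters. -/
structure PrimaryAt (c s : ℝ → ℝ → Plane) (ν a b : ℝ) : Prop where
  pos_a : 0 < a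
  pos_b : 0 < b
  eq : c ν a = s ν b
  disjoint : ∀ a' ∈ Ioo 0 a, ∀ b' ∈ Ioo 0 b, c ν a' ≠ s ν b'

variable (M : ManifoldParams 𝓗 S μ l c s) {ν : ℝ} (hν : ν ∈ 𝓗.posParams)
include M hν

lemma ManifoldParams.zero_u : c ν 0 = S.γ 0 ν := (M.param_u ν hν).base

lemma ManifoldParams.zero_s : s ν 0 = S.γ 0 ν := (M.param_s ν hν).base

lemma ManifoldParams.inj_u {x y : ℝ} (h : c ν x = c ν y) : x = y := (M.param_u ν hν).inj h

lemma ManifoldParams.inj_s {x y : ℝ} (h : s ν x = s ν y) : x = y := (M.param_s ν hν).inj h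

lemma ManifoldParams.isHomoclinicAt {a b : ℝ} (ha : 0 < a) (hb : 0 < b) (h : c ν a = s ν b) :
    IsHomoclinicAt 𝓗 S ν (c ν) (s ν) a b (c ν a) :=
  ⟨M.param_u ν hν, M.param_s ν hν, ha, hb, rfl, h.symm⟩

lemma ManifoldParams.isHomoclinic_iff {p : Plane} :
    IsHomoclinic 𝓗 S ν p ↔ ∃ a > 0, ∃ b > 0, c ν a = p ∧ s ν b = p := by
  constructor
  · rintro ⟨c', s', a, b, h⟩
    obtain ⟨x, hx, rfl⟩ := M.unique_u ν hν c' h.unstable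
    obtain ⟨y, hy, rfl⟩ := M.unique_s ν hν s' h.stable
    exact ⟨a * x, mul_pos h.a_pos hx, b * y, mul_pos h.b_pos hy, h.eq_unstable, h.eq_stable⟩
  · rintro ⟨a, ha, b, hb, h1, h2⟩
    exact ⟨c ν, s ν, a, b, M.param_u ν hν, M.param_s ν hν, ha, hb, h1, h2⟩

lemma ManifoldParams.closedU_eq {a : ℝ} (ha : 0 < a) :
    closedU 𝓗 S ν (c ν a) = c ν '' Icc 0 a := by
  ext z
  constructor
  · rintro ⟨c', hc', a', ha', h1, t, ht, rfl⟩
    obtain ⟨x, hx, rfl⟩ := M.unique_u ν hν c' hc'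
    have := M.inj_u hν h1
    refine ⟨t * x, ⟨by have := ht.1; positivity, ?_⟩, rfl⟩
    rw [← this]
    exact mul_le_mul_of_nonneg_right ht.2 hx.le
  · intro hz
    exact ⟨c ν, M.param_u ν hν, a, ha, rfl, hz⟩

lemma ManifoldParams.openU_eq {a : ℝ} (ha : 0 < a) :
    openU 𝓗 S ν (c ν a) = c ν '' Ioo 0 a := by
  ext z
  constructor
  · rintro ⟨c', hc', a', ha', h1, t, ht, rfl⟩
    obtain ⟨x, hx, rfl⟩ := M.unique_u ν hν c' hc'
    have := M.inj_u hν h1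
    refine ⟨t * x, ⟨by have := ht.1; positivity, ?_⟩, rfl⟩
    rw [← this]
    exact mul_lt_mul_of_pos_right ht.2 hx
  · intro hz
    exact ⟨c ν, M.param_u ν hν, a, ha, rfl, hz⟩

lemma ManifoldParams.openS_eq {b : ℝ} (hb : 0 < b) :
    openS 𝓗 S ν (s ν b) = s ν '' Ioo 0 b := by
  ext z
  constructor
  · rintro ⟨c', hc', a', ha', h1, t, ht, rfl⟩
    obtain ⟨x, hx, rfl⟩ := M.unique_s ν hν c' hc'
    have := M.inj_s hν h1
    refine ⟨t * x, ⟨by have := ht.1; positivity, ?_⟩, rfl⟩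
    rw [← this]
    exact mul_lt_mul_of_pos_right ht.2 hx
  · intro hz
    exact ⟨s ν, M.param_s ν hν, b, hb, rfl, hz⟩

lemma ManifoldParams.closedU_ssubset_iff {a a' : ℝ} (ha : 0 < a) (ha' : 0 < a') :
    closedU 𝓗 S ν (c ν a) ⊂ closedU 𝓗 S ν (c ν a') ↔ a < a' := by
  rw [M.closedU_eq hν ha, M.closedU_eq hν ha', ssubset_iff_subset_not_subset,
    image_subset_image_iff (M.param_u ν hν).inj, image_subset_image_iff (M.param_u ν hν).inj,
    ← ssubset_iff_subset_not_subset]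
  constructor
  · intro h
    have h1 : a ∈ Icc 0 a' := h.subset ⟨ha.le, le_rfl⟩
    refine lt_of_le_of_ne h1.2 ?_
    rintro rfl
    exact h.ne rfl
  · intro h
    refine ⟨Icc_subset_Icc_right h.le, fun h' => ?_⟩
    have h1 : a' ∈ Icc 0 a := h' ⟨ha'.le, le_rfl⟩
    exact absurd h1.2 (not_le.2 h)

lemma ManifoldParams.isPrimary_iff {a b : ℝ} (ha : 0 < a) (hb : 0 < b) (h : c ν a = s ν b) :
    IsPrimary 𝓗 S ν (c ν a) ↔ PrimaryAt c s ν a b := by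
  have h1 : IsHomoclinic 𝓗 S ν (c ν a) := ⟨_, _, a, b, M.isHomoclinicAt hν ha hb h⟩
  rw [IsPrimary, and_iff_right h1, M.openU_eq hν ha, h, M.openS_eq hν hb,
    ← disjoint_iff_inter_eq_empty, disjoint_left]
  constructor
  · intro hd
    refine ⟨ha, hb, h, fun a' ha' b' hb' heq => hd ⟨a', ha', rfl⟩ ⟨b', hb', heq.symm⟩⟩
  · rintro hp _ ⟨a', ha', rfl⟩ ⟨b', hb', heq⟩
    exact hp.disjoint a' ha' b' hb' heq.symm

lemma ManifoldParams.exists_primaryAt {a : ℝ} (ha : 0 < a) (h : IsPrimary 𝓗 S ν (c ν a)) :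
    ∃ b, PrimaryAt c s ν a b := by
  obtain ⟨a', ha', b, hb, h1, h2⟩ := (M.isHomoclinic_iff hν).1 h.1
  exact ⟨b, (M.isPrimary_iff hν ha hb h2.symm).1 h⟩

lemma ManifoldParams.isTangent_iff {a b : ℝ} (ha : 0 < a) (hb : 0 < b) (h : c ν a = s ν b) :
    IsTangent 𝓗 S ν (c ν a) ↔ wedge (deriv (c ν) a) (deriv (s ν) b) = 0 := by
  constructor
  · rintro ⟨c', s', a', b', hab, hli⟩
    obtain ⟨x, hx, rfl⟩ := M.unique_u ν hν c' hab.unstable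
    obtain ⟨y, hy, rfl⟩ := M.unique_s ν hν s' hab.stable
    have e1 : a' * x = a := M.inj_u hν hab.eq_unstable
    have e2 : b' * y = b := M.inj_s hν (hab.eq_stable.trans h)
    rw [linearIndependent_iff_wedge_ne_zero, not_not, deriv_comp_mul_right (M.param_u ν hν).smooth,
      deriv_comp_mul_right (M.param_s ν hν).smooth, e1, e2] at hli
    have : x * y * wedge (deriv (c ν) a) (deriv (s ν) b) = 0 := by
      rw [← hli]; simp only [wedge, Prod.smul_fst, Prod.smul_snd, smul_eq_mul]; ring
    exact (mul_eq_zero.1 this).resolve_left (mul_pos hx hy).ne'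
  · intro hw
    refine ⟨c ν, s ν, a, b, M.isHomoclinicAt hν ha hb h, ?_⟩
    rw [linearIndependent_iff_wedge_ne_zero, not_not, hw]

lemma PrimaryAt.mem_P {a b : ℝ} (h : PrimaryAt c s ν a b)
    (hw : wedge (deriv (c ν) a) (deriv (s ν) b) ≠ 0) : c ν a ∈ P 𝓗 S ν :=
  ⟨(M.isPrimary_iff hν h.pos_a h.pos_b h.eq).2 h, c ν, s ν, a, b,
    M.isHomoclinicAt hν h.pos_a h.pos_b h.eq,
    crossesAt_of_wedge_ne_zero (M.param_u ν hν).smooth (M.param_s ν hν).smooth h.eq hw⟩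

/-- The unstable ordering of primary homoclinic points is the reverse of the stable ordering. -/
lemma PrimaryAt.lt_of_lt {a b a' b' : ℝ} (h : PrimaryAt c s ν a b) (h' : PrimaryAt c s ν a' b')
    (haa : a < a') : b' < b := by
  by_contra hb
  push Not at hb
  rcases hb.lt_or_eq with hb | rfl
  · exact h'.disjoint a ⟨h.pos_a, haa⟩ b ⟨h.pos_b, hb⟩ h.eq
  · exact haa.ne (M.inj_u hν (h.eq.trans h'.eq.symm))

lemma ManifoldParams.map_iter_u (hf : IsFrequencySpanning 𝓗 S k) (n : ℤ) (t : ℝ) :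
    𝓗.iter ν n (c ν t) = c ν (μ ν ^ n * t) := by
  have hμ : μ ν ≠ 0 := by linarith [M.one_lt ν hν]
  induction n using Int.induction_on with
  | zero => rw [iter_zero hf hν]; simp
  | succ n ih =>
    rw [add_comm, iter_add hf hν, ih, M.map_u ν hν]
    congr 1
    rw [zpow_add₀ hμ, zpow_one]; ring
  | pred n ih =>
    have h1 : c ν (μ ν ^ (-(n : ℤ)) * t) = 𝓗.iter ν 1 (c ν (μ ν ^ (-(n : ℤ) - 1) * t)) := by
      rw [M.map_u ν hν]
      congr 1
      rw [zpow_sub₀ hμ, zpow_one]; field_simp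
    rw [sub_eq_add_neg, add_comm, iter_add hf hν, ih, h1, iter_neg_iter hf hν, add_comm,
      ← sub_eq_add_neg]

lemma ManifoldParams.map_iter_s (hf : IsFrequencySpanning 𝓗 S k) (n : ℤ) (t : ℝ) :
    𝓗.iter ν n (s ν t) = s ν (l ν ^ n * t) := by
  have hμ : l ν ≠ 0 := (M.pos ν hν).ne'
  induction n using Int.induction_on with
  | zero => rw [iter_zero hf hν]; simp
  | succ n ih =>
    rw [add_comm, iter_add hf hν, ih, M.map_s ν hν]
    congr 1
    rw [zpow_add₀ hμ, zpow_one]; ring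
  | pred n ih =>
    have h1 : s ν (l ν ^ (-(n : ℤ)) * t) = 𝓗.iter ν 1 (s ν (l ν ^ (-(n : ℤ) - 1) * t)) := by
      rw [M.map_s ν hν]
      congr 1
      rw [zpow_sub₀ hμ, zpow_one]; field_simp
    rw [sub_eq_add_neg, add_comm, iter_add hf hν, ih, h1, iter_neg_iter hf hν, add_comm,
      ← sub_eq_add_neg]

lemma PrimaryAt.map (hf : IsFrequencySpanning 𝓗 S k) {a b : ℝ} (h : PrimaryAt c s ν a b) (n : ℤ) :
    PrimaryAt c s ν (μ ν ^ n * a) (l ν ^ n * b) := by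
  have hμ : 0 < μ ν := by linarith [M.one_lt ν hν]
  have hl := M.pos ν hν
  have hμn : 0 < μ ν ^ n := zpow_pos hμ n
  have hln : 0 < l ν ^ n := zpow_pos hl n
  refine ⟨mul_pos hμn h.pos_a, mul_pos hln h.pos_b, ?_, ?_⟩
  · rw [← M.map_iter_u hν hf, ← M.map_iter_s hν hf, h.eq]
  · intro a' ha' b' hb' heq
    refine h.disjoint (a' / μ ν ^ n) ⟨div_pos ha'.1 hμn, ?_⟩ (b' / l ν ^ n)
      ⟨div_pos hb'.1 hln, ?_⟩ ?_
    · rw [div_lt_iff₀ hμn]; linarith [ha'.2]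
    · rw [div_lt_iff₀ hln]; linarith [hb'.2]
    · refine (iterHomeo hf hν n).injective ?_
      change 𝓗.iter ν n _ = 𝓗.iter ν n _
      rw [M.map_iter_u hν hf, M.map_iter_s hν hf, mul_div_cancel₀ _ hμn.ne',
        mul_div_cancel₀ _ hln.ne', heq]

lemma ManifoldParams.mem_P_iter (hf : IsFrequencySpanning 𝓗 S k) {a : ℝ} (ha : 0 < a) (n : ℤ)
    (h : c ν a ∈ P 𝓗 S ν) : c ν (μ ν ^ n * a) ∈ P 𝓗 S ν := by
  have hμ : 0 < μ ν := by linarith [M.one_lt ν hν]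
  have hl := M.pos ν hν
  obtain ⟨b, hb⟩ := M.exists_primaryAt hν ha h.1
  have hb' := hb.map M hν hf n
  refine ⟨(M.isPrimary_iff hν hb'.pos_a hb'.pos_b hb'.eq).2 hb', ?_⟩
  obtain ⟨-, c', s', a', b', hab, hcr⟩ := h
  obtain ⟨x, hx, rfl⟩ := M.unique_u ν hν c' hab.unstable
  obtain ⟨y, hy, rfl⟩ := M.unique_s ν hν s' hab.stable
  have e1 : a' * x = a := M.inj_u hν hab.eq_unstable
  refine ⟨_, _, μ ν ^ n * a', l ν ^ n * b', ⟨hab.unstable, hab.stable,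
    mul_pos (zpow_pos hμ n) hab.a_pos, mul_pos (zpow_pos hl n) hab.b_pos, ?_, ?_⟩,
    hcr.map (iterHomeo hf hν n) (zpow_pos hμ n) (zpow_pos hl n) ?_ ?_⟩
  · rw [mul_assoc, e1]
  · have e2 : s ν (b' * y) = c ν a := hab.eq_stable
    rw [mul_assoc, ← M.map_iter_s hν hf, e2, M.map_iter_u hν hf]
  · intro t
    change 𝓗.iter ν n (c ν (t * x)) = c ν (μ ν ^ n * t * x)
    rw [M.map_iter_u hν hf, mul_assoc]
  · intro t
    change 𝓗.iter ν n (s ν (t * y)) = s ν (l ν ^ n * t * y)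
    rw [M.map_iter_s hν hf, mul_assoc]

end primary

/-! ### Continuation of transverse homoclinic points -/

section continuation

variable {𝓗 : Family} {S : Saddle} {k : WithTop ℕ∞} {μ l : ℝ → ℝ} {c s : ℝ → ℝ → Plane}
variable (M : ManifoldParams 𝓗 S μ l c s) {ν₀ : ℝ} (hν₀ : ν₀ ∈ 𝓗.posParams)
include M hν₀

lemma ManifoldParams.continuousAt_pair_u (p : ℝ × ℝ) :
    ContinuousAt (fun q : ℝ × (ℝ × ℝ) => c q.1 q.2.1) (ν₀, p) :=
  ContinuousAt.comp (g := fun q : ℝ × ℝ => c q.1 q.2) (f := fun q : ℝ × (ℝ × ℝ) => (q.1, q.2.1))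
    (M.cont_u ν₀ hν₀ p.1) (by fun_prop)

lemma ManifoldParams.continuousAt_pair_s (p : ℝ × ℝ) :
    ContinuousAt (fun q : ℝ × (ℝ × ℝ) => s q.1 q.2.2) (ν₀, p) :=
  ContinuousAt.comp (g := fun q : ℝ × ℝ => s q.1 q.2) (f := fun q : ℝ × (ℝ × ℝ) => (q.1, q.2.2))
    (M.cont_s ν₀ hν₀ p.2) (by fun_prop)

lemma ManifoldParams.continuousAt_pair_du (p : ℝ × ℝ) :
    ContinuousAt (fun q : ℝ × (ℝ × ℝ) => deriv (c q.1) q.2.1) (ν₀, p) :=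
  ContinuousAt.comp (g := fun q : ℝ × ℝ => deriv (c q.1) q.2)
    (f := fun q : ℝ × (ℝ × ℝ) => (q.1, q.2.1)) (M.cont_du ν₀ hν₀ p.1) (by fun_prop)

lemma ManifoldParams.continuousAt_pair_ds (p : ℝ × ℝ) :
    ContinuousAt (fun q : ℝ × (ℝ × ℝ) => deriv (s q.1) q.2.2) (ν₀, p) :=
  ContinuousAt.comp (g := fun q : ℝ × ℝ => deriv (s q.1) q.2)
    (f := fun q : ℝ × (ℝ × ℝ) => (q.1, q.2.2)) (M.cont_ds ν₀ hν₀ p.2) (by fun_prop)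

lemma ManifoldParams.eventually_fst_mem (p : ℝ × ℝ) :
    ∀ᶠ q : ℝ × (ℝ × ℝ) in 𝓝 (ν₀, p), q.1 ∈ 𝓗.posParams :=
  continuousAt_fst ((isOpen_posParams 𝓗).mem_nhds hν₀)

lemma ManifoldParams.eventually_ne {p : ℝ × ℝ} (h : c ν₀ p.1 ≠ s ν₀ p.2) :
    ∀ᶠ q : ℝ × (ℝ × ℝ) in 𝓝 (ν₀, p), c q.1 q.2.1 ≠ s q.1 q.2.2 :=
  ((M.continuousAt_pair_u hν₀ p).prodMk (M.continuousAt_pair_s hν₀ p)).eventually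
    (isOpen_ne_fun continuous_fst continuous_snd |>.mem_nhds h)

/-- The inverse function theorem with a parameter on which the maps depend continuously: near a
transverse intersection there is at most one intersection for each nearby parameter, and there is
one in each smaller neighbourhood once the parameter is close enough. -/
lemma ManifoldParams.exists_unique_zero {p₀ : ℝ × ℝ} (h0 : c ν₀ p₀.1 = s ν₀ p₀.2)
    (hw : wedge (deriv (c ν₀) p₀.1) (deriv (s ν₀) p₀.2) ≠ 0) :
    ∃ W ∈ 𝓝 p₀, (∀ᶠ ν in 𝓝 ν₀, ∀ p ∈ W, ∀ q ∈ W, c ν p.1 = s ν p.2 → c ν q.1 = s ν q.2 → p = q) ∧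
      ∀ W' ∈ 𝓝 p₀, ∀ᶠ ν in 𝓝 ν₀, ∃ p ∈ W', c ν p.1 = s ν p.2 := by
  set u := deriv (c ν₀) p₀.1 with hu
  set w := -deriv (s ν₀) p₀.2 with hwdef
  have hw' : wedge u w ≠ 0 := by
    intro h; apply hw
    simp only [hwdef, wedge, Prod.fst_neg, Prod.snd_neg] at h ⊢
    linarith
  set g : ℝ → ℝ × ℝ → Plane := fun ν p => colInv u w (c ν p.1 - s ν p.2) with hg
  have hzero : ∀ ν p, g ν p = 0 ↔ c ν p.1 = s ν p.2 := by
    intro ν p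
    constructor
    · intro h
      have := congrArg (colMap u w) h
      rw [hg, colMap_colInv hw', map_zero] at this
      exact sub_eq_zero.1 this
    · intro h; simp [hg, h]
  set g' : ℝ → ℝ × ℝ → Plane →L[ℝ] Plane := fun ν p =>
    (colInv u w).comp (colMap (deriv (c ν) p.1) (-deriv (s ν) p.2)) with hg'
  have hder : ∀ ν ∈ 𝓗.posParams, ∀ p, HasFDerivAt (g ν) (g' ν p) p := by
    intro ν hν p
    have h1 : HasFDerivAt (fun p : ℝ × ℝ => c ν p.1)
        ((ContinuousLinearMap.fst ℝ ℝ ℝ).smulRight (deriv (c ν) p.1)) p := by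
      have := (((M.param_u ν hν).smooth.differentiable one_ne_zero p.1).hasDerivAt.hasFDerivAt).comp
        p (hasFDerivAt_fst (𝕜 := ℝ) (E := ℝ) (F := ℝ))
      have hL : (ContinuousLinearMap.toSpanSingleton ℝ (deriv (c ν) p.1)).comp
          (ContinuousLinearMap.fst ℝ ℝ ℝ) =
          (ContinuousLinearMap.fst ℝ ℝ ℝ).smulRight (deriv (c ν) p.1) := by
        ext <;> simp
      rw [← hL]
      exact this
    have h2 : HasFDerivAt (fun p : ℝ × ℝ => s ν p.2)
        ((ContinuousLinearMap.snd ℝ ℝ ℝ).smulRight (deriv (s ν) p.2)) p := by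
      have := (((M.param_s ν hν).smooth.differentiable one_ne_zero p.2).hasDerivAt.hasFDerivAt).comp
        p (hasFDerivAt_snd (𝕜 := ℝ) (E := ℝ) (F := ℝ))
      have hL : (ContinuousLinearMap.toSpanSingleton ℝ (deriv (s ν) p.2)).comp
          (ContinuousLinearMap.snd ℝ ℝ ℝ) =
          (ContinuousLinearMap.snd ℝ ℝ ℝ).smulRight (deriv (s ν) p.2) := by
        ext <;> simp
      rw [← hL]
      exact this
    have h3 := (colInv u w).hasFDerivAt.comp p (h1.sub h2)
    have hL : (ContinuousLinearMap.fst ℝ ℝ ℝ).smulRight (deriv (c ν) p.1)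
        - (ContinuousLinearMap.snd ℝ ℝ ℝ).smulRight (deriv (s ν) p.2)
        = colMap (deriv (c ν) p.1) (-deriv (s ν) p.2) := by
      ext <;> simp
    rw [hL] at h3
    exact h3
  have hid : g' ν₀ p₀ = ContinuousLinearMap.id ℝ Plane :=
    ContinuousLinearMap.ext fun p => colInv_colMap hw' p
  have hcg' : ContinuousAt (fun q : ℝ × (ℝ × ℝ) => g' q.1 q.2) (ν₀, p₀) := by
    refine continuousAt_const.clm_comp ?_
    exact ContinuousAt.comp (g := fun p : Plane × Plane => colMap p.1 p.2)
      (f := fun q : ℝ × (ℝ × ℝ) => (deriv (c q.1) q.2.1, -deriv (s q.1) q.2.2))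
      continuous_colMap.continuousAt
      ((M.continuousAt_pair_du hν₀ p₀).prodMk (M.continuousAt_pair_ds hν₀ p₀).neg)
  have hsmall : ∀ᶠ q : ℝ × (ℝ × ℝ) in 𝓝 (ν₀, p₀),
      ‖g' q.1 q.2 - ContinuousLinearMap.id ℝ Plane‖ < 1 / 2 ∧ q.1 ∈ 𝓗.posParams := by
    have h1 : ContinuousAt (fun q : ℝ × (ℝ × ℝ) =>
        ‖g' q.1 q.2 - ContinuousLinearMap.id ℝ Plane‖) (ν₀, p₀) :=
      (hcg'.sub (continuousAt_const (y := ContinuousLinearMap.id ℝ Plane))).norm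
    have h0 : ‖g' ν₀ p₀ - ContinuousLinearMap.id ℝ Plane‖ < 1 / 2 := by
      rw [hid, sub_self, norm_zero]; norm_num
    have h2 := h1.eventually (gt_mem_nhds h0)
    exact h2.and (M.eventually_fst_mem hν₀ p₀)
  rw [nhds_prod_eq, eventually_prod_iff] at hsmall
  obtain ⟨pa, hpa, pb, hpb, hab⟩ := hsmall
  obtain ⟨ρ, hρ, hball⟩ := Metric.nhds_basis_closedBall.mem_iff.1 hpb
  have happ : ∀ ν, pa ν → ∀ ε ≤ ρ, ApproximatesLinearOn (g ν)
      ((ContinuousLinearEquiv.refl ℝ Plane : Plane ≃L[ℝ] Plane) : Plane →L[ℝ] Plane)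
      (Metric.closedBall p₀ ε) (1 / 2) := by
    intro ν hν ε hε x hx y hy
    have hsub : Metric.closedBall p₀ ε ⊆ Metric.closedBall p₀ ρ := Metric.closedBall_subset_closedBall hε
    have := Convex.norm_image_sub_le_of_norm_hasFDerivWithin_le' (f := g ν) (f' := g' ν)
      (s := Metric.closedBall p₀ ε) (C := 1 / 2) (φ := ContinuousLinearMap.id ℝ Plane)
      (fun z hz => (hder ν (hab hν (hball (hsub hz))).2 z).hasFDerivWithinAt)
      (fun z hz => (hab hν (hball (hsub hz))).1.le) (convex_closedBall _ _) hy hx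
    rw [norm_sub_rev] at this
    simpa [norm_sub_rev] using this
  refine ⟨Metric.closedBall p₀ ρ, Metric.closedBall_mem_nhds _ hρ, ?_, ?_⟩
  · filter_upwards [hpa] with ν hν p hp q hq hzp hzq
    have h1 := happ ν hν ρ le_rfl p hp q hq
    rw [(hzero ν p).2 hzp, (hzero ν q).2 hzq] at h1
    have h2 : ‖p - q‖ ≤ 1 / 2 * ‖p - q‖ := by simpa [norm_sub_rev q p] using h1
    have h3 : ‖p - q‖ = 0 := by linarith [norm_nonneg (p - q)]
    exact sub_eq_zero.1 (norm_eq_zero.1 h3)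
  · intro W' hW'
    obtain ⟨ε', hε', hball'⟩ := Metric.nhds_basis_closedBall.mem_iff.1 hW'
    set ε := min ε' ρ with hε
    have hε0 : 0 < ε := lt_min hε' hρ
    have hg0 : ContinuousAt (fun ν => g ν p₀) ν₀ := by
      have h1 := ContinuousAt.comp (g := fun q : ℝ × ℝ => c q.1 q.2) (f := fun ν => (ν, p₀.1))
        (x := ν₀) (M.cont_u ν₀ hν₀ p₀.1) (by fun_prop)
      have h2 := ContinuousAt.comp (g := fun q : ℝ × ℝ => s q.1 q.2) (f := fun ν => (ν, p₀.2))
        (x := ν₀) (M.cont_s ν₀ hν₀ p₀.2) (by fun_prop)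
      exact continuousAt_const.clm_apply (h1.sub h2)
    have hclose : ∀ᶠ ν in 𝓝 ν₀, ‖g ν p₀‖ < ε / 2 :=
      hg0.norm.eventually (gt_mem_nhds (by beta_reduce; rw [(hzero ν₀ p₀).2 h0, norm_zero]; positivity))
    filter_upwards [hpa, hclose] with ν hν hνε
    have hsurj := (happ ν hν ε (min_le_right _ _)).surjOn_closedBall_of_nonlinearRightInverse
      (ContinuousLinearEquiv.refl ℝ Plane).toNonlinearRightInverse hε0.le Subset.rfl
    have hmem : (0 : Plane) ∈ Metric.closedBall (g ν p₀)
        ((((ContinuousLinearEquiv.refl ℝ Plane).toNonlinearRightInverse.nnnorm : ℝ)⁻¹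
          - ((1 / 2 : NNReal) : ℝ)) * ε) := by
      have hn : ((ContinuousLinearEquiv.refl ℝ Plane).toNonlinearRightInverse.nnnorm : ℝ) = 1 := by
        change ‖ContinuousLinearMap.id ℝ Plane‖ = 1
        exact ContinuousLinearMap.norm_id
      rw [hn, mem_closedBall_iff_norm, zero_sub, norm_neg]
      push_cast
      linarith
    obtain ⟨p, hp, hgp⟩ := hsurj hmem
    exact ⟨p, hball' (Metric.closedBall_subset_closedBall (min_le_left _ _) hp), (hzero ν p).1 hgp⟩

/-- A transverse intersection has a unique continuous continuation to nearby parameters. -/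
lemma ManifoldParams.exists_branch {p₀ : ℝ × ℝ} (h0 : c ν₀ p₀.1 = s ν₀ p₀.2)
    (hw : wedge (deriv (c ν₀) p₀.1) (deriv (s ν₀) p₀.2) ≠ 0) :
    ∃ f : ℝ → ℝ × ℝ, f ν₀ = p₀ ∧
      (∀ᶠ ν in 𝓝 ν₀, ContinuousAt f ν ∧ c ν (f ν).1 = s ν (f ν).2 ∧
        wedge (deriv (c ν) (f ν).1) (deriv (s ν) (f ν).2) ≠ 0) ∧
      ∀ᶠ q : ℝ × (ℝ × ℝ) in 𝓝 (ν₀, p₀), c q.1 q.2.1 = s q.1 q.2.2 → q.2 = f q.1 := by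
  classical
  obtain ⟨W, hW, huniq, hex⟩ := M.exists_unique_zero hν₀ h0 hw
  set f : ℝ → ℝ × ℝ := fun ν => if h : ∃ p ∈ W, c ν p.1 = s ν p.2 then h.choose else 0 with hf
  have hfs : ∀ ν, (∃ p ∈ W, c ν p.1 = s ν p.2) → f ν ∈ W ∧ c ν (f ν).1 = s ν (f ν).2 := by
    intro ν h
    have : f ν = h.choose := dif_pos h
    rw [this]
    exact h.choose_spec
  have hf0 : f ν₀ = p₀ := by
    have h1 := hfs ν₀ ⟨p₀, mem_of_mem_nhds hW, h0⟩
    exact huniq.self_of_nhds _ h1.1 _ (mem_of_mem_nhds hW) h1.2 h0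
  have hcont0 : ContinuousAt f ν₀ := by
    intro W' hW'
    rw [hf0] at hW'
    rw [mem_map]
    filter_upwards [hex (W ∩ W') (inter_mem hW hW'), huniq] with ν ⟨p, hp, hz⟩ hu
    have h1 := hfs ν ⟨p, hp.1, hz⟩
    have : f ν = p := hu _ h1.1 _ hp.1 h1.2 hz
    change f ν ∈ W'
    rw [this]
    exact hp.2
  have hwev : ∀ᶠ ν in 𝓝 ν₀, wedge (deriv (c ν) (f ν).1) (deriv (s ν) (f ν).2) ≠ 0 := by
    have h1 : ContinuousAt (fun q : ℝ × (ℝ × ℝ) => wedge (deriv (c q.1) q.2.1) (deriv (s q.1) q.2.2))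
        (ν₀, p₀) :=
      ContinuousAt.comp (g := fun p : Plane × Plane => wedge p.1 p.2)
        (f := fun q : ℝ × (ℝ × ℝ) => (deriv (c q.1) q.2.1, deriv (s q.1) q.2.2))
        continuous_wedge.continuousAt
        ((M.continuousAt_pair_du hν₀ p₀).prodMk (M.continuousAt_pair_ds hν₀ p₀))
    have h2 : Tendsto (fun ν => (ν, f ν)) (𝓝 ν₀) (𝓝 (ν₀, p₀)) := by
      have := (continuousAt_id (x := ν₀)).prodMk hcont0
      simpa [ContinuousAt, hf0] using this
    exact h2.eventually (h1.eventually (isOpen_ne.mem_nhds hw))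
  have hexW := hex W hW
  obtain ⟨Wo, hWoW, hWo, hpo⟩ := mem_nhds_iff.1 hW
  have hWof : ∀ᶠ ν in 𝓝 ν₀, f ν ∈ Wo := hcont0 (by rw [hf0]; exact hWo.mem_nhds hpo)
  refine ⟨f, hf0, ?_, ?_⟩
  · filter_upwards [eventually_eventually_nhds.2 huniq, hexW, hwev, hWof,
      (isOpen_posParams 𝓗).mem_nhds hν₀] with ν₁ hu hex₁ hw₁ hWo₁ hν₁
    refine ⟨?_, (hfs ν₁ hex₁).2, hw₁⟩
    obtain ⟨-, -, -, hex'⟩ := M.exists_unique_zero hν₁ (hfs ν₁ hex₁).2 hw₁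
    intro W' hW'
    rw [mem_map]
    filter_upwards [hex' (Wo ∩ W') (inter_mem (hWo.mem_nhds hWo₁) hW'), hu] with ν ⟨p, hp, hz⟩ hu'
    have h1 := hfs ν ⟨p, hWoW hp.1, hz⟩
    have : f ν = p := hu' _ h1.1 _ (hWoW hp.1) h1.2 hz
    change f ν ∈ W'
    rw [this]
    exact hp.2
  · have h1 : ∀ᶠ q : ℝ × (ℝ × ℝ) in 𝓝 (ν₀, p₀), q.2 ∈ W := continuousAt_snd hW
    have h2 : ∀ᶠ q : ℝ × (ℝ × ℝ) in 𝓝 (ν₀, p₀), ∀ p ∈ W, ∀ p' ∈ W,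
        c q.1 p.1 = s q.1 p.2 → c q.1 p'.1 = s q.1 p'.2 → p = p' :=
      (continuousAt_fst : ContinuousAt Prod.fst (ν₀, p₀)).eventually huniq
    filter_upwards [h1, h2] with q hq hu hz
    have h3 := hfs q.1 ⟨q.2, hq, hz⟩
    exact hu _ hq _ h3.1 hz h3.2

/-- Near the saddle the two manifolds meet only in the saddle. -/
lemma ManifoldParams.eventually_eq_zero :
    ∀ᶠ q : ℝ × (ℝ × ℝ) in 𝓝 (ν₀, (0, 0)), c q.1 q.2.1 = s q.1 q.2.2 → q.2 = (0, 0) := by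
  have h0 : ∀ ν ∈ 𝓗.posParams, c ν 0 = s ν 0 := fun ν hν => by
    rw [M.zero_u hν, M.zero_s hν]
  obtain ⟨f, -, -, huniq⟩ := M.exists_branch hν₀ (p₀ := (0, 0)) (h0 ν₀ hν₀) (M.wedge_ne ν₀ hν₀)
  have hline : Tendsto (fun q : ℝ × (ℝ × ℝ) => (q.1, ((0, 0) : ℝ × ℝ))) (𝓝 (ν₀, (0, 0)))
      (𝓝 (ν₀, (0, 0))) := by
    have : ContinuousAt (fun q : ℝ × (ℝ × ℝ) => (q.1, ((0, 0) : ℝ × ℝ))) (ν₀, (0, 0)) := by fun_prop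
    exact this
  filter_upwards [huniq, hline.eventually huniq, M.eventually_fst_mem hν₀ (0, 0)] with q h1 h2 h3 hz
  rw [h1 hz, ← h2 (h0 q.1 h3)]

/-- The continuation of a transverse primary homoclinic point is primary. -/
lemma PrimaryAt.eventually {p₀ : ℝ × ℝ} (hp : PrimaryAt c s ν₀ p₀.1 p₀.2) {f : ℝ → ℝ × ℝ}
    (hf0 : f ν₀ = p₀) (hfc : ContinuousAt f ν₀) (hfz : ∀ᶠ ν in 𝓝 ν₀, c ν (f ν).1 = s ν (f ν).2)
    (huniq : ∀ᶠ q : ℝ × (ℝ × ℝ) in 𝓝 (ν₀, p₀), c q.1 q.2.1 = s q.1 q.2.2 → q.2 = f q.1) :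
    ∀ᶠ ν in 𝓝 ν₀, PrimaryAt c s ν (f ν).1 (f ν).2 := by
  -- the rectangle between the saddle and the point, rescaled to the unit square
  have key : ∀ᶠ ν in 𝓝 ν₀, ∀ x ∈ Icc (0 : ℝ) 1 ×ˢ Icc (0 : ℝ) 1,
      c ν (x.1 * (f ν).1) = s ν (x.2 * (f ν).2) →
        (x.1 * (f ν).1, x.2 * (f ν).2) = (0, 0) ∨ (x.1 * (f ν).1, x.2 * (f ν).2) = f ν := by
    refine (isCompact_Icc.prod isCompact_Icc).eventually_forall_of_forall_eventually
      (P := fun ν (x : ℝ × ℝ) => c ν (x.1 * (f ν).1) = s ν (x.2 * (f ν).2) →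
        (x.1 * (f ν).1, x.2 * (f ν).2) = (0, 0) ∨ (x.1 * (f ν).1, x.2 * (f ν).2) = f ν) ?_
    rintro ⟨x, y⟩ ⟨hx, hy⟩
    change x ∈ Icc 0 1 at hx
    change y ∈ Icc 0 1 at hy
    have hsc : Tendsto (fun q : ℝ × (ℝ × ℝ) => (q.1, (q.2.1 * (f q.1).1, q.2.2 * (f q.1).2)))
        (𝓝 (ν₀, (x, y))) (𝓝 (ν₀, (x * p₀.1, y * p₀.2))) := by
      have h1 : ContinuousAt (fun q : ℝ × (ℝ × ℝ) => f q.1) (ν₀, (x, y)) :=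
        ContinuousAt.comp (g := f) (f := Prod.fst) hfc continuousAt_fst
      have h2 : ContinuousAt (fun q : ℝ × (ℝ × ℝ) =>
          (q.1, (q.2.1 * (f q.1).1, q.2.2 * (f q.1).2))) (ν₀, (x, y)) :=
        continuousAt_fst.prodMk (((continuousAt_fst.comp continuousAt_snd).mul h1.fst).prodMk
          ((continuousAt_snd.comp continuousAt_snd).mul h1.snd))
      simpa [ContinuousAt, hf0] using h2
    by_cases hz : c ν₀ (x * p₀.1) = s ν₀ (y * p₀.2)
    · have hcases : (x * p₀.1, y * p₀.2) = ((0, 0) : ℝ × ℝ) ∨ (x * p₀.1, y * p₀.2) = p₀ := by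
        have ha := hp.pos_a
        have hb := hp.pos_b
        rcases hx.1.eq_or_lt with h | hx0
        · left
          rw [← h, zero_mul, M.zero_u hν₀, ← M.zero_s hν₀] at hz
          rw [← h, zero_mul, ← M.inj_s hν₀ hz]
        rcases hy.1.eq_or_lt with h | hy0
        · left
          rw [← h, zero_mul, M.zero_s hν₀, ← M.zero_u hν₀] at hz
          rw [← h, zero_mul, M.inj_u hν₀ hz]
        rcases hx.2.eq_or_lt with h | hx1
        · right
          rw [h, one_mul, hp.eq] at hz
          rw [h, one_mul, ← M.inj_s hν₀ hz]
        rcases hy.2.eq_or_lt with h | hy1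
        · right
          rw [h, one_mul, ← hp.eq] at hz
          rw [h, one_mul, M.inj_u hν₀ hz]
        exact absurd hz (hp.disjoint _ ⟨by positivity, by nlinarith⟩ _ ⟨by positivity, by nlinarith⟩)
      rcases hcases with h | h
      · rw [h] at hsc
        filter_upwards [hsc.eventually (M.eventually_eq_zero hν₀)] with q hq hz'
        exact Or.inl (hq hz')
      · rw [h] at hsc
        filter_upwards [hsc.eventually huniq] with q hq hz'
        exact Or.inr (hq hz')
    · filter_upwards [hsc.eventually (M.eventually_ne hν₀ (p := (x * p₀.1, y * p₀.2)) hz)] with q hq hz'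
      exact absurd hz' hq
  have hpos1 : ∀ᶠ ν in 𝓝 ν₀, 0 < (f ν).1 :=
    hfc.fst.eventually (lt_mem_nhds (by beta_reduce; rw [hf0]; exact hp.pos_a))
  have hpos2 : ∀ᶠ ν in 𝓝 ν₀, 0 < (f ν).2 :=
    hfc.snd.eventually (lt_mem_nhds (by beta_reduce; rw [hf0]; exact hp.pos_b))
  filter_upwards [key, hpos1, hpos2, hfz] with ν hk h1 h2 hz
  refine ⟨h1, h2, hz, fun a' ha' b' hb' heq => ?_⟩
  have ea : a' / (f ν).1 * (f ν).1 = a' := div_mul_cancel₀ _ h1.ne'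
  have eb : b' / (f ν).2 * (f ν).2 = b' := div_mul_cancel₀ _ h2.ne'
  have := hk (a' / (f ν).1, b' / (f ν).2)
    ⟨⟨div_nonneg ha'.1.le h1.le, (div_le_one h1).2 ha'.2.le⟩,
      ⟨div_nonneg hb'.1.le h2.le, (div_le_one h2).2 hb'.2.le⟩⟩ (by simp only [ea, eb]; exact heq)
  simp only [ea, eb] at this
  rcases this with h | h
  · exact ha'.1.ne' (congrArg Prod.fst h)
  · exact ha'.2.ne (congrArg Prod.fst h)

/-- Below every homoclinic point there is a primary one. -/
lemma ManifoldParams.exists_primaryAt_le {a b : ℝ} (ha : 0 < a) (hb : 0 < b)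
    (h : c ν₀ a = s ν₀ b) : ∃ a' ≤ a, ∃ b' ≤ b, PrimaryAt c s ν₀ a' b' := by
  have hline : Tendsto (fun p : ℝ × ℝ => (ν₀, p)) (𝓝 (0, 0)) (𝓝 (ν₀, (0, 0))) := by
    have : ContinuousAt (fun p : ℝ × ℝ => (ν₀, p)) (0, 0) := by fun_prop
    exact this
  obtain ⟨ε, hε, hloc⟩ := Metric.eventually_nhds_iff.1 (hline.eventually (M.eventually_eq_zero hν₀))
  set K : Set (ℝ × ℝ) := {p | p ∈ Icc 0 a ×ˢ Icc 0 b ∧ c ν₀ p.1 = s ν₀ p.2 ∧ ε ≤ dist p (0, 0)}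
    with hK
  have hzp : ∀ p : ℝ × ℝ, 0 < p.1 → c ν₀ p.1 = s ν₀ p.2 → ε ≤ dist p (0, 0) := by
    intro p hp hz
    by_contra hcon
    push Not at hcon
    exact hp.ne' (congrArg Prod.fst (hloc hcon hz))
  have hcu : Continuous fun p : ℝ × ℝ => c ν₀ p.1 :=
    (M.param_u ν₀ hν₀).smooth.continuous.comp continuous_fst
  have hcs : Continuous fun p : ℝ × ℝ => s ν₀ p.2 :=
    (M.param_s ν₀ hν₀).smooth.continuous.comp continuous_snd
  have hKc : IsCompact K := by
    refine (isCompact_Icc.prod isCompact_Icc).of_isClosed_subset ?_ (fun p hp => hp.1)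
    exact (isClosed_Icc.prod isClosed_Icc).inter ((isClosed_eq hcu hcs).inter
      (isClosed_le continuous_const (continuous_id.dist continuous_const)))
  have hKn : K.Nonempty := ⟨(a, b), ⟨⟨ha.le, le_rfl⟩, ⟨hb.le, le_rfl⟩⟩, h, hzp (a, b) ha h⟩
  obtain ⟨p, hp, hmin⟩ := hKc.exists_isMinOn hKn continuous_fst.continuousOn
  have hp0 : p ≠ (0, 0) := by
    intro h0
    have := hp.2.2
    rw [h0, dist_self] at this
    linarith
  have hp1 : 0 < p.1 := by
    refine lt_of_le_of_ne hp.1.1.1 fun h0 => hp0 ?_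
    have hz := hp.2.1
    rw [← h0, M.zero_u hν₀, ← M.zero_s hν₀] at hz
    exact Prod.ext h0.symm (M.inj_s hν₀ hz).symm
  have hp2 : 0 < p.2 := by
    refine lt_of_le_of_ne hp.1.2.1 fun h0 => hp0 ?_
    have hz := hp.2.1
    rw [← h0, M.zero_s hν₀, ← M.zero_u hν₀] at hz
    exact Prod.ext (M.inj_u hν₀ hz) h0.symm
  refine ⟨p.1, hp.1.1.2, p.2, hp.1.2.2, hp1, hp2, hp.2.1, fun a' ha' b' hb' heq => ?_⟩
  have hmem : (a', b') ∈ K := ⟨⟨⟨ha'.1.le, ha'.2.le.trans hp.1.1.2⟩,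
    ⟨hb'.1.le, hb'.2.le.trans hp.1.2.2⟩⟩, heq, hzp _ ha'.1 heq⟩
  exact absurd (hmin hmem) (not_le.2 ha'.2)

/-- A continuous family of primary homoclinic points confines, by the reversal of the orderings,
the stable parameter of all primary homoclinic points in its vicinity. -/
lemma ManifoldParams.exists_bounds (hf : IsFrequencySpanning 𝓗 S k) {f : ℝ → ℝ × ℝ}
    (hfc : ContinuousAt f ν₀) (hfp : ∀ᶠ ν in 𝓝 ν₀, PrimaryAt c s ν (f ν).1 (f ν).2) {a₀ : ℝ}
    (h1 : (f ν₀).1 < μ ν₀ * a₀) (h2 : a₀ < μ ν₀ * (f ν₀).1) :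
    ∃ lo > 0, ∃ hi, ∀ᶠ q : ℝ × ℝ in 𝓝 (ν₀, a₀), ∀ b, PrimaryAt c s q.1 q.2 b → b ∈ Icc lo hi := by
  have hp₀ := hfp.self_of_nhds
  have hl₀ := M.pos ν₀ hν₀
  have hb₀ := hp₀.pos_b
  have cf : ContinuousAt (fun q : ℝ × ℝ => f q.1) (ν₀, a₀) :=
    ContinuousAt.comp (g := f) (f := Prod.fst) hfc continuousAt_fst
  have cμ : ContinuousAt (fun q : ℝ × ℝ => μ q.1) (ν₀, a₀) :=
    ContinuousAt.comp (g := μ) (f := Prod.fst) (M.cont_μ ν₀ hν₀) continuousAt_fst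
  have cl : ContinuousAt (fun q : ℝ × ℝ => l q.1) (ν₀, a₀) :=
    ContinuousAt.comp (g := l) (f := Prod.fst) (M.cont_l ν₀ hν₀) continuousAt_fst
  have e1 : ∀ᶠ q : ℝ × ℝ in 𝓝 (ν₀, a₀), (f q.1).1 < μ q.1 * q.2 :=
    cf.fst.eventually_lt (cμ.mul continuousAt_snd) h1
  have e2 : ∀ᶠ q : ℝ × ℝ in 𝓝 (ν₀, a₀), q.2 < μ q.1 * (f q.1).1 :=
    continuousAt_snd.eventually_lt (cμ.mul cf.fst) h2
  have e3 : ∀ᶠ q : ℝ × ℝ in 𝓝 (ν₀, a₀), l ν₀ * (f ν₀).2 / 2 < l q.1 * (f q.1).2 :=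
    (cl.mul cf.snd).eventually (lt_mem_nhds (by
      have : 0 < l ν₀ * (f ν₀).2 := by positivity
      change _ < l ν₀ * (f ν₀).2
      linarith))
  have e4 : ∀ᶠ q : ℝ × ℝ in 𝓝 (ν₀, a₀), (f q.1).2 / l q.1 < (f ν₀).2 / l ν₀ + 1 :=
    (cf.snd.div cl hl₀.ne').eventually (gt_mem_nhds (lt_add_one _))
  have e5 : ∀ᶠ q : ℝ × ℝ in 𝓝 (ν₀, a₀), PrimaryAt c s q.1 (f q.1).1 (f q.1).2 :=
    (continuousAt_fst : ContinuousAt Prod.fst (ν₀, a₀)).eventually hfp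
  have e6 : ∀ᶠ q : ℝ × ℝ in 𝓝 (ν₀, a₀), q.1 ∈ 𝓗.posParams :=
    continuousAt_fst ((isOpen_posParams 𝓗).mem_nhds hν₀)
  refine ⟨l ν₀ * (f ν₀).2 / 2, by positivity, (f ν₀).2 / l ν₀ + 1, ?_⟩
  filter_upwards [e1, e2, e3, e4, e5, e6] with q h1 h2 h3 h4 h5 hν b hb
  have hμ := M.one_lt q.1 hν
  have hl := M.pos q.1 hν
  have up := h5.map M hν hf 1
  have down := h5.map M hν hf (-1)
  simp only [zpow_one, zpow_neg] at up down
  have g1 := hb.lt_of_lt M hν up h2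
  have g2 := down.lt_of_lt M hν hb (by
    rw [inv_mul_lt_iff₀ (by linarith)]; linarith)
  have g3 : (l q.1)⁻¹ * (f q.1).2 = (f q.1).2 / l q.1 := by field_simp
  rw [g3] at g2
  exact ⟨by linarith, by linarith⟩

end continuation

/-! ### The set of primary homoclinic points as a function of `ν` -/

section points

variable {𝓗 : Family} {S : Saddle} {k : WithTop ℕ∞} {μ l : ℝ → ℝ} {c s : ℝ → ℝ → Plane}

/-- The unstable parameters of the points of the topologically transverse primary orbits. -/
def primaryParams (𝓗 : Family) (S : Saddle) (c : ℝ → ℝ → Plane) (ν : ℝ) : Set ℝ :=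
  {a | 0 < a ∧ c ν a ∈ P 𝓗 S ν}

/-- The unstable parameters of the points of the primary orbits that are not tangent. -/
def simpleParams (𝓗 : Family) (S : Saddle) (c : ℝ → ℝ → Plane) (ν : ℝ) : Set ℝ :=
  {a | a ∈ primaryParams 𝓗 S c ν ∧ ¬ IsTangent 𝓗 S ν (c ν a)}

variable (M : ManifoldParams 𝓗 S μ l c s) (hf : IsFrequencySpanning 𝓗 S k)
include M hf

lemma ManifoldParams.exists_primaryAt_of_mem {ν a : ℝ} (hν : ν ∈ 𝓗.posParams)
    (ha : a ∈ primaryParams 𝓗 S c ν) : ∃ b, PrimaryAt c s ν a b :=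
  M.exists_primaryAt hν ha.1 ha.2.1

lemma ManifoldParams.exists_primary_branch {ν₀ a₀ : ℝ} (hν₀ : ν₀ ∈ 𝓗.posParams)
    (ha₀ : a₀ ∈ simpleParams 𝓗 S c ν₀) : ∃ b₀, ∃ f : ℝ → ℝ × ℝ, f ν₀ = (a₀, b₀) ∧
      (∀ᶠ ν in 𝓝 ν₀, ContinuousAt f ν ∧ PrimaryAt c s ν (f ν).1 (f ν).2 ∧
        wedge (deriv (c ν) (f ν).1) (deriv (s ν) (f ν).2) ≠ 0) ∧
      ∀ᶠ q : ℝ × (ℝ × ℝ) in 𝓝 (ν₀, (a₀, b₀)), c q.1 q.2.1 = s q.1 q.2.2 → q.2 = f q.1 := by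
  obtain ⟨b₀, hb₀⟩ := M.exists_primaryAt_of_mem hf hν₀ ha₀.1
  have hw : wedge (deriv (c ν₀) a₀) (deriv (s ν₀) b₀) ≠ 0 := fun h =>
    ha₀.2 ((M.isTangent_iff hν₀ hb₀.pos_a hb₀.pos_b hb₀.eq).2 h)
  obtain ⟨f, hf0, hfe, huniq⟩ := M.exists_branch hν₀ (p₀ := (a₀, b₀)) hb₀.eq hw
  have hp := PrimaryAt.eventually M hν₀ (p₀ := (a₀, b₀)) hb₀ hf0 hfe.self_of_nhds.1
    (hfe.mono fun ν h => h.2.1) huniq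
  refine ⟨b₀, f, hf0, ?_, huniq⟩
  filter_upwards [hfe, hp] with ν h1 h2
  exact ⟨h1.1, h2, h1.2.2⟩

/-- The continuation of a simple parameter, and its local uniqueness among all primary parameters.
-/
theorem ManifoldParams.exists_continuation {ν₀ a₀ : ℝ} (hν₀ : ν₀ ∈ 𝓗.posParams)
    (ha₀ : a₀ ∈ simpleParams 𝓗 S c ν₀) : ∃ α : ℝ → ℝ, α ν₀ = a₀ ∧
      (∀ᶠ ν in 𝓝 ν₀, ContinuousAt α ν ∧ α ν ∈ simpleParams 𝓗 S c ν) ∧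
      ∀ᶠ q : ℝ × ℝ in 𝓝 (ν₀, a₀), q.2 ∈ primaryParams 𝓗 S c q.1 → q.2 = α q.1 := by
  obtain ⟨b₀, f, hf0, hfe, huniq⟩ := M.exists_primary_branch hf hν₀ ha₀
  have hp₀ : PrimaryAt c s ν₀ a₀ b₀ := by simpa [hf0] using hfe.self_of_nhds.2.1
  have hμ := M.one_lt ν₀ hν₀
  obtain ⟨lo, -, hi, hbd⟩ := M.exists_bounds hν₀ hf hfe.self_of_nhds.1 (hfe.mono fun ν h => h.2.1)
    (a₀ := a₀) (by rw [hf0]; nlinarith [hp₀.pos_a]) (by rw [hf0]; nlinarith [hp₀.pos_a])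
  have hDn : ∀ᶠ ν in 𝓝 ν₀, ν ∈ 𝓗.posParams := (isOpen_posParams 𝓗).mem_nhds hν₀
  refine ⟨fun ν => (f ν).1, by beta_reduce; rw [hf0], ?_, ?_⟩
  · filter_upwards [hfe, hDn] with ν h hν
    refine ⟨h.1.fst, ⟨h.2.1.pos_a, h.2.1.mem_P M hν h.2.2⟩, ?_⟩
    rw [M.isTangent_iff hν h.2.1.pos_a h.2.1.pos_b h.2.1.eq]
    exact h.2.2
  · have key : ∀ᶠ q : ℝ × ℝ in 𝓝 (ν₀, a₀), ∀ b ∈ Icc lo hi,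
        c q.1 q.2 = s q.1 b → q.2 = (f q.1).1 := by
      refine isCompact_Icc.eventually_forall_of_forall_eventually
        (P := fun (q : ℝ × ℝ) b => c q.1 q.2 = s q.1 b → q.2 = (f q.1).1) ?_
      intro y _
      have hre : Tendsto (fun z : (ℝ × ℝ) × ℝ => (z.1.1, (z.1.2, z.2))) (𝓝 ((ν₀, a₀), y))
          (𝓝 (ν₀, (a₀, y))) := by
        have : ContinuousAt (fun z : (ℝ × ℝ) × ℝ => (z.1.1, (z.1.2, z.2))) ((ν₀, a₀), y) := by
          fun_prop
        exact this
      by_cases hy : y = b₀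
      · subst hy
        filter_upwards [hre.eventually huniq] with z hz heq
        exact congrArg Prod.fst (hz heq)
      · have hne : c ν₀ a₀ ≠ s ν₀ y := by
          rw [hp₀.eq]
          exact fun h => hy (M.inj_s hν₀ h).symm
        filter_upwards [hre.eventually (M.eventually_ne hν₀ (p := (a₀, y)) hne)] with z hz heq
        exact absurd heq hz
    have hD : ∀ᶠ q : ℝ × ℝ in 𝓝 (ν₀, a₀), q.1 ∈ 𝓗.posParams := continuousAt_fst.eventually hDn
    filter_upwards [hbd, key, hD] with q h1 h2 hq hmem
    obtain ⟨b, hb⟩ := M.exists_primaryAt_of_mem hf hq hmem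
    exact h2 b (h1 b hb) hb.eq

lemma ManifoldParams.primaryParams_nonempty {ν : ℝ} (hν : ν ∈ 𝓗.posParams) :
    (primaryParams 𝓗 S c ν).Nonempty := by
  obtain ⟨p, hp, -⟩ := hf.primary.two ν hν
  obtain ⟨a, ha, b, hb, h1, h2⟩ := (M.isHomoclinic_iff hν).1 hp.1.1
  exact ⟨a, ha, by rw [h1]; exact hp⟩

lemma ManifoldParams.mem_primaryParams_zpow {ν a : ℝ} (hν : ν ∈ 𝓗.posParams)
    (ha : a ∈ primaryParams 𝓗 S c ν) (n : ℤ) : μ ν ^ n * a ∈ primaryParams 𝓗 S c ν :=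
  ⟨mul_pos (zpow_pos (by linarith [M.one_lt ν hν]) n) ha.1, M.mem_P_iter hν hf ha.1 n ha.2⟩

lemma ManifoldParams.mem_simpleParams_zpow {ν a : ℝ} (hν : ν ∈ 𝓗.posParams)
    (ha : a ∈ simpleParams 𝓗 S c ν) (n : ℤ) : μ ν ^ n * a ∈ simpleParams 𝓗 S c ν := by
  refine ⟨M.mem_primaryParams_zpow hf hν ha.1 n, ?_⟩
  obtain ⟨b, hb⟩ := M.exists_primaryAt_of_mem hf hν ha.1
  have hb' := hb.map M hν hf n
  have hw : wedge (deriv (c ν) a) (deriv (s ν) b) ≠ 0 := fun h =>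
    ha.2 ((M.isTangent_iff hν hb.pos_a hb.pos_b hb.eq).2 h)
  rw [M.isTangent_iff hν hb'.pos_a hb'.pos_b hb'.eq]
  intro h0
  -- the derivative of the iterate is injective and maps tangent vectors to tangent vectors
  have hcd : Differentiable ℝ (c ν) := (M.param_u ν hν).smooth.differentiable one_ne_zero
  have hsd : Differentiable ℝ (s ν) := (M.param_s ν hν).smooth.differentiable one_ne_zero
  have hid : Differentiable ℝ (𝓗.iter ν n) := (contDiff_iter hf hν n).differentiable one_ne_zero
  have hin : Differentiable ℝ (𝓗.iter ν (-n)) :=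
    (contDiff_iter hf hν (-n)).differentiable one_ne_zero
  set L := fderiv ℝ (𝓗.iter ν n) (c ν a) with hL
  have hu : L (deriv (c ν) a) = μ ν ^ n • deriv (c ν) (μ ν ^ n * a) := by
    have h1 : HasDerivAt (fun t => 𝓗.iter ν n (c ν t)) (L (deriv (c ν) a)) a :=
      (hid (c ν a)).hasFDerivAt.comp_hasDerivAt a (hcd a).hasDerivAt
    have h2 : HasDerivAt (fun t => c ν (μ ν ^ n * t)) (μ ν ^ n • deriv (c ν) (μ ν ^ n * a)) a :=
      HasDerivAt.scomp a (hcd (μ ν ^ n * a)).hasDerivAt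
        (by simpa using (hasDerivAt_id a).const_mul (μ ν ^ n))
    have h3 : (fun t => 𝓗.iter ν n (c ν t)) = fun t => c ν (μ ν ^ n * t) :=
      funext fun t => M.map_iter_u hν hf n t
    rw [h3] at h1
    exact h1.unique h2
  have hs : L (deriv (s ν) b) = l ν ^ n • deriv (s ν) (l ν ^ n * b) := by
    have h1 : HasDerivAt (fun t => 𝓗.iter ν n (s ν t)) (L (deriv (s ν) b)) b := by
      rw [hL, hb.eq]
      exact (hid (s ν b)).hasFDerivAt.comp_hasDerivAt b (hsd b).hasDerivAt
    have h2 : HasDerivAt (fun t => s ν (l ν ^ n * t)) (l ν ^ n • deriv (s ν) (l ν ^ n * b)) b :=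
      HasDerivAt.scomp b (hsd (l ν ^ n * b)).hasDerivAt
        (by simpa using (hasDerivAt_id b).const_mul (l ν ^ n))
    have h3 : (fun t => 𝓗.iter ν n (s ν t)) = fun t => s ν (l ν ^ n * t) :=
      funext fun t => M.map_iter_s hν hf n t
    rw [h3] at h1
    exact h1.unique h2
  have hinj : Function.Injective L := by
    have h1 := (hin (𝓗.iter ν n (c ν a))).hasFDerivAt.comp (c ν a) (hid (c ν a)).hasFDerivAt
    have h2 : 𝓗.iter ν (-n) ∘ 𝓗.iter ν n = id := funext fun z => iter_neg_iter hf hν n z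
    rw [h2] at h1
    have h3 := h1.unique (hasFDerivAt_id _)
    intro x y hxy
    have hx := congrArg (fun T : Plane →L[ℝ] Plane => T x) h3
    have hy := congrArg (fun T : Plane →L[ℝ] Plane => T y) h3
    simp only [ContinuousLinearMap.comp_apply, ContinuousLinearMap.id_apply] at hx hy
    rw [← hx, ← hy]
    exact congrArg _ hxy
  have hli := (linearIndependent_iff_wedge_ne_zero.2 hw).map' (L : Plane →ₗ[ℝ] Plane)
    (LinearMap.ker_eq_bot.2 hinj)
  have hv : (L : Plane →ₗ[ℝ] Plane) ∘ ![deriv (c ν) a, deriv (s ν) b]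
      = ![μ ν ^ n • deriv (c ν) (μ ν ^ n * a), l ν ^ n • deriv (s ν) (l ν ^ n * b)] := by
    rw [← hu, ← hs]
    funext i; fin_cases i <;> rfl
  rw [hv] at hli
  refine linearIndependent_iff_wedge_ne_zero.1 hli ?_
  have h1 : wedge (μ ν ^ n • deriv (c ν) (μ ν ^ n * a)) (l ν ^ n • deriv (s ν) (l ν ^ n * b))
      = μ ν ^ n * l ν ^ n * wedge (deriv (c ν) (μ ν ^ n * a)) (deriv (s ν) (l ν ^ n * b)) := by
    simp only [wedge, Prod.smul_fst, Prod.smul_snd, smul_eq_mul]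
    ring
  rw [h1, h0, mul_zero]

lemma ManifoldParams.simpleParams_eq {ν : ℝ} (hν : ν ∈ 𝓗.posParams) (hB : ν ∉ bifValues 𝓗 S) :
    simpleParams 𝓗 S c ν = primaryParams 𝓗 S c ν := by
  ext a
  exact ⟨fun h => h.1, fun h => ⟨h, fun ht => hB ⟨hν, c ν a, h.2.1, ht⟩⟩⟩

/-- At parameters which are not bifurcation values no new primary points appear: a limit of primary
points is a homoclinic point, and if it were not primary then a primary point below it would
persist. -/
theorem ManifoldParams.eventually_notMem {ν₀ a₀ : ℝ} (hν₀ : ν₀ ∈ 𝓗.posParams)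
    (hB : ν₀ ∉ bifValues 𝓗 S) (h0 : 0 < a₀) (ha₀ : a₀ ∉ primaryParams 𝓗 S c ν₀) :
    ∀ᶠ q : ℝ × ℝ in 𝓝 (ν₀, a₀), q.2 ∉ primaryParams 𝓗 S c q.1 := by
  have hμ := M.one_lt ν₀ hν₀
  have hμ0 : 0 < μ ν₀ := by linarith
  -- a reference point in the fundamental domain of `a₀`
  obtain ⟨x, hx⟩ := M.primaryParams_nonempty hf hν₀
  obtain ⟨n, hn1, hn2⟩ := exists_mem_Ico_zpow (x := a₀ / x) (y := μ ν₀) (div_pos h0 hx.1) hμ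
  have hr : μ ν₀ ^ n * x ∈ primaryParams 𝓗 S c ν₀ := M.mem_primaryParams_zpow hf hν₀ hx n
  rw [le_div_iff₀ hx.1] at hn1
  rw [div_lt_iff₀ hx.1, zpow_add_one₀ hμ0.ne'] at hn2
  set r := μ ν₀ ^ n * x with hrdef
  have hr0 := hr.1
  rw [← M.simpleParams_eq hf hν₀ hB] at hr
  obtain ⟨b₀, f, hf0, hfe, -⟩ := M.exists_primary_branch hf hν₀ hr
  obtain ⟨lo, hlo, hi, hbd⟩ := M.exists_bounds hν₀ hf hfe.self_of_nhds.1
    (hfe.mono fun ν h => h.2.1) (a₀ := a₀) (by rw [hf0]; simp only; nlinarith)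
    (by rw [hf0]; simp only [hrdef]; nlinarith)
  have key : ∀ᶠ q : ℝ × ℝ in 𝓝 (ν₀, a₀), ∀ b ∈ Icc lo hi, ¬ PrimaryAt c s q.1 q.2 b := by
    refine isCompact_Icc.eventually_forall_of_forall_eventually
      (P := fun (q : ℝ × ℝ) b => ¬ PrimaryAt c s q.1 q.2 b) ?_
    intro y hy
    have hy0 : 0 < y := lt_of_lt_of_le hlo hy.1
    by_cases hz : c ν₀ a₀ = s ν₀ y
    · obtain ⟨a₁, ha₁, b₁, hb₁, hp₁⟩ := M.exists_primaryAt_le hν₀ h0 hy0 hz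
      have hw : wedge (deriv (c ν₀) a₁) (deriv (s ν₀) b₁) ≠ 0 := fun h =>
        hB ⟨hν₀, c ν₀ a₁, (M.isPrimary_iff hν₀ hp₁.pos_a hp₁.pos_b hp₁.eq).2 hp₁,
          (M.isTangent_iff hν₀ hp₁.pos_a hp₁.pos_b hp₁.eq).2 h⟩
      have hmem := hp₁.mem_P M hν₀ hw
      have hlt : a₁ < a₀ := lt_of_le_of_ne ha₁ fun h => ha₀ ⟨h0, by rw [← h]; exact hmem⟩
      have hlt' : b₁ < y := by
        refine lt_of_le_of_ne hb₁ fun h => hlt.ne (M.inj_u hν₀ ?_)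
        rw [hp₁.eq, hz, h]
      obtain ⟨f₁, hf₁0, hf₁e, -⟩ := M.exists_branch hν₀ (p₀ := (a₁, b₁)) hp₁.eq hw
      have cf : ContinuousAt (fun z : (ℝ × ℝ) × ℝ => f₁ z.1.1) ((ν₀, a₀), y) :=
        ContinuousAt.comp (g := f₁) (f := fun z : (ℝ × ℝ) × ℝ => z.1.1) hf₁e.self_of_nhds.1
          (by fun_prop)
      have c1 : ContinuousAt (fun z : (ℝ × ℝ) × ℝ => z.1.2) ((ν₀, a₀), y) := by fun_prop
      have c2 : ContinuousAt (fun z : (ℝ × ℝ) × ℝ => z.1.1) ((ν₀, a₀), y) := by fun_prop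
      have g1 := cf.fst.eventually_lt c1 (by simpa [hf₁0] using hlt)
      have g2 := cf.snd.eventually_lt continuousAt_snd (by simpa [hf₁0] using hlt')
      have g3 := cf.fst.eventually (lt_mem_nhds (a := (0 : ℝ)) (by simpa [hf₁0] using hp₁.pos_a))
      have g4 := cf.snd.eventually (lt_mem_nhds (a := (0 : ℝ)) (by simpa [hf₁0] using hp₁.pos_b))
      have g5 := c2.eventually (hf₁e.mono fun ν h => h.2.1)
      filter_upwards [g1, g2, g3, g4, g5] with z k1 k2 k3 k4 k5 hp
      exact hp.disjoint _ ⟨k3, k1⟩ _ ⟨k4, k2⟩ k5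
    · have hre : Tendsto (fun z : (ℝ × ℝ) × ℝ => (z.1.1, (z.1.2, z.2))) (𝓝 ((ν₀, a₀), y))
          (𝓝 (ν₀, (a₀, y))) := by
        have : ContinuousAt (fun z : (ℝ × ℝ) × ℝ => (z.1.1, (z.1.2, z.2))) ((ν₀, a₀), y) := by
          fun_prop
        exact this
      filter_upwards [hre.eventually (M.eventually_ne hν₀ (p := (a₀, y)) hz)] with z hz' hp
      exact hz' hp.eq
  have hD : ∀ᶠ q : ℝ × ℝ in 𝓝 (ν₀, a₀), q.1 ∈ 𝓗.posParams :=
    continuousAt_fst.eventually ((isOpen_posParams 𝓗).mem_nhds hν₀)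
  filter_upwards [hbd, key, hD] with q h1 h2 hq hmem
  obtain ⟨b, hb⟩ := M.exists_primaryAt_of_mem hf hq hmem
  exact h2 b (h1 b hb) hb

/-- A fundamental domain contains only finitely many primary points. -/
theorem ManifoldParams.finite_primaryParams {ν : ℝ} (hν : ν ∈ 𝓗.posParams) (x : ℝ) :
    (primaryParams 𝓗 S c ν ∩ Ico x (μ ν * x)).Finite := by
  obtain ⟨A, hA, hAo⟩ := hf.primary.finite ν hν
  have hμ := M.one_lt ν hν
  have hμ0 : 0 < μ ν := by linarith
  have hex : ∀ a ∈ primaryParams 𝓗 S c ν ∩ Ico x (μ ν * x), ∃ q ∈ A, 𝓗.SameOrbit ν q (c ν a) :=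
    fun a ha => hAo _ ha.1.2.1
  choose! q hqA hq using hex
  refine Set.Finite.of_injOn (f := q) (t := A) (fun a ha => hqA a ha) ?_ hA
  intro a ha a' ha' heq
  obtain ⟨n, hn⟩ := hq a ha
  obtain ⟨n', hn'⟩ := hq a' ha'
  have h1 : c ν a' = c ν (μ ν ^ (n' - n) * a) := by
    rw [← M.map_iter_u hν hf, hn, heq, ← iter_add hf hν, sub_add_cancel, ← hn']
  have h2 := M.inj_u hν h1
  have ha0 := ha.1.1
  -- two points of one orbit in a fundamental domain coincide
  have h3 : n' - n = 0 := by
    by_contra hne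
    rcases lt_or_gt_of_ne hne with h | h
    · have h4 : μ ν ^ (n' - n) ≤ μ ν ^ (-1 : ℤ) := zpow_le_zpow_right₀ hμ.le (by omega)
      have h5 : μ ν ^ (n' - n) * a ≤ μ ν ^ (-1 : ℤ) * a := by gcongr
      have h6 : μ ν ^ (-1 : ℤ) * a < x := by
        rw [zpow_neg_one, inv_mul_lt_iff₀ hμ0]; exact ha.2.2
      linarith [ha'.2.1]
    · have h4 : μ ν ^ (1 : ℤ) ≤ μ ν ^ (n' - n) := zpow_le_zpow_right₀ hμ.le (by omega)
      rw [zpow_one] at h4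
      have h5 : μ ν * a ≤ μ ν ^ (n' - n) * a := by gcongr
      have h6 : μ ν * x ≤ μ ν * a := by gcongr; exact ha.2.1
      linarith [ha'.2.2]
  rw [h2, h3]; simp

end points

/-! ### Continuation of locally defined objects over an interval -/

/-- Objects over an interval that are characterized by a property of their germs, and that extend
from either side across every point, extend to the whole interval. -/
lemma exists_extension_of_local {X : Type*} {D : Set ℝ} (hD : D.OrdConnected)
    {Q : (ℝ → X) → ℝ → Prop} (hQ : ∀ f g ν, f =ᶠ[𝓝 ν] g → Q f ν → Q g ν)
    (hext : ∀ β ∈ D, ∀ ε > 0, ∃ δ > 0, δ ≤ ε ∧ Ioo (β - δ) (β + δ) ⊆ D ∧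
      ∀ U, (U = Ioo (β - δ) β ∨ U = Ioo β (β + δ)) → ∀ f, (∀ ν ∈ U, Q f ν) →
        ∃ g, (∀ ν ∈ Ioo (β - δ) (β + δ), Q g ν) ∧ EqOn g f U)
    {J₀ : Set ℝ} (hJ₀ : IsOpen J₀) (hc₀ : J₀.OrdConnected) (hn₀ : J₀.Nonempty) (hJD : J₀ ⊆ D)
    {f₀ : ℝ → X} (hf₀ : ∀ ν ∈ J₀, Q f₀ ν) : ∃ f, (∀ ν ∈ D, Q f ν) ∧ EqOn f f₀ J₀ := by
  classical
  let T := {p : Set ℝ × (ℝ → X) // IsOpen p.1 ∧ p.1.OrdConnected ∧ J₀ ⊆ p.1 ∧ p.1 ⊆ D ∧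
    (∀ ν ∈ p.1, Q p.2 ν) ∧ EqOn p.2 f₀ J₀}
  let r : T → T → Prop := fun p q => p.1.1 ⊆ q.1.1 ∧ EqOn q.1.2 p.1.2 p.1.1
  have htrans : ∀ {a b c : T}, r a b → r b c → r a c := fun {a b c} h1 h2 =>
    ⟨h1.1.trans h2.1, fun ν hν => (h2.2 (h1.1 hν)).trans (h1.2 hν)⟩
  let t₀ : T := ⟨(J₀, f₀), hJ₀, hc₀, Subset.rfl, hJD, hf₀, fun _ _ => rfl⟩
  obtain ⟨m, hm⟩ := exists_maximal_of_chains_bounded (r := r) (by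
    intro C hC
    rcases C.eq_empty_or_nonempty with rfl | ⟨t₁, ht₁⟩
    · exact ⟨t₀, fun a ha => absurd ha (notMem_empty a)⟩
    set J : Set ℝ := ⋃ t ∈ C, t.1.1 with hJ
    have hmemJ : ∀ ν, ν ∈ J ↔ ∃ t ∈ C, ν ∈ t.1.1 := by intro ν; simp [hJ]
    set F : ℝ → X := fun ν => if h : ∃ t ∈ C, ν ∈ t.1.1 then h.choose.1.2 ν else f₀ ν with hF
    have hagree : ∀ t ∈ C, ∀ t' ∈ C, ∀ ν ∈ t.1.1, ν ∈ t'.1.1 → t.1.2 ν = t'.1.2 ν := by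
      intro t ht t' ht' ν hν hν'
      rcases eq_or_ne t t' with rfl | hne
      · rfl
      rcases hC ht ht' hne with h | h
      · exact (h.2 hν).symm
      · exact h.2 hν'
    have hFt : ∀ t ∈ C, EqOn F t.1.2 t.1.1 := by
      intro t ht ν hν
      have hex : ∃ t ∈ C, ν ∈ t.1.1 := ⟨t, ht, hν⟩
      have : F ν = hex.choose.1.2 ν := dif_pos hex
      rw [this]
      exact hagree _ hex.choose_spec.1 _ ht ν hex.choose_spec.2 hν
    refine ⟨⟨(J, F), ?_, ?_, ?_, ?_, ?_, ?_⟩, fun t ht => ⟨?_, hFt t ht⟩⟩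
    · exact isOpen_biUnion fun t _ => t.2.1
    · -- two members of a chain lie in a common one
      refine ⟨fun x hx y hy z hz => ?_⟩
      obtain ⟨t, ht, hxt⟩ := (hmemJ x).1 hx
      obtain ⟨t', ht', hyt⟩ := (hmemJ y).1 hy
      rcases eq_or_ne t t' with rfl | hne
      · exact (hmemJ z).2 ⟨t, ht, t.2.2.1.out hxt hyt hz⟩
      rcases hC ht ht' hne with h | h
      · exact (hmemJ z).2 ⟨t', ht', t'.2.2.1.out (h.1 hxt) hyt hz⟩
      · exact (hmemJ z).2 ⟨t, ht, t.2.2.1.out hxt (h.1 hyt) hz⟩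
    · exact fun ν hν => (hmemJ ν).2 ⟨t₁, ht₁, t₁.2.2.2.1 hν⟩
    · intro ν hν
      obtain ⟨t, ht, h⟩ := (hmemJ ν).1 hν
      exact t.2.2.2.2.1 h
    · intro ν hν
      obtain ⟨t, ht, h⟩ := (hmemJ ν).1 hν
      refine hQ t.1.2 F ν ?_ (t.2.2.2.2.2.1 ν h)
      filter_upwards [t.2.1.mem_nhds h] with x hx
      exact (hFt t ht hx).symm
    · intro ν hν
      exact (hFt t₁ ht₁ (t₁.2.2.2.1 hν)).trans (t₁.2.2.2.2.2.2 hν)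
    · exact fun ν hν => (hmemJ ν).2 ⟨t, ht, hν⟩) htrans
  obtain ⟨⟨J, f⟩, hJo, hJc, hJ0, hJsub, hfQ, hff₀⟩ := m
  simp only at hJo hJc hJ0 hJsub hfQ hff₀
  -- a maximal object extends across no point
  have hno : ∀ β ∈ D, β ∉ J → ∀ δ > 0, Ioo (β - δ) (β + δ) ⊆ D → ∀ U, U.Nonempty → U ⊆ J →
      J ∩ Ioo (β - δ) (β + δ) ⊆ U → ∀ g, (∀ ν ∈ Ioo (β - δ) (β + δ), Q g ν) → EqOn g f U →
      U ⊆ Ioo (β - δ) (β + δ) → False := by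
    intro β hβ hβJ δ hδ hVD U ⟨u, hu⟩ hUJ hUs g hg hgf hUV
    set F : ℝ → X := fun ν => if ν ∈ J then f ν else g ν with hF
    have hFJ : EqOn F f J := fun ν hν => if_pos hν
    have hFV : EqOn F g (Ioo (β - δ) (β + δ)) := by
      intro ν hν
      by_cases h : ν ∈ J
      · exact (hFJ h).trans (hgf (hUs ⟨h, hν⟩)).symm
      · exact if_neg h
    let t : T := ⟨(J ∪ Ioo (β - δ) (β + δ), F), hJo.union isOpen_Ioo,
      (hJc.isPreconnected.union' ⟨u, hUJ hu, hUV hu⟩ isPreconnected_Ioo).ordConnected,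
      hJ0.trans subset_union_left, union_subset hJsub hVD, by
        rintro ν (hν | hν)
        · exact hQ f F ν (eventually_of_mem (hJo.mem_nhds hν) fun x hx => (hFJ hx).symm) (hfQ ν hν)
        · exact hQ g F ν (eventually_of_mem (isOpen_Ioo.mem_nhds hν) fun x hx => (hFV hx).symm)
            (hg ν hν), fun ν hν => (hFJ (hJ0 hν)).trans (hff₀ hν)⟩
    have := (hm t ⟨subset_union_left, hFJ⟩).1
    exact hβJ (this (Or.inr ⟨by linarith, by linarith⟩))
  obtain ⟨j, hj₀⟩ := hn₀
  have hj : j ∈ J := hJ0 hj₀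
  suffices hJD' : D ⊆ J from ⟨f, fun ν hν => hfQ ν (hJD' hν), hff₀⟩
  intro ν hν
  by_contra hνJ
  rcases lt_trichotomy j ν with hlt | rfl | hlt
  · have hub : ∀ x ∈ J, x ≤ ν := by
      intro x hx
      by_contra h
      exact hνJ (hJc.out hj hx ⟨hlt.le, (not_le.1 h).le⟩)
    have hlub := isLUB_csSup ⟨j, hj⟩ ⟨ν, hub⟩
    set β := sSup J with hβ
    have hβD : β ∈ D := hD.out (hJsub hj) hν ⟨hlub.1 hj, hlub.2 hub⟩
    have hβJ : β ∉ J := by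
      intro h
      obtain ⟨e, he, hball⟩ := Metric.isOpen_iff.1 hJo β h
      have : β + e / 2 ∈ J := hball (by
        rw [Real.ball_eq_Ioo]; exact ⟨by linarith, by linarith⟩)
      linarith [hlub.1 this]
    have hjβ : j < β := lt_of_le_of_ne (hlub.1 hj) fun h => hβJ (h ▸ hj)
    obtain ⟨δ, hδ, hδε, hVD, hst⟩ := hext β hβD (β - j) (by linarith)
    have hUJ : Ioo (β - δ) β ⊆ J := by
      intro x hx
      obtain ⟨y, hy, hxy⟩ := (lt_isLUB_iff hlub).1 hx.2
      exact hJc.out hj hy ⟨by linarith [hx.1], hxy.le⟩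
    obtain ⟨g, hg, hgf⟩ := hst _ (Or.inl rfl) f fun x hx => hfQ x (hUJ hx)
    exact hno β hβD hβJ δ hδ hVD _ (nonempty_Ioo.2 (by linarith)) hUJ
      (fun x hx => ⟨hx.2.1, lt_of_le_of_ne (hlub.1 hx.1) fun h => hβJ (h ▸ hx.1)⟩) g hg hgf
      (Ioo_subset_Ioo_right (by linarith))
  · exact hνJ hj
  · have hub : ∀ x ∈ J, ν ≤ x := by
      intro x hx
      by_contra h
      exact hνJ (hJc.out hx hj ⟨(not_le.1 h).le, hlt.le⟩)
    have hglb := isGLB_csInf ⟨j, hj⟩ ⟨ν, hub⟩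
    set β := sInf J with hβ
    have hβD : β ∈ D := hD.out hν (hJsub hj) ⟨hglb.2 hub, hglb.1 hj⟩
    have hβJ : β ∉ J := by
      intro h
      obtain ⟨e, he, hball⟩ := Metric.isOpen_iff.1 hJo β h
      have : β - e / 2 ∈ J := hball (by
        rw [Real.ball_eq_Ioo]; exact ⟨by linarith, by linarith⟩)
      linarith [hglb.1 this]
    have hjβ : β < j := lt_of_le_of_ne (hglb.1 hj) fun h => hβJ (h ▸ hj)
    obtain ⟨δ, hδ, hδε, hVD, hst⟩ := hext β hβD (j - β) (by linarith)
    have hUJ : Ioo β (β + δ) ⊆ J := by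
      intro x hx
      obtain ⟨y, hy, hxy⟩ := (isGLB_lt_iff hglb).1 hx.1
      exact hJc.out hy hj ⟨hxy.le, by linarith [hx.2]⟩
    obtain ⟨g, hg, hgf⟩ := hst _ (Or.inr rfl) f fun x hx => hfQ x (hUJ hx)
    exact hno β hβD hβJ δ hδ hVD _ (nonempty_Ioo.2 (by linarith)) hUJ
      (fun x hx => ⟨lt_of_le_of_ne (hglb.1 hx.1) fun h => hβJ (h ▸ hx.1), hx.2.2⟩) g hg hgf
      (Ioo_subset_Ioo_left (by linarith))

/-- A finite strictly monotone map extends to an order isomorphism onto any larger finite set: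
the missing values are added one by one, each labelled by a real number from the corresponding gap
in the set of labels. -/
lemma exists_strictMonoOn_extension (F : Finset ℝ) (n : ℕ) : ∀ (R : Finset ℝ) (x : ℝ → ℝ),
    StrictMonoOn x R → (∀ r ∈ R, x r ∈ F) → F.card = R.card + n →
    ∃ L, R ⊆ L ∧ ∃ x', EqOn x' x R ∧ StrictMonoOn x' L ∧ x' '' L = F := by
  classical
  induction n with
  | zero =>
    intro R x hx hF hcard
    refine ⟨R, Finset.Subset.refl _, x, fun _ _ => rfl, hx, ?_⟩
    rw [← Finset.coe_image, Finset.coe_inj]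
    refine Finset.eq_of_subset_of_card_le (Finset.image_subset_iff.2 hF) ?_
    rw [Finset.card_image_of_injOn hx.injOn, hcard, add_zero]
  | succ n ih =>
    intro R x hx hF hcard
    obtain ⟨y, hyF, hy⟩ : ∃ y ∈ F, y ∉ R.image x := by
      refine Finset.exists_mem_notMem_of_card_lt_card ?_
      rw [Finset.card_image_of_injOn hx.injOn, hcard]; omega
    have hyne : ∀ r ∈ R, x r ≠ y := fun r hr h => hy (Finset.mem_image.2 ⟨r, hr, h⟩)
    obtain ⟨m, hm1, hm2⟩ := Order.exists_between_finsets (R.filter fun r => x r < y)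
      (R.filter fun r => y < x r) (by
        intro a ha b hb
        rw [Finset.mem_filter] at ha hb
        exact (hx.lt_iff_lt ha.1 hb.1).1 (ha.2.trans hb.2))
    have hmR : ∀ r ∈ R, (r < m ∧ x r < y) ∨ (m < r ∧ y < x r) := by
      intro r hr
      rcases lt_or_gt_of_ne (hyne r hr) with h | h
      · exact Or.inl ⟨hm1 r (Finset.mem_filter.2 ⟨hr, h⟩), h⟩
      · exact Or.inr ⟨hm2 r (Finset.mem_filter.2 ⟨hr, h⟩), h⟩
    have hmn : m ∉ R := fun h => by rcases hmR m h with h | h <;> exact lt_irrefl _ h.1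
    have hne : ∀ r ∈ R, r ≠ m := fun r hr h => hmn (h ▸ hr)
    set x₁ := Function.update x m y with hx₁
    have hx₁m : x₁ m = y := Function.update_self _ _ _
    have hx₁r : ∀ r ∈ R, x₁ r = x r := fun r hr => Function.update_of_ne (hne r hr) _ _
    obtain ⟨L, hL, x', hx', hmono, himg⟩ := ih (insert m R) x₁ (by
        intro a ha b hb hab
        rw [Finset.coe_insert] at ha hb
        rcases ha with rfl | ha <;> rcases hb with rfl | hb
        · exact absurd hab (lt_irrefl _)
        · rw [hx₁m, hx₁r b hb]
          rcases hmR b hb with h | h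
          · exact absurd hab h.1.not_gt
          · exact h.2
        · rw [hx₁m, hx₁r a ha]
          rcases hmR a ha with h | h
          · exact h.2
          · exact absurd hab h.1.not_gt
        · rw [hx₁r a ha, hx₁r b hb]
          exact hx ha hb hab)
      (by
        intro r hr
        rcases Finset.mem_insert.1 hr with rfl | hr
        · rw [hx₁m]; exact hyF
        · rw [hx₁r r hr]; exact hF r hr)
      (by rw [Finset.card_insert_of_notMem hmn, hcard]; omega)
    refine ⟨L, (Finset.subset_insert _ _).trans hL, x', fun r hr => ?_, hmono, himg⟩
    rw [hx' (by rw [Finset.coe_insert]; exact Or.inr hr), hx₁r r hr]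

/-! ### Labelling the branches of an abstract family of orbits -/

/-- What the labelling uses of the primary homoclinic points: over each parameter `ν` of an open
interval `D` lies a set `A ν` of positive numbers, invariant under multiplication by `μ ν` and
finite modulo it, and a subset `N ν` of points that have a unique local continuation. Outside a
locally finite set `B` all points are such, and no new points are born. -/
structure BranchSystem (D B : Set ℝ) (μ : ℝ → ℝ) (A N : ℝ → Set ℝ) : Prop where
  isOpen : IsOpen D
  ordConnected : D.OrdConnected
  one_lt : ∀ ν ∈ D, 1 < μ ν
  cont_μ : ∀ ν ∈ D, ContinuousAt μ ν
  sub : ∀ ν ∈ D, N ν ⊆ A ν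
  pos : ∀ ν ∈ D, ∀ a ∈ A ν, 0 < a
  nonempty : ∀ ν ∈ D, (A ν).Nonempty
  zpow_A : ∀ ν ∈ D, ∀ a ∈ A ν, ∀ n : ℤ, μ ν ^ n * a ∈ A ν
  zpow_N : ∀ ν ∈ D, ∀ a ∈ N ν, ∀ n : ℤ, μ ν ^ n * a ∈ N ν
  finite : ∀ ν ∈ D, ∀ x, (A ν ∩ Ico x (μ ν * x)).Finite
  continuation : ∀ ν₀ ∈ D, ∀ a₀ ∈ N ν₀, ∃ α : ℝ → ℝ, α ν₀ = a₀ ∧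
    (∀ᶠ ν in 𝓝 ν₀, ContinuousAt α ν ∧ α ν ∈ N ν) ∧
    ∀ᶠ q : ℝ × ℝ in 𝓝 (ν₀, a₀), q.2 ∈ A q.1 → q.2 = α q.1
  eq_of_notMem : ∀ ν ∈ D, ν ∉ B → N ν = A ν
  closed : ∀ ν ∈ D, ν ∉ B → ∀ a > 0, a ∉ A ν → ∀ᶠ q : ℝ × ℝ in 𝓝 (ν, a), q.2 ∉ A q.1
  finite_B : ∀ a b : ℝ, (B ∩ Ioo a b).Finite

/-- `x` labels one point of each orbit of `A` under multiplication by `m` by the elements of `L`,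
respecting the order, all in one fundamental segment; `x` vanishes outside `L`. -/
structure IsLabelledBy (m : ℝ) (A : Set ℝ) (L : Finset ℝ) (x : ℝ → ℝ) : Prop where
  mem : ∀ r ∈ L, x r ∈ A
  strictMono : StrictMonoOn x L
  window : ∀ r ∈ L, ∀ r' ∈ L, x r < m * x r'
  exhaust : ∀ y ∈ A, ∃ n : ℤ, ∃ r ∈ L, y = m ^ n * x r
  support : ∀ r ∉ L, x r = 0

/-- The properties of a labelling `f` at the parameter `ν`. -/
structure IsLabellingAt (B : Set ℝ) (μ : ℝ → ℝ) (A N : ℝ → Set ℝ) (f : ℝ → Finset ℝ × (ℝ → ℝ))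
    (ν : ℝ) : Prop where
  labelled : IsLabelledBy (μ ν) (A ν) (f ν).1 (f ν).2
  const : ν ∉ B → ∀ᶠ ν' in 𝓝 ν, (f ν').1 = (f ν).1
  persists : ∀ r ∈ (f ν).1, (f ν).2 r ∈ N ν →
    ∀ᶠ ν' in 𝓝 ν, r ∈ (f ν').1 ∧ ContinuousAt (fun x => (f x).2 r) ν'

lemma IsLabellingAt.congr {B : Set ℝ} {μ : ℝ → ℝ} {A N : ℝ → Set ℝ}
    {f g : ℝ → Finset ℝ × (ℝ → ℝ)} {ν : ℝ} (hfg : f =ᶠ[𝓝 ν] g) (h : IsLabellingAt B μ A N f ν) :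
    IsLabellingAt B μ A N g ν := by
  have h0 := hfg.self_of_nhds
  refine ⟨h0 ▸ h.labelled, fun hν => ?_, fun r hr hrN => ?_⟩
  · filter_upwards [hfg, h.const hν] with x hx hx'
    rw [← hx, hx', h0]
  · rw [← h0] at hr hrN
    filter_upwards [hfg, eventually_eventually_nhds.2 hfg, h.persists r hr hrN] with x hx hx' hp
    rw [← hx]
    exact ⟨hp.1, hp.2.congr (hx'.mono fun y hy => by beta_reduce; rw [hy])⟩

/-- In a fundamental segment each orbit has at most one point. -/
lemma zpow_eq_zero_of_window {m a b : ℝ} (hm : 1 < m) (hb : 0 < b) (h1 : a < m * b)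
    (h2 : b < m * a) {n : ℤ} (h : a = m ^ n * b) : n = 0 := by
  have hm0 : 0 < m := by linarith
  rw [h] at h1 h2
  have h1' : m ^ n < m ^ (1 : ℤ) := by rw [zpow_one]; exact lt_of_mul_lt_mul_right h1 hb.le
  have h2' : m ^ (0 : ℤ) < m ^ (1 + n) := by
    rw [zpow_zero, zpow_add₀ hm0.ne', zpow_one]
    nlinarith
  have := (zpow_lt_zpow_iff_right₀ hm).1 h1'
  have := (zpow_lt_zpow_iff_right₀ hm).1 h2'
  omega

lemma IsLabelledBy.unique {m : ℝ} {A : Set ℝ} {L : Finset ℝ} {x : ℝ → ℝ}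
    (h : IsLabelledBy m A L x) (hm : 1 < m) (hA : ∀ a ∈ A, 0 < a) {r r' : ℝ} (hr : r ∈ L)
    (hr' : r' ∈ L) {n : ℤ} (hrr : x r = m ^ n * x r') : n = 0 ∧ r = r' := by
  have hn := zpow_eq_zero_of_window hm (hA _ (h.mem r' hr')) (h.window r hr r' hr')
    (h.window r' hr' r hr) hrr
  refine ⟨hn, h.strictMono.injOn hr hr' ?_⟩
  rw [hrr, hn, zpow_zero, one_mul]

namespace BranchSystem

variable {D B : Set ℝ} {μ : ℝ → ℝ} {A N : ℝ → Set ℝ} (Z : BranchSystem D B μ A N)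
include Z

lemma cont_zpow {ν : ℝ} (hν : ν ∈ D) (n : ℤ) : ContinuousAt (fun x => μ x ^ n) ν :=
  (Z.cont_μ ν hν).zpow₀ n (Or.inl (by linarith [Z.one_lt ν hν]))

/-- A partial labelling of a fibre extends to a labelling. -/
lemma exists_labelled {ν : ℝ} (hν : ν ∈ D) (R : Finset ℝ) (x : ℝ → ℝ) (hx : ∀ r ∈ R, x r ∈ A ν)
    (hmono : StrictMonoOn x R) (hwin : ∀ r ∈ R, ∀ r' ∈ R, x r < μ ν * x r') :
    ∃ L x', R ⊆ L ∧ EqOn x' x R ∧ IsLabelledBy (μ ν) (A ν) L x' := by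
  classical
  have hμ := Z.one_lt ν hν
  have hμ0 : 0 < μ ν := by linarith
  -- the fundamental segment starts at the smallest labelled point
  obtain ⟨m, hm, hR⟩ : ∃ m ∈ A ν, ∀ r ∈ R, x r ∈ Ico m (μ ν * m) := by
    rcases R.eq_empty_or_nonempty with rfl | hne
    · obtain ⟨m, hm⟩ := Z.nonempty ν hν
      exact ⟨m, hm, fun r hr => absurd hr (Finset.notMem_empty r)⟩
    · obtain ⟨r₀, hr₀, hmin⟩ := R.exists_min_image x hne
      exact ⟨x r₀, hx r₀ hr₀, fun r hr => ⟨hmin r hr, hwin r hr r₀ hr₀⟩⟩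
  have hm0 := Z.pos ν hν m hm
  have hfin := Z.finite ν hν m
  have hmaps : ∀ r ∈ R, x r ∈ hfin.toFinset := fun r hr =>
    hfin.mem_toFinset.2 ⟨hx r hr, hR r hr⟩
  have hcard : R.card ≤ hfin.toFinset.card := by
    rw [← Finset.card_image_of_injOn hmono.injOn]
    exact Finset.card_le_card (Finset.image_subset_iff.2 hmaps)
  obtain ⟨L, hRL, x', hx', hmono', himg⟩ := exists_strictMonoOn_extension hfin.toFinset
    (hfin.toFinset.card - R.card) R x hmono hmaps (by omega)
  rw [hfin.coe_toFinset] at himg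
  have hxL : ∀ r ∈ L, x' r ∈ A ν ∩ Ico m (μ ν * m) := fun r hr => himg ▸ mem_image_of_mem x' hr
  obtain ⟨x'', hind, hsupp⟩ : ∃ x'' : ℝ → ℝ, EqOn x'' x' L ∧ ∀ r ∉ L, x'' r = 0 :=
    ⟨fun r => if r ∈ L then x' r else 0, fun r hr => if_pos hr, fun r hr => if_neg hr⟩
  refine ⟨L, x'', hRL, fun r hr => (hind (hRL hr)).trans (hx' hr), ?_, ?_, ?_, ?_, hsupp⟩
  · intro r hr
    rw [hind hr]; exact (hxL r hr).1
  · exact hmono'.congr hind.symm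
  · intro r hr r' hr'
    rw [hind hr, hind hr']
    calc x' r < μ ν * m := (hxL r hr).2.2
      _ ≤ μ ν * x' r' := by gcongr; exact (hxL r' hr').2.1
  · intro y hy
    have hy0 := Z.pos ν hν y hy
    obtain ⟨n, hn1, hn2⟩ := exists_mem_Ico_zpow (x := y / m) (y := μ ν) (div_pos hy0 hm0) hμ
    rw [le_div_iff₀ hm0] at hn1
    rw [div_lt_iff₀ hm0, zpow_add_one₀ hμ0.ne'] at hn2
    have hp : 0 < μ ν ^ n := zpow_pos hμ0 n
    have hmem : μ ν ^ (-n) * y ∈ A ν ∩ Ico m (μ ν * m) := by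
      refine ⟨Z.zpow_A ν hν y hy (-n), ?_, ?_⟩
      · rw [zpow_neg, le_inv_mul_iff₀ hp]; exact hn1
      · rw [zpow_neg, inv_mul_lt_iff₀ hp]; linarith
    rw [← himg] at hmem
    obtain ⟨r, hr, hry⟩ := hmem
    refine ⟨n, r, hr, ?_⟩
    rw [hind hr, hry, ← mul_assoc, ← zpow_add₀ hμ0.ne', add_neg_cancel, zpow_zero, one_mul]

/-- Two continuous sections, one of which consists of continuable points, agree over a connected set
if they agree at one point. -/
lemma section_unique {U : Set ℝ} (hUD : U ⊆ D) (hU : IsOpen U) (hc : U.OrdConnected) {σ τ : ℝ → ℝ}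
    (hσ : ∀ ν ∈ U, ContinuousAt σ ν ∧ σ ν ∈ N ν) (hτ : ∀ ν ∈ U, ContinuousAt τ ν ∧ τ ν ∈ A ν)
    {ν₁ : ℝ} (hν₁ : ν₁ ∈ U) (h : σ ν₁ = τ ν₁) : EqOn σ τ U := by
  have hloc : ∀ ν ∈ U, σ ν = τ ν → σ =ᶠ[𝓝 ν] τ := by
    intro ν hν heq
    obtain ⟨α, hα, -, huniq⟩ := Z.continuation ν (hUD hν) (σ ν) (hσ ν hν).2
    have h1 : Tendsto (fun x => (x, σ x)) (𝓝 ν) (𝓝 (ν, σ ν)) :=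
      continuousAt_id.prodMk (hσ ν hν).1
    have h2 : Tendsto (fun x => (x, τ x)) (𝓝 ν) (𝓝 (ν, σ ν)) := by
      rw [heq]; exact continuousAt_id.prodMk (hτ ν hν).1
    filter_upwards [h1.eventually huniq, h2.eventually huniq, hU.mem_nhds hν] with x h1 h2 hx
    rw [h1 (Z.sub x (hUD hx) (hσ x hx).2), h2 (hτ x hx).2]
  have hsub : U ⊆ {ν | σ =ᶠ[𝓝 ν] τ} := by
    refine hc.isPreconnected.subset_left_of_subset_union (u := {ν | σ =ᶠ[𝓝 ν] τ})
      (v := {ν | ∀ᶠ x in 𝓝 ν, σ x ≠ τ x}) isOpen_setOfPred_eventually_nhds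
      isOpen_setOfPred_eventually_nhds ?_ ?_ ⟨ν₁, hν₁, hloc ν₁ hν₁ h⟩
    · rw [Set.disjoint_left]
      intro ν h1 h2
      have h1' : σ =ᶠ[𝓝 ν] τ := h1
      exact Filter.Eventually.self_of_nhds h2 h1'.eq_of_nhds
    · intro ν hν
      by_cases heq : σ ν = τ ν
      · exact Or.inl (hloc ν hν heq)
      · exact Or.inr (((hσ ν hν).1.prodMk (hτ ν hν).1).eventually
          ((isOpen_ne_fun continuous_fst continuous_snd).mem_nhds heq))
  exact fun ν hν => (hsub hν).self_of_nhds

/-- Local triviality near a parameter outside `B`. -/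
lemma exists_local_sections {ν₀ : ℝ} (hν₀ : ν₀ ∈ D) (hB : ν₀ ∉ B) :
    ∀ᶠ V in (𝓝 ν₀).smallSets, ∀ ν₁ ∈ V, ∀ x ∈ A ν₁, ∃ σ : ℝ → ℝ, σ ν₁ = x ∧
      ∀ ν ∈ V, ContinuousAt σ ν ∧ σ ν ∈ A ν := by
  have hNA := Z.eq_of_notMem ν₀ hν₀ hB
  have hμ := Z.one_lt ν₀ hν₀
  have hcon : ∀ y, ∃ α : ℝ → ℝ, y ∈ A ν₀ → α ν₀ = y ∧
      (∀ᶠ ν in 𝓝 ν₀, ContinuousAt α ν ∧ α ν ∈ N ν) ∧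
      ∀ᶠ q : ℝ × ℝ in 𝓝 (ν₀, y), q.2 ∈ A q.1 → q.2 = α q.1 := by
    intro y
    by_cases hy : y ∈ A ν₀
    · obtain ⟨α, h⟩ := Z.continuation ν₀ hν₀ y (hNA.symm ▸ hy)
      exact ⟨α, fun _ => h⟩
    · exact ⟨0, fun h => absurd h hy⟩
  choose α hα using hcon
  obtain ⟨y₀, hy₀⟩ := Z.nonempty ν₀ hν₀
  have hy₀0 := Z.pos ν₀ hν₀ y₀ hy₀
  obtain ⟨hα0, hα1, -⟩ := hα y₀ hy₀
  -- a moving fundamental segment, parametrized by the unit interval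
  set e : ℝ → ℝ → ℝ := fun ν t => α y₀ ν + t * (μ ν * α y₀ ν - α y₀ ν) with he
  set F : Set ℝ := A ν₀ ∩ Icc y₀ (μ ν₀ * y₀) with hF
  have hFfin : F.Finite := by
    refine ((Z.finite ν₀ hν₀ y₀).union (finite_singleton (μ ν₀ * y₀))).subset ?_
    rintro y ⟨hy, h1, h2⟩
    rcases h2.eq_or_lt with h | h
    · exact Or.inr h
    · exact Or.inl ⟨hy, h1, h⟩
  have key : ∀ᶠ ν in 𝓝 ν₀, ∀ t ∈ Icc (0 : ℝ) 1, e ν t ∈ A ν → ∃ y ∈ F, e ν t = α y ν := by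
    refine isCompact_Icc.eventually_forall_of_forall_eventually
      (P := fun ν t => e ν t ∈ A ν → ∃ y ∈ F, e ν t = α y ν) ?_
    intro t ht
    have hc1 : ContinuousAt (fun z : ℝ × ℝ => α y₀ z.1) (ν₀, t) :=
      ContinuousAt.comp (g := α y₀) (f := Prod.fst) hα1.self_of_nhds.1 continuousAt_fst
    have hc2 : ContinuousAt (fun z : ℝ × ℝ => μ z.1) (ν₀, t) :=
      ContinuousAt.comp (g := μ) (f := Prod.fst) (Z.cont_μ ν₀ hν₀) continuousAt_fst
    have hc : Tendsto (fun z : ℝ × ℝ => (z.1, e z.1 z.2)) (𝓝 (ν₀, t)) (𝓝 (ν₀, e ν₀ t)) :=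
      continuousAt_fst.prodMk (hc1.add (continuousAt_snd.mul ((hc2.mul hc1).sub hc1)))
    have h0 : e ν₀ t ∈ Icc y₀ (μ ν₀ * y₀) := by
      simp only [he, hα0]
      have h1 : 0 ≤ μ ν₀ * y₀ - y₀ := by nlinarith
      exact ⟨by nlinarith [ht.1], by nlinarith [ht.2]⟩
    by_cases hA : e ν₀ t ∈ A ν₀
    · filter_upwards [hc.eventually (hα _ hA).2.2] with z hz hzA
      exact ⟨_, ⟨hA, h0⟩, hz hzA⟩
    · filter_upwards [hc.eventually (Z.closed ν₀ hν₀ hB _ (lt_of_lt_of_le hy₀0 h0.1) hA)]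
        with z hz hzA
      exact absurd hzA hz
  have hgood : ∀ᶠ ν in 𝓝 ν₀, ∀ y ∈ F, ContinuousAt (α y) ν ∧ α y ν ∈ N ν :=
    (eventually_all_finite hFfin).2 fun y hy => (hα y hy.1).2.1
  have hall := key.and (hgood.and (hα1.and (Z.isOpen.mem_nhds hν₀)))
  filter_upwards [hall.smallSets] with V hV ν₁ hν₁ x hx
  obtain ⟨h1, -, h3, hν₁D⟩ := hV ν₁ hν₁
  have hm := Z.one_lt ν₁ hν₁D
  have hm0 : 0 < μ ν₁ := by linarith
  have hx0 := Z.pos ν₁ hν₁D x hx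
  have ha0 := Z.pos ν₁ hν₁D _ (Z.sub ν₁ hν₁D h3.2)
  obtain ⟨n, hn1, hn2⟩ := exists_mem_Ico_zpow (x := x / α y₀ ν₁) (y := μ ν₁) (div_pos hx0 ha0) hm
  rw [le_div_iff₀ ha0] at hn1
  rw [div_lt_iff₀ ha0, zpow_add_one₀ hm0.ne'] at hn2
  have hp : 0 < μ ν₁ ^ n := zpow_pos hm0 n
  have hxn := Z.zpow_A ν₁ hν₁D x hx (-n)
  have hlen : 0 < μ ν₁ * α y₀ ν₁ - α y₀ ν₁ := by nlinarith
  have hw1 : α y₀ ν₁ ≤ μ ν₁ ^ (-n) * x := by rw [zpow_neg, le_inv_mul_iff₀ hp]; exact hn1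
  have hw2 : μ ν₁ ^ (-n) * x < μ ν₁ * α y₀ ν₁ := by rw [zpow_neg, inv_mul_lt_iff₀ hp]; linarith
  set t := (μ ν₁ ^ (-n) * x - α y₀ ν₁) / (μ ν₁ * α y₀ ν₁ - α y₀ ν₁) with ht
  have het : e ν₁ t = μ ν₁ ^ (-n) * x := by
    simp only [he, ht]
    rw [div_mul_cancel₀ _ hlen.ne']; ring
  obtain ⟨y, hyF, hy⟩ := h1 t ⟨div_nonneg (by linarith) hlen.le, (div_le_one hlen).2 (by linarith)⟩
    (het ▸ hxn)
  refine ⟨fun ν => μ ν ^ n * α y ν, ?_, fun ν hν => ?_⟩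
  · beta_reduce
    rw [← hy, het, ← mul_assoc, ← zpow_add₀ hm0.ne', add_neg_cancel, zpow_zero, one_mul]
  · obtain ⟨-, h2, -, hνD⟩ := hV ν hν
    exact ⟨(Z.cont_zpow hνD n).mul (h2 y hyF).1,
      Z.zpow_A ν hνD _ (Z.sub ν hνD (h2 y hyF).2) n⟩

/-- Through each point over an interval without points of `B` passes a continuous section. -/
lemma exists_section {I : Set ℝ} (hID : I ⊆ D) (hI : IsOpen I) (hc : I.OrdConnected)
    (hIB : Disjoint I B) {ν₁ x : ℝ} (hν₁ : ν₁ ∈ I) (hx : x ∈ A ν₁) :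
    ∃ σ : ℝ → ℝ, σ ν₁ = x ∧ ∀ ν ∈ I, ContinuousAt σ ν ∧ σ ν ∈ A ν := by
  have hloc : ∀ ν ∈ I, ∃ δ₀ > 0, ∀ δ ≤ δ₀, Ioo (ν - δ) (ν + δ) ⊆ I ∧
      ∀ ν₁ ∈ Ioo (ν - δ) (ν + δ), ∀ x ∈ A ν₁, ∃ σ : ℝ → ℝ, σ ν₁ = x ∧
        ∀ ν' ∈ Ioo (ν - δ) (ν + δ), ContinuousAt σ ν' ∧ σ ν' ∈ A ν' := by
    intro ν hν
    obtain ⟨V, hV, hV'⟩ := eventually_smallSets.1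
      (Z.exists_local_sections (hID hν) (Set.disjoint_left.1 hIB hν))
    obtain ⟨δ₀, hδ₀, hball⟩ := Metric.mem_nhds_iff.1 (inter_mem hV (hI.mem_nhds hν))
    refine ⟨δ₀, hδ₀, fun δ hδ => ?_⟩
    have hsub : Ioo (ν - δ) (ν + δ) ⊆ V ∩ I := by
      rw [Real.ball_eq_Ioo] at hball
      exact (Ioo_subset_Ioo (by linarith) (by linarith)).trans hball
    exact ⟨hsub.trans inter_subset_right, hV' _ (hsub.trans inter_subset_left)⟩
  obtain ⟨δ₀, hδ₀, hst⟩ := hloc ν₁ hν₁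
  have hmem₁ : ν₁ ∈ Ioo (ν₁ - δ₀) (ν₁ + δ₀) := ⟨by linarith, by linarith⟩
  obtain ⟨hsub, hsec⟩ := hst δ₀ le_rfl
  obtain ⟨σ₀, hσ₀, hσ₀'⟩ := hsec ν₁ hmem₁ x hx
  obtain ⟨σ, hσ, hσσ₀⟩ := exists_extension_of_local hc
    (Q := fun σ ν => ContinuousAt σ ν ∧ σ ν ∈ A ν)
    (fun f g ν hfg hf => ⟨hf.1.congr hfg, hfg.self_of_nhds ▸ hf.2⟩) (by
      intro β hβ ε hε
      obtain ⟨δ₁, hδ₁, hst₁⟩ := hloc β hβ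
      obtain ⟨hsub₁, hsec₁⟩ := hst₁ (min δ₁ ε) (min_le_left _ _)
      have hδ : 0 < min δ₁ ε := lt_min hδ₁ hε
      refine ⟨min δ₁ ε, hδ, min_le_right _ _, hsub₁, ?_⟩
      intro U hU f hf
      obtain ⟨hUo, hUc, ⟨u, hu⟩, hUs⟩ : IsOpen U ∧ U.OrdConnected ∧ U.Nonempty ∧
          U ⊆ Ioo (β - min δ₁ ε) (β + min δ₁ ε) := by
        rcases hU with rfl | rfl
        · exact ⟨isOpen_Ioo, ordConnected_Ioo, nonempty_Ioo.2 (by linarith),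
            Ioo_subset_Ioo_right (by linarith)⟩
        · exact ⟨isOpen_Ioo, ordConnected_Ioo, nonempty_Ioo.2 (by linarith),
            Ioo_subset_Ioo_left (by linarith)⟩
      obtain ⟨g, hgu, hg⟩ := hsec₁ u (hUs hu) (f u) (hf u hu).2
      have hUI := hUs.trans hsub₁
      refine ⟨g, hg, Z.section_unique (hUI.trans hID) hUo hUc (fun ν hν => ?_) hf hu hgu⟩
      rw [Z.eq_of_notMem ν (hID (hUI hν)) (Set.disjoint_left.1 hIB (hUI hν))]
      exact hg ν (hUs hν))
    isOpen_Ioo ordConnected_Ioo ⟨ν₁, hmem₁⟩ hsub hσ₀'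
  exact ⟨σ, (hσσ₀ hmem₁).trans hσ₀, hσ⟩

end BranchSystem

/-- A locally constant function on an interval is constant; only values at points of `U` are used
as centres, while the neighbourhoods are taken in `ℝ`. -/
lemma eq_of_eventually_eq {X : Type*} {U : Set ℝ} (hc : U.OrdConnected) {g : ℝ → X}
    (h : ∀ ν ∈ U, ∀ᶠ ν' in 𝓝 ν, g ν' = g ν) {ν ν' : ℝ} (hν : ν ∈ U) (hν' : ν' ∈ U) :
    g ν' = g ν := by
  have hsub : U ⊆ {x | ∀ᶠ x' in 𝓝 x, g x' = g ν} := by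
    refine hc.isPreconnected.subset_left_of_subset_union (u := {x | ∀ᶠ x' in 𝓝 x, g x' = g ν})
      (v := {x | ∀ᶠ x' in 𝓝 x, g x' ≠ g ν}) isOpen_setOfPred_eventually_nhds
      isOpen_setOfPred_eventually_nhds ?_ ?_ ⟨ν, hν, h ν hν⟩
    · rw [Set.disjoint_left]
      intro x h1 h2
      have h1' : ∀ᶠ x' in 𝓝 x, g x' = g ν := h1
      exact Filter.Eventually.self_of_nhds h2 h1'.self_of_nhds
    · intro x hx
      by_cases heq : g x = g ν
      · exact Or.inl ((h x hx).mono fun y hy => hy.trans heq)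
      · exact Or.inr ((h x hx).mono fun y hy => hy ▸ heq)
  have h' : ∀ᶠ x' in 𝓝 ν', g x' = g ν := hsub hν'
  exact h'.self_of_nhds

namespace BranchSystem

variable {D B : Set ℝ} {μ : ℝ → ℝ} {A N : ℝ → Set ℝ} (Z : BranchSystem D B μ A N)
include Z

section interval

variable {I : Set ℝ} (hID : I ⊆ D) (hI : IsOpen I) (hc : I.OrdConnected) (hIB : Disjoint I B)
include hID hI hc hIB

lemma section_eq {σ τ : ℝ → ℝ} (hσ : ∀ ν ∈ I, ContinuousAt σ ν ∧ σ ν ∈ A ν)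
    (hτ : ∀ ν ∈ I, ContinuousAt τ ν ∧ τ ν ∈ A ν) {ν₁ : ℝ} (hν₁ : ν₁ ∈ I) (h : σ ν₁ = τ ν₁) :
    EqOn σ τ I := by
  refine Z.section_unique hID hI hc (fun ν hν => ?_) hτ hν₁ h
  rw [Z.eq_of_notMem ν (hID hν) (Set.disjoint_left.1 hIB hν)]
  exact hσ ν hν

lemma section_lt {σ τ : ℝ → ℝ} (hσ : ∀ ν ∈ I, ContinuousAt σ ν ∧ σ ν ∈ A ν)
    (hτ : ∀ ν ∈ I, ContinuousAt τ ν ∧ τ ν ∈ A ν) {ν₁ : ℝ} (hν₁ : ν₁ ∈ I) (h : σ ν₁ < τ ν₁)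
    {ν : ℝ} (hν : ν ∈ I) : σ ν < τ ν := by
  by_contra hle
  obtain ⟨x, hx, hxe⟩ := hc.isPreconnected.intermediate_value₂ hν₁ hν
    (fun y hy => (hσ y hy).1.continuousWithinAt) (fun y hy => (hτ y hy).1.continuousWithinAt)
    h.le (not_lt.1 hle)
  exact h.ne (Z.section_eq hID hI hc hIB hσ hτ hx hxe hν₁)

/-- A labelling of one fibre spreads along the continuous sections. -/
lemma exists_spread {ν₁ : ℝ} (hν₁ : ν₁ ∈ I) {L : Finset ℝ} {x : ℝ → ℝ}
    (h : IsLabelledBy (μ ν₁) (A ν₁) L x) :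
    ∃ f : ℝ → Finset ℝ × (ℝ → ℝ), f ν₁ = (L, x) ∧ ∀ ν ∈ I, IsLabellingAt B μ A N f ν := by
  have hex : ∀ r, ∃ σ : ℝ → ℝ, r ∈ L → σ ν₁ = x r ∧ ∀ ν ∈ I, ContinuousAt σ ν ∧ σ ν ∈ A ν := by
    intro r
    by_cases hr : r ∈ L
    · obtain ⟨σ, h1, h2⟩ := Z.exists_section hID hI hc hIB hν₁ (h.mem r hr)
      exact ⟨σ, fun _ => ⟨h1, h2⟩⟩
    · exact ⟨0, fun h' => absurd h' hr⟩
  choose τ hτ using hex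
  obtain ⟨σ, hσ, hσ0⟩ : ∃ σ : ℝ → ℝ → ℝ, (∀ r ∈ L, σ r = τ r) ∧ ∀ r ∉ L, σ r = 0 :=
    ⟨fun r => if r ∈ L then τ r else 0, fun r hr => if_pos hr, fun r hr => if_neg hr⟩
  have hσ1 : ∀ r ∈ L, σ r ν₁ = x r := fun r hr => by rw [hσ r hr]; exact (hτ r hr).1
  have hσ2 : ∀ r ∈ L, ∀ ν ∈ I, ContinuousAt (σ r) ν ∧ σ r ν ∈ A ν := fun r hr => by
    rw [hσ r hr]; exact (hτ r hr).2
  have hσ3 : ∀ n : ℤ, ∀ r ∈ L, ∀ ν ∈ I, ContinuousAt (fun ν => μ ν ^ n * σ r ν) ν ∧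
      μ ν ^ n * σ r ν ∈ A ν := fun n r hr ν hν =>
    ⟨(Z.cont_zpow (hID hν) n).mul (hσ2 r hr ν hν).1, Z.zpow_A ν (hID hν) _ (hσ2 r hr ν hν).2 n⟩
  refine ⟨fun ν => (L, fun r => σ r ν), Prod.ext rfl (funext fun r => ?_), fun ν hν =>
    ⟨⟨fun r hr => (hσ2 r hr ν hν).2, fun r hr r' hr' hlt => ?_, fun r hr r' hr' => ?_,
      fun y hy => ?_, fun r hr => ?_⟩, fun _ => Eventually.of_forall fun _ => rfl,
      fun r hr _ => ?_⟩⟩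
  · by_cases hr : r ∈ L
    · exact hσ1 r hr
    · change σ r ν₁ = x r
      rw [hσ0 r hr, h.support r hr]; rfl
  · exact Z.section_lt hID hI hc hIB (hσ2 r hr) (hσ2 r' hr') hν₁
      (by rw [hσ1 r hr, hσ1 r' hr']; exact h.strictMono hr hr' hlt) hν
  · have h1 := Z.section_lt hID hI hc hIB (hσ2 r hr) (hσ3 1 r' hr') hν₁
      (by rw [hσ1 r hr, hσ1 r' hr', zpow_one]; exact h.window r hr r' hr') hν
    rwa [zpow_one] at h1
  · obtain ⟨ρ, hρ, hρ'⟩ := Z.exists_section hID hI hc hIB hν hy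
    obtain ⟨n, r, hr, hry⟩ := h.exhaust _ (hρ' ν₁ hν₁).2
    refine ⟨n, r, hr, ?_⟩
    rw [← hρ]
    exact Z.section_eq hID hI hc hIB hρ' (hσ3 n r hr) hν₁ (by rw [hry, hσ1 r hr]) hν
  · change σ r ν = 0
    rw [hσ0 r hr]; rfl
  · filter_upwards [hI.mem_nhds hν] with ν' hν'
    exact ⟨hr, (hσ2 r hr ν' hν').1⟩

omit hI in
lemma labels_eq {f : ℝ → Finset ℝ × (ℝ → ℝ)} (hf : ∀ ν ∈ I, IsLabellingAt B μ A N f ν)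
    {ν ν' : ℝ} (hν : ν ∈ I) (hν' : ν' ∈ I) : (f ν').1 = (f ν).1 :=
  eq_of_eventually_eq (g := fun ν => (f ν).1) hc
    (fun x hx => (hf x hx).const (Set.disjoint_left.1 hIB hx)) hν hν'

omit hI in
/-- Over an interval without points of `B` the points with a given label form a continuous section.
-/
lemma labelled_section {f : ℝ → Finset ℝ × (ℝ → ℝ)} (hf : ∀ ν ∈ I, IsLabellingAt B μ A N f ν)
    {ν : ℝ} (hν : ν ∈ I) {r : ℝ} (hr : r ∈ (f ν).1) :
    ∀ ν' ∈ I, ContinuousAt (fun x => (f x).2 r) ν' ∧ (f ν').2 r ∈ A ν' := by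
  intro ν' hν'
  have hr' : r ∈ (f ν').1 := by rwa [Z.labels_eq hID hc hIB hf hν hν']
  have hA := (hf ν' hν').labelled.mem r hr'
  refine ⟨((hf ν' hν').persists r hr' ?_).self_of_nhds.2, hA⟩
  rwa [Z.eq_of_notMem ν' (hID hν') (Set.disjoint_left.1 hIB hν')]

lemma labelling_unique {f g : ℝ → Finset ℝ × (ℝ → ℝ)}
    (hf : ∀ ν ∈ I, IsLabellingAt B μ A N f ν) (hg : ∀ ν ∈ I, IsLabellingAt B μ A N g ν) {ν₁ : ℝ}
    (hν₁ : ν₁ ∈ I) (h : f ν₁ = g ν₁) : EqOn f g I := by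
  intro ν hν
  have h1 := Z.labels_eq hID hc hIB hf hν₁ hν
  have h2 := Z.labels_eq hID hc hIB hg hν₁ hν
  refine Prod.ext (by rw [h1, h2, h]) (funext fun r => ?_)
  by_cases hr : r ∈ (f ν₁).1
  · exact Z.section_eq hID hI hc hIB (Z.labelled_section hID hc hIB hf hν₁ hr)
      (Z.labelled_section hID hc hIB hg hν₁ (h ▸ hr)) hν₁ (by rw [h]) hν
  · rw [(hf ν hν).labelled.support r (h1 ▸ hr), (hg ν hν).labelled.support r (h2 ▸ h ▸ hr)]

end interval

/-- Two families of points of `A` with the same limit in `N` agree eventually. -/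
lemma eventuallyEq_of_tendsto {β y : ℝ} (hβ : β ∈ D) (hy : y ∈ N β) {l : Filter ℝ} (hl : l ≤ 𝓝 β)
    {p q : ℝ → ℝ} (hp : Tendsto p l (𝓝 y)) (hq : Tendsto q l (𝓝 y)) (hpA : ∀ᶠ ν in l, p ν ∈ A ν)
    (hqA : ∀ᶠ ν in l, q ν ∈ A ν) : p =ᶠ[l] q := by
  obtain ⟨α, -, -, huniq⟩ := Z.continuation β hβ y hy
  have h1 : Tendsto (fun ν => (ν, p ν)) l (𝓝 (β, y)) := by
    rw [nhds_prod_eq]; exact (tendsto_id.mono_right hl).prodMk hp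
  have h2 : Tendsto (fun ν => (ν, q ν)) l (𝓝 (β, y)) := by
    rw [nhds_prod_eq]; exact (tendsto_id.mono_right hl).prodMk hq
  filter_upwards [h1.eventually huniq, h2.eventually huniq, hpA, hqA] with ν h1 h2 h3 h4
  rw [h1 h3, h2 h4]

/-- A labelling on one side of a bifurcation value extends across it. -/
lemma exists_extension_across {β : ℝ} (hβ : β ∈ D) (hβB : β ∈ B) {U W : Set ℝ} (hU : IsOpen U)
    (hUc : U.OrdConnected) (hUD : U ⊆ D) (hUB : Disjoint U B) [NeBot (𝓝[U] β)] (hW : IsOpen W)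
    (hWc : W.OrdConnected) (hWD : W ⊆ D) (hWB : Disjoint W B) [NeBot (𝓝[W] β)] (hUW : Disjoint U W)
    (hnhds : insert β (U ∪ W) ∈ 𝓝 β) {f : ℝ → Finset ℝ × (ℝ → ℝ)}
    (hf : ∀ ν ∈ U, IsLabellingAt B μ A N f ν) :
    ∃ g, (∀ ν ∈ insert β (U ∪ W), IsLabellingAt B μ A N g ν) ∧ EqOn g f U := by
  classical
  have hβU : β ∉ U := fun h => Set.disjoint_left.1 hUB h hβB
  have hβW : β ∉ W := fun h => Set.disjoint_left.1 hWB h hβB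
  have hμβ := Z.one_lt β hβ
  have hU' : ∀ᶠ ν in 𝓝[U] β, ν ∈ U := self_mem_nhdsWithin
  have hW' : ∀ᶠ ν in 𝓝[W] β, ν ∈ W := self_mem_nhdsWithin
  obtain ⟨u, hu⟩ := hU'.exists
  set L := (f u).1 with hLdef
  have hL : ∀ ν ∈ U, (f ν).1 = L := fun ν hν => Z.labels_eq hUD hUc hUB hf hu hν
  have hsec : ∀ r ∈ L, ∀ ν ∈ U, ContinuousAt (fun x => (f x).2 r) ν ∧ (f ν).2 r ∈ A ν :=
    fun r hr => Z.labelled_section hUD hUc hUB hf hu hr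
  have hsecμ : ∀ n : ℤ, ∀ r ∈ L, ∀ ν ∈ U, ContinuousAt (fun x => μ x ^ n * (f x).2 r) ν ∧
      μ ν ^ n * (f ν).2 r ∈ A ν := fun n r hr ν hν =>
    ⟨(Z.cont_zpow (hUD hν) n).mul (hsec r hr ν hν).1,
      Z.zpow_A ν (hUD hν) _ (hsec r hr ν hν).2 n⟩
  -- the labels of the orbits that can be continued through the bifurcation
  set R := L.filter (fun r => ∃ y ∈ N β, Tendsto (fun x => (f x).2 r) (𝓝[U] β) (𝓝 y)) with hR
  have hRL : ∀ r ∈ R, r ∈ L := fun r hr => (Finset.mem_filter.1 hr).1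
  have hex : ∀ r, ∃ y, r ∈ R → y ∈ N β ∧ Tendsto (fun x => (f x).2 r) (𝓝[U] β) (𝓝 y) := by
    intro r
    by_cases hr : r ∈ R
    · obtain ⟨y, h1, h2⟩ := (Finset.mem_filter.1 hr).2
      exact ⟨y, fun _ => ⟨h1, h2⟩⟩
    · exact ⟨0, fun h => absurd h hr⟩
  choose y hy using hex
  have hyA : ∀ r ∈ R, y r ∈ A β := fun r hr => Z.sub β hβ (hy r hr).1
  have hmono : StrictMonoOn y R := by
    intro r hr r' hr' hlt
    have hlt' : ∀ᶠ ν in 𝓝[U] β, (f ν).2 r < (f ν).2 r' := hU'.mono fun ν hν =>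
      (hf ν hν).labelled.strictMono (by rw [hL ν hν]; exact hRL r hr)
        (by rw [hL ν hν]; exact hRL r' hr') hlt
    refine lt_of_le_of_ne (le_of_tendsto_of_tendsto (hy r hr).2 (hy r' hr').2
      (hlt'.mono fun ν h => h.le)) fun heq => ?_
    obtain ⟨ν, h1, h2⟩ := ((Z.eventuallyEq_of_tendsto hβ (hy r hr).1 nhdsWithin_le_nhds
      (hy r hr).2 (heq ▸ (hy r' hr').2) (hU'.mono fun ν hν => (hsec r (hRL r hr) ν hν).2)
      (hU'.mono fun ν hν => (hsec r' (hRL r' hr') ν hν).2)).and hlt').exists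
    exact h2.ne h1
  have hwin : ∀ r ∈ R, ∀ r' ∈ R, y r < μ β * y r' := by
    intro r hr r' hr'
    have hlt' : ∀ᶠ ν in 𝓝[U] β, (f ν).2 r < μ ν ^ (1 : ℤ) * (f ν).2 r' := hU'.mono fun ν hν => by
      rw [zpow_one]
      exact (hf ν hν).labelled.window r (by rw [hL ν hν]; exact hRL r hr) r'
        (by rw [hL ν hν]; exact hRL r' hr')
    have hlim : Tendsto (fun ν => μ ν ^ (1 : ℤ) * (f ν).2 r') (𝓝[U] β) (𝓝 (μ β * y r')) := by
      have := ((Z.cont_zpow hβ 1).tendsto.mono_left (nhdsWithin_le_nhds (s := U))).mul (hy r' hr').2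
      rwa [zpow_one] at this
    refine lt_of_le_of_ne (le_of_tendsto_of_tendsto (hy r hr).2 hlim
      (hlt'.mono fun ν h => h.le)) fun heq => ?_
    obtain ⟨ν, h1, h2⟩ := ((Z.eventuallyEq_of_tendsto hβ (hy r hr).1 nhdsWithin_le_nhds
      (hy r hr).2 (heq ▸ hlim) (hU'.mono fun ν hν => (hsec r (hRL r hr) ν hν).2)
      (hU'.mono fun ν hν => (hsecμ 1 r' (hRL r' hr') ν hν).2)).and hlt').exists
    exact h2.ne h1
  -- every continuable orbit at the bifurcation value comes from a labelled orbit
  have hcover : ∀ z ∈ N β, ∃ n : ℤ, ∃ r ∈ R, z = μ β ^ n * y r := by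
    intro z hz
    obtain ⟨α, hα0, hα, -⟩ := Z.continuation β hβ z hz
    obtain ⟨e, he, hball⟩ := Metric.eventually_nhds_iff_ball.1 hα
    have hUe : IsOpen (U ∩ Metric.ball β e) := hU.inter Metric.isOpen_ball
    have hUec : (U ∩ Metric.ball β e).OrdConnected := by
      rw [Real.ball_eq_Ioo]; exact hUc.inter ordConnected_Ioo
    have hball' : ∀ᶠ ν in 𝓝[U] β, ν ∈ U ∩ Metric.ball β e :=
      hU'.and (nhdsWithin_le_nhds (Metric.ball_mem_nhds β he))
    obtain ⟨ν₁, hν₁⟩ := hball'.exists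
    obtain ⟨n, r, hr, hrz⟩ := (hf ν₁ hν₁.1).labelled.exhaust _
      (Z.sub ν₁ (hUD hν₁.1) (hball ν₁ hν₁.2).2)
    rw [hL ν₁ hν₁.1] at hr
    have heq := Z.section_unique (inter_subset_left.trans hUD) hUe hUec
      (fun ν hν => hball ν hν.2) (fun ν hν => hsecμ n r hr ν hν.1) hν₁ hrz
    have hlim : Tendsto (fun ν => (f ν).2 r) (𝓝[U] β) (𝓝 (μ β ^ (-n) * z)) := by
      have h1 : Tendsto (fun ν => μ ν ^ (-n) * α ν) (𝓝[U] β) (𝓝 (μ β ^ (-n) * z)) := by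
        rw [← hα0]
        exact ((Z.cont_zpow hβ (-n)).mul hα.self_of_nhds.1).tendsto.mono_left nhdsWithin_le_nhds
      refine h1.congr' ?_
      filter_upwards [hball'] with ν hν
      have hm0 : 0 < μ ν := by linarith [Z.one_lt ν (hUD hν.1)]
      have h2 : α ν = μ ν ^ n * (f ν).2 r := heq hν
      rw [h2, ← mul_assoc, ← zpow_add₀ hm0.ne', neg_add_cancel, zpow_zero, one_mul]
    have hrR : r ∈ R := Finset.mem_filter.2 ⟨hr, _, Z.zpow_N β hβ z hz (-n), hlim⟩
    refine ⟨n, r, hrR, ?_⟩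
    rw [tendsto_nhds_unique (hy r hrR).2 hlim, ← mul_assoc,
      ← zpow_add₀ (by linarith : μ β ≠ 0), add_neg_cancel, zpow_zero, one_mul]
  obtain ⟨Lβ, yβ, hRLβ, hyβ, hlab⟩ := Z.exists_labelled hβ R y hyA hmono hwin
  have hNR : ∀ r ∈ Lβ, yβ r ∈ N β → r ∈ R := by
    intro r hr hrN
    obtain ⟨n, r', hr', hrr'⟩ := hcover _ hrN
    rw [← hyβ hr'] at hrr'
    rw [(hlab.unique hμβ (Z.pos β hβ) hr (hRLβ hr') hrr').2]
    exact hr'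
  -- the continuable orbits on the other side
  have hexα : ∀ r, ∃ α : ℝ → ℝ, r ∈ R → α β = y r ∧
      (∀ᶠ ν in 𝓝 β, ContinuousAt α ν ∧ α ν ∈ N ν) := by
    intro r
    by_cases hr : r ∈ R
    · obtain ⟨α, h1, h2, -⟩ := Z.continuation β hβ (y r) (hy r hr).1
      exact ⟨α, fun _ => ⟨h1, h2⟩⟩
    · exact ⟨0, fun h => absurd h hr⟩
  choose α hα using hexα
  have hαc : ∀ r ∈ R, ContinuousAt (α r) β := fun r hr => (hα r hr).2.self_of_nhds.1
  have g1 : ∀ᶠ ν in 𝓝 β, ∀ r ∈ R, ContinuousAt (α r) ν ∧ α r ν ∈ N ν :=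
    (Finset.eventually_all R).2 fun r hr => (hα r hr).2
  have g2 : ∀ᶠ ν in 𝓝 β, ∀ r ∈ R, ∀ r' ∈ R, r < r' → α r ν < α r' ν := by
    refine (Finset.eventually_all R).2 fun r hr => (Finset.eventually_all R).2 fun r' hr' => ?_
    by_cases hlt : r < r'
    · have := (hαc r hr).eventually_lt (hαc r' hr')
        (by rw [(hα r hr).1, (hα r' hr').1]; exact hmono hr hr' hlt)
      exact this.mono fun ν h _ => h
    · exact Eventually.of_forall fun ν h => absurd h hlt
  have g3 : ∀ᶠ ν in 𝓝 β, ∀ r ∈ R, ∀ r' ∈ R, α r ν < μ ν * α r' ν := by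
    refine (Finset.eventually_all R).2 fun r hr => (Finset.eventually_all R).2 fun r' hr' => ?_
    exact (hαc r hr).eventually_lt ((Z.cont_μ β hβ).mul (hαc r' hr'))
      (by rw [(hα r hr).1, (hα r' hr').1]; exact hwin r hr r' hr')
  obtain ⟨e, he, hball⟩ := Metric.eventually_nhds_iff_ball.1 (g1.and (g2.and g3))
  have hWe : IsOpen (W ∩ Metric.ball β e) := hW.inter Metric.isOpen_ball
  have hWec : (W ∩ Metric.ball β e).OrdConnected := by
    rw [Real.ball_eq_Ioo]; exact hWc.inter ordConnected_Ioo
  obtain ⟨ν₁, hν₁⟩ := (hW'.and (nhdsWithin_le_nhds (Metric.ball_mem_nhds β he))).exists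
  have hν₁D := hWD hν₁.1
  obtain ⟨L₁, x₁, hRL₁, hx₁, hlab₁⟩ := Z.exists_labelled hν₁D R (fun r => α r ν₁)
    (fun r hr => Z.sub ν₁ hν₁D ((hball ν₁ hν₁.2).1 r hr).2)
    (fun r hr r' hr' hlt => (hball ν₁ hν₁.2).2.1 r hr r' hr' hlt) (hball ν₁ hν₁.2).2.2
  obtain ⟨fW, hfW₁, hfW⟩ := Z.exists_spread hWD hW hWc hWB hν₁.1 hlab₁
  have hRW : ∀ r ∈ R, r ∈ (fW ν₁).1 := fun r hr => by rw [hfW₁]; exact hRL₁ hr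
  have hsecW : ∀ r ∈ R, ∀ ν ∈ W, ContinuousAt (fun x => (fW x).2 r) ν ∧ (fW ν).2 r ∈ A ν :=
    fun r hr => Z.labelled_section hWD hWc hWB hfW hν₁.1 (hRW r hr)
  have hαW : ∀ r ∈ R, ∀ ν ∈ W ∩ Metric.ball β e, α r ν = (fW ν).2 r := by
    intro r hr ν hν
    exact Z.section_unique (inter_subset_left.trans hWD) hWe hWec
      (fun ν hν => (hball ν hν.2).1 r hr) (fun ν hν => hsecW r hr ν hν.1) hν₁
      (by rw [hfW₁]; exact (hx₁ hr).symm) hν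
  set g : ℝ → Finset ℝ × (ℝ → ℝ) := fun ν =>
    if ν ∈ U then f ν else if ν = β then (Lβ, yβ) else fW ν with hg
  have hgU : EqOn g f U := fun ν hν => if_pos hν
  have hgβ : g β = (Lβ, yβ) := (if_neg hβU).trans (if_pos rfl)
  have hgW : EqOn g fW W := fun ν hν =>
    (if_neg (Set.disjoint_right.1 hUW hν)).trans (if_neg fun h : ν = β => hβW (h ▸ hν))
  have evU : ∀ ν ∈ U, f =ᶠ[𝓝 ν] g := fun ν hν =>
    eventually_of_mem (hU.mem_nhds hν) fun x hx => (hgU hx).symm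
  have evW : ∀ ν ∈ W, fW =ᶠ[𝓝 ν] g := fun ν hν =>
    eventually_of_mem (hW.mem_nhds hν) fun x hx => (hgW hx).symm
  refine ⟨g, ?_, hgU⟩
  rintro ν (rfl | hν | hν)
  · refine ⟨by rw [hgβ]; exact hlab, fun h => absurd hβB h, fun r hr hrN => ?_⟩
    rw [hgβ] at hr hrN
    have hrR := hNR r hr hrN
    have hleft : ∀ᶠ x in 𝓝 ν, x ∈ U → (f x).2 r = α r x := by
      rw [← eventually_nhdsWithin_iff]
      refine Z.eventuallyEq_of_tendsto hβ (hy r hrR).1 nhdsWithin_le_nhds (hy r hrR).2 ?_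
        (hU'.mono fun x hx => (hsec r (hRL r hrR) x hx).2)
        (nhdsWithin_le_nhds ((hα r hrR).2.and (Z.isOpen.mem_nhds hβ) |>.mono
          fun x hx => Z.sub x hx.2 hx.1.2))
      rw [← (hα r hrR).1]
      exact (hαc r hrR).tendsto.mono_left nhdsWithin_le_nhds
    have hgα : α r =ᶠ[𝓝 ν] fun x => (g x).2 r := by
      filter_upwards [hnhds, hleft, Metric.ball_mem_nhds ν he] with x hx hl hxe
      rcases hx with rfl | hx | hx
      · rw [hgβ, (hα r hrR).1]; exact (hyβ hrR).symm
      · rw [hgU hx, hl hx]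
      · rw [hgW hx]; exact hαW r hrR x ⟨hx, hxe⟩
    filter_upwards [hnhds] with x hx
    rcases hx with rfl | hx | hx
    · exact ⟨by rw [hgβ]; exact hr, (hαc r hrR).congr hgα⟩
    · refine ⟨by rw [hgU hx, hL x hx]; exact hRL r hrR, ?_⟩
      exact (hsec r (hRL r hrR) x hx).1.congr ((evU x hx).mono fun z hz => by beta_reduce; rw [hz])
    · refine ⟨by rw [hgW hx, Z.labels_eq hWD hWc hWB hfW hν₁.1 hx]; exact hRW r hrR, ?_⟩
      exact (hsecW r hrR x hx).1.congr ((evW x hx).mono fun z hz => by beta_reduce; rw [hz])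
  · exact (hf ν hν).congr (evU ν hν)
  · exact (hfW ν hν).congr (evW ν hν)

/-- Every parameter has an interval neighbourhood that contains no other point of `B`. -/
lemma exists_isolating {β ε : ℝ} (hβ : β ∈ D) (hε : 0 < ε) :
    ∃ δ > 0, δ ≤ ε ∧ Ioo (β - δ) (β + δ) ⊆ D ∧ ∀ ν ∈ Ioo (β - δ) (β + δ), ν ≠ β → ν ∉ B := by
  have hfin : ((B ∩ Ioo (β - 1) (β + 1)) \ {β}).Finite := (Z.finite_B _ _).subset sdiff_subset
  have h1 : ((B ∩ Ioo (β - 1) (β + 1)) \ {β})ᶜ ∈ 𝓝 β :=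
    hfin.isClosed.isOpen_compl.mem_nhds fun h => h.2 rfl
  obtain ⟨e, he, hball⟩ := Metric.mem_nhds_iff.1 (inter_mem h1 (Z.isOpen.mem_nhds hβ))
  rw [Real.ball_eq_Ioo] at hball
  refine ⟨min e (min ε 1), by positivity, (min_le_right _ _).trans (min_le_left _ _), ?_, ?_⟩
  · exact fun ν hν => (hball ⟨by linarith [hν.1, min_le_left e (min ε 1)],
      by linarith [hν.2, min_le_left e (min ε 1)]⟩).2
  · intro ν hν hne hB
    have h2 : min e (min ε 1) ≤ 1 := (min_le_right _ _).trans (min_le_right _ _)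
    exact (hball ⟨by linarith [hν.1, min_le_left e (min ε 1)],
      by linarith [hν.2, min_le_left e (min ε 1)]⟩).1
      ⟨⟨hB, by linarith [hν.1], by linarith [hν.2]⟩, hne⟩

/-- Every branch system has a labelling. -/
theorem exists_labelling :
    ∃ f : ℝ → Finset ℝ × (ℝ → ℝ), ∀ ν ∈ D, IsLabellingAt B μ A N f ν := by
  rcases D.eq_empty_or_nonempty with hD | ⟨ν₀, hν₀⟩
  · exact ⟨fun _ => (∅, 0), fun ν hν => absurd (hD ▸ hν) (notMem_empty ν)⟩
  obtain ⟨δ₀, hδ₀, -, hsub₀, hiso₀⟩ := Z.exists_isolating hν₀ one_pos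
  have hJ₀ : Ioo ν₀ (ν₀ + δ₀) ⊆ Ioo (ν₀ - δ₀) (ν₀ + δ₀) := Ioo_subset_Ioo_left (by linarith)
  have hJB : Disjoint (Ioo ν₀ (ν₀ + δ₀)) B :=
    Set.disjoint_left.2 fun x hx => hiso₀ x (hJ₀ hx) hx.1.ne'
  have hν₁ : ν₀ + δ₀ / 2 ∈ Ioo ν₀ (ν₀ + δ₀) := ⟨by linarith, by linarith⟩
  obtain ⟨L, x, -, -, hlab⟩ := Z.exists_labelled (hsub₀ (hJ₀ hν₁)) ∅ 0 (by simp)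
    (fun a ha => absurd ha (by simp)) (by simp)
  obtain ⟨f₀, -, hf₀⟩ := Z.exists_spread (hJ₀.trans hsub₀) isOpen_Ioo ordConnected_Ioo hJB hν₁ hlab
  obtain ⟨f, hf, -⟩ := exists_extension_of_local Z.ordConnected (Q := IsLabellingAt B μ A N)
    (fun f g ν hfg hf => hf.congr hfg) (by
      intro β hβ ε hε
      obtain ⟨δ, hδ, hδε, hsub, hiso⟩ := Z.exists_isolating hβ hε
      refine ⟨δ, hδ, hδε, hsub, fun U hU f hf => ?_⟩
      have hl : Ioo (β - δ) β ⊆ Ioo (β - δ) (β + δ) := Ioo_subset_Ioo_right (by linarith)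
      have hr : Ioo β (β + δ) ⊆ Ioo (β - δ) (β + δ) := Ioo_subset_Ioo_left (by linarith)
      have hlB : Disjoint (Ioo (β - δ) β) B :=
        Set.disjoint_left.2 fun x hx => hiso x (hl hx) hx.2.ne
      have hrB : Disjoint (Ioo β (β + δ)) B :=
        Set.disjoint_left.2 fun x hx => hiso x (hr hx) hx.1.ne'
      have hn₁ : NeBot (𝓝[Ioo (β - δ) β] β) := by
        rw [nhdsWithin_Ioo_eq_nhdsLT (by linarith)]; infer_instance
      have hn₂ : NeBot (𝓝[Ioo β (β + δ)] β) := by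
        rw [nhdsWithin_Ioo_eq_nhdsGT (by linarith)]; infer_instance
      have hun : insert β (Ioo (β - δ) β ∪ Ioo β (β + δ)) = Ioo (β - δ) (β + δ) := by
        rw [← union_singleton, union_assoc, union_comm _ {β}, ← union_assoc,
          union_singleton, Ioo_insert_right (by linarith), Ioc_union_Ioo_eq_Ioo (by linarith)
          (by linarith)]
      have hnh : Ioo (β - δ) (β + δ) ∈ 𝓝 β := Ioo_mem_nhds (by linarith) (by linarith)
      have hd : Disjoint (Ioo (β - δ) β) (Ioo β (β + δ)) :=
        Set.disjoint_left.2 fun x h1 h2 => lt_asymm h1.2 h2.1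
      by_cases hβB : β ∈ B
      · rcases hU with rfl | rfl
        · rw [← hun]
          exact Z.exists_extension_across hβ hβB isOpen_Ioo ordConnected_Ioo (hl.trans hsub) hlB
            isOpen_Ioo ordConnected_Ioo (hr.trans hsub) hrB hd (hun ▸ hnh) hf
        · rw [← hun, union_comm]
          rw [union_comm] at hun
          exact Z.exists_extension_across hβ hβB isOpen_Ioo ordConnected_Ioo (hr.trans hsub) hrB
            isOpen_Ioo ordConnected_Ioo (hl.trans hsub) hlB hd.symm (hun ▸ hnh) hf
      · have hVB : Disjoint (Ioo (β - δ) (β + δ)) B := Set.disjoint_left.2 fun x hx => by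
          by_cases h : x = β
          · rwa [h]
          · exact hiso x hx h
        obtain ⟨hUo, hUc, hUV, ⟨u, hu⟩⟩ : IsOpen U ∧ U.OrdConnected ∧
            U ⊆ Ioo (β - δ) (β + δ) ∧ U.Nonempty := by
          rcases hU with rfl | rfl
          · exact ⟨isOpen_Ioo, ordConnected_Ioo, hl, nonempty_Ioo.2 (by linarith)⟩
          · exact ⟨isOpen_Ioo, ordConnected_Ioo, hr, nonempty_Ioo.2 (by linarith)⟩
        obtain ⟨g, hgu, hg⟩ := Z.exists_spread hsub isOpen_Ioo ordConnected_Ioo hVB (hUV hu)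
          (hf u hu).labelled
        exact ⟨g, hg, Z.labelling_unique (hUV.trans hsub) hUo hUc (hVB.mono_left hUV)
          (fun ν hν => hg ν (hUV hν)) hf hu hgu⟩)
    isOpen_Ioo ordConnected_Ioo ⟨_, hν₁⟩ (hJ₀.trans hsub₀) hf₀
  exact ⟨f, hf⟩

end BranchSystem

/-! ### The labelling of the primary homoclinic orbits -/

section final

variable {𝓗 : Family} {S : Saddle} {k : WithTop ℕ∞} {μ l : ℝ → ℝ} {c s : ℝ → ℝ → Plane}

lemma ordConnected_posParams (𝓗 : Family) : 𝓗.posParams.OrdConnected :=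
  ⟨fun _ hx _ hy _ hz => ⟨hx.1.trans_le hz.1, (EReal.coe_le_coe_iff.2 hz.2).trans_lt hy.2⟩⟩

/-- The primary homoclinic points, in the parameters of the unstable manifolds, form a branch
system. -/
lemma ManifoldParams.branchSystem (M : ManifoldParams 𝓗 S μ l c s)
    (h : IsFrequencySpanning 𝓗 S k) :
    BranchSystem 𝓗.posParams (bifValues 𝓗 S) μ (primaryParams 𝓗 S c) (simpleParams 𝓗 S c) where
  isOpen := isOpen_posParams 𝓗
  ordConnected := ordConnected_posParams 𝓗
  one_lt := M.one_lt
  cont_μ := M.cont_μ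
  sub _ _ _ ha := ha.1
  pos _ _ _ ha := ha.1
  nonempty _ hν := M.primaryParams_nonempty h hν
  zpow_A _ hν _ ha n := M.mem_primaryParams_zpow h hν ha n
  zpow_N _ hν _ ha n := M.mem_simpleParams_zpow h hν ha n
  finite _ hν x := M.finite_primaryParams h hν x
  continuation _ hν _ ha := M.exists_continuation h hν ha
  eq_of_notMem _ hν hB := M.simpleParams_eq h hν hB
  closed _ hν hB _ h0 ha := M.eventually_notMem h hν hB h0 ha
  finite_B := h.bifurcations

end final

end FreqSpan

end

theorem mainTheorem4 (𝓗 : FreqSpan.Family) (S : FreqSpan.Saddle) (k : WithTop ℕ∞)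
    (h : FreqSpan.IsFrequencySpanning 𝓗 S k) :
    ∃ (Lbl : ℝ → Finset ℝ) (p : ℝ → ℝ → FreqSpan.Plane),
      FreqSpan.IsLabelling 𝓗 S Lbl p ∧
      FreqSpan.IsPiecewiseConstant 𝓗 S Lbl p ∧
      FreqSpan.RespectsUnstableOrder 𝓗 S Lbl p := by
  obtain ⟨μ, l, c, s, M⟩ := FreqSpan.exists_manifoldParams h
  obtain ⟨f, hf⟩ := (M.branchSystem h).exists_labelling
  have hA : ∀ ν ∈ 𝓗.posParams, ∀ r ∈ (f ν).1, (f ν).2 r ∈ FreqSpan.primaryParams 𝓗 S c ν :=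
    fun ν hν => (hf ν hν).labelled.mem
  have hpos : ∀ ν ∈ 𝓗.posParams, ∀ r ∈ (f ν).1, 0 < (f ν).2 r := fun ν hν r hr => (hA ν hν r hr).1
  refine ⟨fun ν => (f ν).1, fun ν r => c ν ((f ν).2 r), ⟨fun ν hν r hr => (hA ν hν r hr).2, ?_⟩,
    ⟨?_, ?_⟩, ⟨?_, ?_⟩⟩
  · intro ν hν z hz
    obtain ⟨y, hy0, -, -, rfl, -⟩ := (M.isHomoclinic_iff hν).1 hz.1.1
    have hlab := (hf ν hν).labelled
    obtain ⟨n, r, hr, rfl⟩ := hlab.exhaust y ⟨hy0, hz⟩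
    refine ⟨r, ⟨hr, n, (M.map_iter_u hν h n _).symm⟩, ?_⟩
    rintro r' ⟨hr', n', hn'⟩
    rw [M.map_iter_u hν h] at hn'
    have h1 := M.inj_u hν hn'
    have hμ0 : μ ν ≠ 0 := by linarith [M.one_lt ν hν]
    refine (hlab.unique (M.one_lt ν hν) (fun a ha => ha.1) hr' hr (n := -n' + n) ?_).2
    rw [zpow_add₀ hμ0, mul_assoc, h1, ← mul_assoc, ← zpow_add₀ hμ0, neg_add_cancel, zpow_zero,
      one_mul]
  · intro a b hab hB ν hν ν' hν'
    exact FreqSpan.eq_of_eventually_eq (g := fun ν => (f ν).1) ordConnected_Ioo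
      (fun x hx => (hf x (hab hx)).const fun hxB => (hB ▸ ⟨hx, hxB⟩ : x ∈ (∅ : Set ℝ))) hν' hν
  · intro ν₀ hν₀ r hr ht
    filter_upwards [(hf ν₀ hν₀).persists r hr ⟨hA ν₀ hν₀ r hr, ht⟩,
      (FreqSpan.isOpen_posParams 𝓗).mem_nhds hν₀] with ν hν hνD
    exact ⟨hν.1, ContinuousAt.comp (g := fun q : ℝ × ℝ => c q.1 q.2)
      (f := fun ν => (ν, (f ν).2 r)) (M.cont_u ν hνD _) (continuousAt_id.prodMk hν.2)⟩
  · intro ν hν r hr r' hr'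
    rw [M.closedU_ssubset_iff hν (hpos ν hν r hr) (hpos ν hν r' hr')]
    exact ((hf ν hν).labelled.strictMono.lt_iff_lt hr hr').symm
  · intro ν hν r hr r' hr'
    have h1 : 𝓗.poincare ν 0 (c ν ((f ν).2 r')) = c ν (μ ν * (f ν).2 r') := by
      rw [← FreqSpan.iter_one, M.map_u ν hν]
    rw [h1, M.closedU_ssubset_iff hν (hpos ν hν r hr)
      (mul_pos (by linarith [M.one_lt ν hν]) (hpos ν hν r' hr'))]
    exact (hf ν hν).labelled.window r hr r' hr'
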